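/- Let $\mathcal D\subset L^2(\mathbb R)$ be the subspace of Schwartz functions, let $P=-i\,d/dx$ and $Q$ (multiplication by $x$) be the momentum and position operators on $\mathcal D$, and let $H_0=P^2$ on $\mathcal D$. Let $\mathcal R\subset\mathcal B(L^2(\mathbb R))$ be the resolvent algebra, i.e. the C*-algebra generated by the resolvents $(ic\,1+aP+bQ)^{-1}$ with $a,b\in\mathbb R$, $c\in\mathbb R\setminus\{0\}$, where $aP+bQ$ stands for the closure of this operator on $\mathcal D$. Let $0<\kappa<1/2$ and $g\in\mathbb R$, and let $V(x)=g\,|x|^{-\kappa}$ for $x\in\mathbb R\setminus\{0\}$, $V(0)=0$. Then the multiplication operator $V=V(Q)$ is defined on $\mathcal D$, and the Hamiltonian $H=H_0+V$ is essentially self-adjoint on $\mathcal D$. Moreover, with $e^{itH_0}$ and $e^{itH}$ denoting the strongly continuous one-parameter unitary groups generated by the closures of $H_0$ and $H$, the operator $e^{itH}e^{-itH_0}-1$ is compact for every $t\in\mathbb R$. Hence $\mathcal R$ is stable under the adjoint action of $e^{itH}$: $e^{itH}\,\mathcal R\,e^{-itH}=\mathcal R$ for every $t\in\mathbb R$. 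-/

import Mathlib

noncomputable section

open MeasureTheory Complex
open scoped SchwartzMap InnerProductSpace

namespace ResolventAlgebra

/-- The Hilbert space `L²(ℝ)` of the Schrödinger representation. -/
abbrev L2R : Type := Lp ℂ 2 (volume : Measure ℝ)

/-- Bounded operators on `L²(ℝ)`. -/
abbrev BoundedOp : Type := L2R →L[ℂ] L2R

/-- The inclusion of the Schwartz functions into `L²(ℝ)`. -/
def schwartzIncl : 𝓢(ℝ, ℂ) →ₗ[ℂ] L2R :=
  (SchwartzMap.toLpCLM ℂ ℂ 2 (volume : Measure ℝ)).toLinearMap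

theorem schwartzIncl_injective : Function.Injective schwartzIncl :=
  SchwartzMap.injective_toLp 2 volume

/-- The domain `𝓓 ⊆ L²(ℝ)` consisting of the (classes of) Schwartz functions. -/
def schwartzDomain : Submodule ℂ L2R := LinearMap.range schwartzIncl

/-- A linear map of Schwartz functions to themselves,
regarded as an unbounded operator on `L²(ℝ)` with domain `𝓓`. -/
def schwartzOp (A : 𝓢(ℝ, ℂ) →ₗ[ℂ] 𝓢(ℝ, ℂ)) : L2R →ₗ.[ℂ] L2R where
  domain := schwartzDomain
  toFun := schwartzIncl ∘ₗ A ∘ₗ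
    (LinearEquiv.ofInjective schwartzIncl schwartzIncl_injective).symm.toLinearMap

theorem schwartzOp_apply (A : 𝓢(ℝ, ℂ) →ₗ[ℂ] 𝓢(ℝ, ℂ)) (f : 𝓢(ℝ, ℂ)) :
    schwartzOp A ⟨schwartzIncl f, LinearMap.mem_range_self _ f⟩ = schwartzIncl (A f) := by
  have h : (LinearEquiv.ofInjective schwartzIncl schwartzIncl_injective).symm
      ⟨schwartzIncl f, LinearMap.mem_range_self _ f⟩ = f := by
    rw [LinearEquiv.symm_apply_eq]; rfl
  change schwartzIncl (A ((LinearEquiv.ofInjective schwartzIncl schwartzIncl_injective).symm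
      ⟨schwartzIncl f, LinearMap.mem_range_self _ f⟩)) = _
  rw [h]

/-- `f ↦ -i f'` on Schwartz functions. -/
def momentumSchwartz : 𝓢(ℝ, ℂ) →ₗ[ℂ] 𝓢(ℝ, ℂ) :=
  (-I) • (SchwartzMap.derivCLM ℂ ℂ).toLinearMap

theorem momentumSchwartz_apply (f : 𝓢(ℝ, ℂ)) (x : ℝ) :
    momentumSchwartz f x = -I * deriv f x := rfl

/-- `f ↦ (x ↦ x f(x))` on Schwartz functions. -/
def positionSchwartz : 𝓢(ℝ, ℂ) →ₗ[ℂ] 𝓢(ℝ, ℂ) :=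
  (SchwartzMap.smulLeftCLM ℂ (fun x : ℝ => (x : ℂ))).toLinearMap

theorem positionSchwartz_apply (f : 𝓢(ℝ, ℂ)) (x : ℝ) :
    positionSchwartz f x = (x : ℂ) * f x :=
  congrFun (SchwartzMap.smulLeftCLM_apply (by fun_prop) f) x

/-- The momentum operator `P` on `𝓓`. -/
def momentum : L2R →ₗ.[ℂ] L2R := schwartzOp momentumSchwartz

/-- The position operator `Q` on `𝓓`. -/
def position : L2R →ₗ.[ℂ] L2R := schwartzOp positionSchwartz

/-- The free Hamiltonian `H₀ = P²` on `𝓓`. -/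
def freeHamiltonian : L2R →ₗ.[ℂ] L2R := schwartzOp (momentumSchwartz ∘ₗ momentumSchwartz)

/-- The operator `V(Q)` of multiplication by a function `V`, on its natural domain
of all `f ∈ L²(ℝ)` with `V f ∈ L²(ℝ)`. -/
def potential (V : ℝ → ℝ) : L2R →ₗ.[ℂ] L2R where
  domain :=
    { carrier := {f | MemLp (fun x => (V x : ℂ) * f x) 2 volume}
      zero_mem' := by
        refine (memLp_congr_ae ?_).mpr (MemLp.zero (ε := ℂ))
        filter_upwards [Lp.coeFn_zero ℂ 2 (volume : Measure ℝ)] with x hx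
        change (V x : ℂ) * (0 : L2R) x = 0
        rw [hx, Pi.zero_apply, mul_zero]
      add_mem' := by
        intro f g hf hg
        refine (memLp_congr_ae ?_).mpr (MemLp.add hf hg)
        filter_upwards [Lp.coeFn_add f g] with x hx
        rw [hx, Pi.add_apply, mul_add]; rfl
      smul_mem' := by
        intro c f hf
        refine (memLp_congr_ae ?_).mpr (MemLp.const_smul hf c)
        filter_upwards [Lp.coeFn_smul c f] with x hx
        simp [hx, mul_left_comm] }
  toFun :=
    { toFun := fun f => MemLp.toLp (fun x => (V x : ℂ) * (f : L2R) x) f.2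
      map_add' := by
        intro f g
        rw [← MemLp.toLp_add]
        refine MemLp.toLp_congr _ _ ?_
        filter_upwards [Lp.coeFn_add (f : L2R) (g : L2R)] with x hx
        change (V x : ℂ) * ((f : L2R) + (g : L2R)) x = _
        rw [hx, Pi.add_apply, mul_add]; rfl
      map_smul' := by
        intro c f
        rw [RingHom.id_apply, ← MemLp.toLp_const_smul]
        refine MemLp.toLp_congr _ _ ?_
        filter_upwards [Lp.coeFn_smul c (f : L2R)] with x hx
        simp [hx, mul_left_comm] }

/-- The Hamiltonian `H = H₀ + V(Q)`, with the operator sum's domain `𝓓 ∩ dom V(Q)`. -/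
def hamiltonian (V : ℝ → ℝ) : L2R →ₗ.[ℂ] L2R := freeHamiltonian + potential V

/-- Essential self-adjointness of an unbounded operator (on its own domain):
it is closable and its closure is self-adjoint. -/
def IsEssentiallySelfAdjoint (T : L2R →ₗ.[ℂ] L2R) : Prop :=
  T.IsClosable ∧ IsSelfAdjoint T.closure

/-- `U` is a strongly continuous one-parameter group of unitaries with infinitesimal
generator `A`, i.e. `U t = e^{itA}`: a vector `ψ` is in the domain of `A` with `A ψ = φ` exactly if
`t ↦ U t ψ` is differentiable at `0` with derivative `i φ`. -/
structure IsUnitaryGroupOf (U : ℝ → BoundedOp) (A : L2R →ₗ.[ℂ] L2R) : Prop where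
  unitary : ∀ t, U t ∈ unitary BoundedOp
  zero : U 0 = 1
  add : ∀ s t, U (s + t) = U s * U t
  continuous : ∀ ψ, Continuous fun t => U t ψ
  generator : ∀ ψ φ, (ψ, φ) ∈ A.graph ↔ HasDerivAt (fun t => U t ψ) (I • φ) 0

namespace IsUnitaryGroupOf

variable {U U' : ℝ → BoundedOp} {A : L2R →ₗ.[ℂ] L2R}

theorem norm_apply (h : IsUnitaryGroupOf U A) (t : ℝ) (ψ : L2R) : ‖U t ψ‖ = ‖ψ‖ :=
  _root_.Unitary.norm_map ⟨U t, h.unitary t⟩ ψ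

theorem hasDerivAt (h : IsUnitaryGroupOf U A) {ψ φ : L2R} (hψ : (ψ, φ) ∈ A.graph) (t : ℝ) :
    HasDerivAt (fun s => U s ψ) (U t (I • φ)) t := by
  have h0 := ((U t).restrictScalars ℝ).hasFDerivAt.comp_hasDerivAt (0 : ℝ) ((h.generator ψ φ).1 hψ)
  have h1 : HasDerivAt (fun s => U t (U s ψ)) (U t (I • φ)) (t - t) := by
    rw [sub_self]; exact h0
  have h2 := HasDerivAt.scomp (h := fun s : ℝ => s - t) t h1 ((hasDerivAt_id t).sub_const t)
  rw [one_smul] at h2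
  refine h2.congr_of_eventuallyEq (Filter.Eventually.of_forall fun s => ?_)
  have : U s = U t * U (s - t) := by rw [← h.add]; congr 1; ring
  simp [this]

theorem mem_graph (h : IsUnitaryGroupOf U A) {ψ φ : L2R} (hψ : (ψ, φ) ∈ A.graph) (t : ℝ) :
    (U t ψ, U t φ) ∈ A.graph := by
  rw [h.generator]
  have h0 := ((U t).restrictScalars ℝ).hasFDerivAt.comp_hasDerivAt (0 : ℝ) ((h.generator ψ φ).1 hψ)
  change HasDerivAt _ (U t (I • φ)) 0 at h0
  rw [map_smul] at h0
  refine h0.congr_of_eventuallyEq (Filter.Eventually.of_forall fun s => ?_)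
  have : U s * U t = U t * U s := by rw [← h.add, ← h.add, add_comm]
  exact congrArg (fun B : BoundedOp => B ψ) this

/-- The group `e^{itA}` is determined by its densely defined generator `A`. -/
theorem unique (h : IsUnitaryGroupOf U A) (h' : IsUnitaryGroupOf U' A)
    (hA : Dense (A.domain : Set L2R)) : U = U' := by
  have key : ∀ t, ∀ ψ ∈ A.domain, U t ψ = U' t ψ := by
    intro t ψ hψ
    have hg : (ψ, A ⟨ψ, hψ⟩) ∈ A.graph := A.mem_graph ⟨ψ, hψ⟩
    set φ := A ⟨ψ, hψ⟩
    let w : ℝ → L2R := fun s => U s ψ - U' s ψ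
    let v : ℝ → L2R := fun s => U s φ - U' s φ
    have hw : ∀ s, HasDerivAt w (I • v s) s := by
      intro s
      have h1 := (h.hasDerivAt hg s).sub (h'.hasDerivAt hg s)
      have h2 : I • v s = U s (I • φ) - U' s (I • φ) := by simp [v, smul_sub]
      rw [h2]; exact h1
    have hwv : ∀ s, (w s, v s) ∈ A.graph := fun s =>
      A.graph.sub_mem (h.mem_graph hg s) (h'.mem_graph hg s)
    have hsym : ∀ s, (⟪w s, I • v s⟫_ℂ).re = 0 := by
      intro s
      have h1 := (h.generator _ _).1 (hwv s)
      have h2 := h1.inner ℂ h1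
      have h3 : (fun r => ⟪U r (w s), U r (w s)⟫_ℂ) = fun _ => ⟪w s, w s⟫_ℂ := by
        funext r
        simp only [inner_self_eq_norm_sq_to_K, h.norm_apply]
      rw [h3] at h2
      have h4 := h2.unique (hasDerivAt_const (0 : ℝ) _)
      rw [h.zero] at h4
      have h5 := congrArg Complex.re h4
      have h6 : (⟪I • v s, w s⟫_ℂ).re = (⟪w s, I • v s⟫_ℂ).re := by
        rw [← inner_conj_symm (I • v s) (w s), conj_re]
      simp only [one_apply_eq_self, add_re, zero_re] at h5
      rw [h6] at h5
      linarith
    have hconst : ∀ s, HasDerivAt (fun r => (⟪w r, w r⟫_ℂ).re) 0 s := by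
      intro s
      have h2 := (hw s).inner ℂ (hw s)
      have h3 := Complex.reCLM.hasFDerivAt.comp_hasDerivAt s h2
      have h6 : (⟪I • v s, w s⟫_ℂ).re = (⟪w s, I • v s⟫_ℂ).re := by
        rw [← inner_conj_symm (I • v s) (w s), conj_re]
      have h7 : Complex.reCLM (⟪w s, I • v s⟫_ℂ + ⟪I • v s, w s⟫_ℂ) = 0 := by
        rw [Complex.reCLM_apply, add_re, h6, hsym, add_zero]
      rw [h7] at h3
      exact h3
    have h8 := is_const_of_deriv_eq_zero (fun s => (hconst s).differentiableAt)
      (fun s => (hconst s).deriv) t 0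
    have h9 : w 0 = 0 := by simp [w, h.zero, h'.zero]
    simp only [h9, inner_zero_right, zero_re] at h8
    have h10 : w t = 0 := by
      rw [← inner_self_eq_zero (𝕜 := ℂ), ← inner_self_ofReal_re]
      simpa using h8
    exact sub_eq_zero.1 h10
  funext t
  exact ContinuousLinearMap.ext_on (s := (A.domain : Set L2R))
    (hA.mono Submodule.subset_span) (fun ψ hψ => key t ψ hψ)

end IsUnitaryGroupOf

open Classical in
/-- The unitary group `t ↦ e^{itA}` of an unbounded (self-adjoint) operator `A`, and `0` if there
is no such group. It exists exactly if `A` is self-adjoint, and it is then unique. -/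
def unitaryGroup (A : L2R →ₗ.[ℂ] L2R) : ℝ → BoundedOp :=
  if h : ∃ U, IsUnitaryGroupOf U A then h.choose else 0

/-- The free evolution `t ↦ e^{itH₀}`, for the closure of `H₀` on `𝓓`. -/
def freeEvolution : ℝ → BoundedOp := unitaryGroup freeHamiltonian.closure

/-- The evolution `t ↦ e^{itH}`, for the closure of `H = H₀ + V(Q)`. -/
def evolution (V : ℝ → ℝ) : ℝ → BoundedOp := unitaryGroup (hamiltonian V).closure

/-- `R` is the inverse `(z + T)⁻¹`: it maps `L²(ℝ)` into the domain of `T`, and it is a right and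
left inverse of `z + T`. -/
def IsResolventAt (T : L2R →ₗ.[ℂ] L2R) (z : ℂ) (R : BoundedOp) : Prop :=
  (∀ φ : L2R, ∃ h : R φ ∈ T.domain, z • R φ + T ⟨R φ, h⟩ = φ) ∧
    ∀ ψ : T.domain, R (z • (ψ : L2R) + T ψ) = ψ

/-- The set of the resolvents `R(a,b,c) = (i c 1 + a P + b Q)⁻¹`, `a b c : ℝ`, `c ≠ 0`, where
`a P + b Q` stands for the closure of the operator with domain `𝓓`. -/
def basicResolvents : Set BoundedOp :=
  {R | ∃ a b c : ℝ, c ≠ 0 ∧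
    IsResolventAt ((a : ℂ) • momentum + (b : ℂ) • position).closure (I * (c : ℂ)) R}

/-- The resolvent algebra `ℛ`: the C*-algebra generated by the resolvents `R(a,b,c)`. It contains
`1 = i R(0,0,1)`, so it does not matter that the generated algebra is taken to be unital. -/
def resolventAlgebra : StarSubalgebra ℂ BoundedOp :=
  (StarAlgebra.adjoin ℂ basicResolvents).topologicalClosure

/-- The potential `V(x) = g |x|^{-κ}` for `x ≠ 0`, `V(0) = 0`. -/
def singularPotential (g κ : ℝ) (x : ℝ) : ℝ := if x = 0 then 0 else g * |x| ^ (-κ)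

end ResolventAlgebra

end

open ResolventAlgebra

noncomputable section

open MeasureTheory Complex Filter Topology InnerProductSpace
open scoped SchwartzMap FourierTransform BoundedContinuousFunction ENNReal

/-! Split V at radius R: the tail `g * max |x| R ^ (-κ)` is bounded by `|g| * R ^ (-κ)`, and the
remainder is supported in [-R, R] and square integrable because 2κ < 1. So V lies in L² + L^∞. The
operator V (H₀ + iμ)⁻¹ has norm below 1 for large |μ|, and a Neumann series gives essential
self-adjointness (`isEssentiallySelfAdjoint_hamiltonian`). The unitary groups come from Stone's
theorem, proved here with Yosida approximants (`isUnitaryGroupOf_stoneGroup`).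

For compactness, differentiate W(s) = e^{isH} e^{-isH₀}; the derivative is i e^{isH} V e^{-isH₀},
whose integrand need not be compact. The range of P is dense in L², so V = w' + b' + G' with G
Schwartz, w' small in L² and b' small in sup norm (`isApproximable_singularPotential`). The summand
G' is almost a commutator: with X = G(Q)(P + i)⁻¹ one has H X - X H₀ = -2i G' + 2Y, where X and Y
are Hilbert–Schmidt (`hamiltonian_commutator`). Replacing W(s) by e^{isH}(1 - (i/2) X) e^{-isH₀}
cancels G' and leaves e^{isH} Y e^{-isH₀}, a norm continuous family of compact operators, plus the
terms with w' and b'.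

The term with b' is at most t ‖b'‖. The function w' is unbounded, but the free evolution smooths:
the time integral over [0, t] of |(e^{-isH₀} ψ)(x)|² is bounded by a multiple of ‖ψ‖², uniformly in
x (`integral_gaussian_mul_evolution_le`). Integrating against |w'(x)|² bounds its contribution by a
multiple of ‖w'‖ ‖ψ‖. Hence W(t) - 1 is a norm limit of compact operators
(`exists_isCompactOperator_norm_sub_le`, `IsApproximable.isCompactOperator`).

For stability, conjugation by e^{itH} is conjugation by e^{itH₀} followed by conjugation by W(t).
The first sends the resolvent with parameters (a, b, c) to the one with (a + 2tb, b, c). The second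
preserves the algebra because W(t) is 1 plus a compact operator and the algebra contains every
compact operator (`mem_resolventAlgebra_of_isCompactOperator`): it contains f(Q) and m(P) for f, m
vanishing at infinity, and f(Q) m(P) h(Q) tends to a rank one operator as m concentrates at zero
momentum. -/

namespace ResolventAlgebra

/-! ### Compact operators as norm limits of finite rank operators -/

section CompactOperators

variable {E : Type*} [NormedAddCommGroup E] [InnerProductSpace ℂ E]

/-- The span of the operators `|a⟩⟨b|`. -/
def finiteRankSpan (E : Type*) [NormedAddCommGroup E] [InnerProductSpace ℂ E] :
    Submodule ℂ (E →L[ℂ] E) :=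
  Submodule.span ℂ {T | ∃ a b : E, T = rankOne ℂ a b}

theorem rankOne_mem_finiteRankSpan (a b : E) : rankOne ℂ a b ∈ finiteRankSpan E :=
  Submodule.subset_span ⟨a, b, rfl⟩

theorem isCompactOperator_rankOne (a b : E) : IsCompactOperator (rankOne ℂ a b : E →L[ℂ] E) :=
  (isCompactOperator_of_locallyCompactSpace_dom (innerSL ℂ b)).clm_comp
    (ContinuousLinearMap.toSpanSingleton ℂ a)

variable [CompleteSpace E]

theorem isClosed_setOf_isCompactOperator : IsClosed {T : E →L[ℂ] E | IsCompactOperator T} :=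
  isClosed_setOfPred_isCompactOperator

theorem isCompactOperator_of_mem_closure_finiteRankSpan {T : E →L[ℂ] E}
    (hT : T ∈ closure (finiteRankSpan E : Set (E →L[ℂ] E))) : IsCompactOperator T := by
  refine closure_minimal ?_ isClosed_setOf_isCompactOperator hT
  have : finiteRankSpan E ≤ compactOperator (RingHom.id ℂ) E E := by
    refine Submodule.span_le.2 ?_
    rintro _ ⟨a, b, rfl⟩
    exact isCompactOperator_rankOne a b
  exact this

/-- A compact operator on a Hilbert space is a norm limit of finite rank operators. -/
theorem mem_closure_finiteRankSpan_of_isCompactOperator {T : E →L[ℂ] E}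
    (hT : IsCompactOperator T) : T ∈ closure (finiteRankSpan E : Set (E →L[ℂ] E)) := by
  rw [Metric.mem_closure_iff]
  intro ε hε
  obtain ⟨K, hK, hTK⟩ := hT.image_closedBall_subset_compact (f := (T : E →ₗ[ℂ] E)) 1
  obtain ⟨t, htK, htf, hcov⟩ := hK.totallyBounded.exists_subset (Metric.dist_mem_uniformity
    (show 0 < ε / 2 by positivity))
  -- `t` is a finite ε/2-net of the compact set containing the image of the unit ball, so composing
  -- `T` with the projection onto its span moves unit vectors by at most ε/2.
  let S : Submodule ℂ E := Submodule.span ℂ t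
  have : FiniteDimensional ℂ S := FiniteDimensional.span_of_finite ℂ htf
  let b := stdOrthonormalBasis ℂ S
  have hsum : S.starProjection ∘L T ∈ finiteRankSpan E := by
    rw [b.starProjection_eq_sum_rankOne, ContinuousLinearMap.finsetSum_comp]
    refine Submodule.sum_mem _ fun i _ => ?_
    rw [rankOne_comp]
    exact rankOne_mem_finiteRankSpan _ _
  refine ⟨_, hsum, ?_⟩
  rw [dist_eq_norm]
  refine lt_of_le_of_lt (ContinuousLinearMap.opNorm_le_of_unit_norm (C := ε / 2) (by positivity) ?_)
    (by linarith)
  intro x hx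
  have hxK : T x ∈ K := hTK ⟨x, by simp [hx], rfl⟩
  obtain ⟨y, hyt, hy⟩ := Set.mem_iUnion₂.1 (hcov hxK)
  have hyS : y ∈ S := Submodule.subset_span hyt
  have h1 : T x - S.starProjection (T x) = Sᗮ.starProjection (T x - y) := by
    rw [map_sub, Submodule.starProjection_orthogonal_apply_eq_zero hyS, sub_zero,
      Submodule.starProjection_orthogonal_val]
  have h2 := Sᗮ.norm_starProjection_apply_le (T x - y)
  rw [← h1] at h2
  refine h2.trans ?_
  rw [← dist_eq_norm]
  exact le_of_lt hy

/-- Hilbert–Schmidt operators are compact. -/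
theorem isCompactOperator_of_hilbertSchmidt {ι : Type*} (b : HilbertBasis ι ℂ E) {T : E →L[ℂ] E}
    {C : ℝ} (hC : ∀ s : Finset ι, ∑ i ∈ s, ‖T (b i)‖ ^ 2 ≤ C) : IsCompactOperator T := by
  have hsum : Summable fun i => ‖T (b i)‖ ^ 2 :=
    summable_of_sum_le (fun i => by positivity) hC
  refine isCompactOperator_of_mem_closure_finiteRankSpan ?_
  rw [Metric.mem_closure_iff]
  intro ε hε
  -- The tail is made smaller than a square because Cauchy–Schwarz, with Bessel's inequality for the
  -- coefficients, takes its square root.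
  obtain ⟨s, hs⟩ := summable_iff_vanishing_norm.1 hsum ((ε / 2) ^ 2) (by positivity)
  refine ⟨∑ i ∈ s, rankOne ℂ (T (b i)) (b i),
    Submodule.sum_mem _ fun i _ => rankOne_mem_finiteRankSpan _ _, ?_⟩
  rw [dist_eq_norm]
  refine lt_of_le_of_lt (ContinuousLinearMap.opNorm_le_bound _ (M := ε / 2) (by positivity) ?_)
    (by linarith)
  intro x
  have h1 : HasSum (fun i => ⟪b i, x⟫_ℂ • T (b i)) (T x) := by
    have := (b.hasSum_repr x).mapL T
    simpa [b.repr_apply_apply] using this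
  have h2 : Tendsto (fun t : Finset ι => ‖∑ i ∈ t, ⟪b i, x⟫_ℂ • T (b i) -
      ∑ i ∈ s, ⟪b i, x⟫_ℂ • T (b i)‖) atTop
      (𝓝 ‖T x - ∑ i ∈ s, ⟪b i, x⟫_ℂ • T (b i)‖) :=
    (Tendsto.sub_const h1 _).norm
  have h3 : (T - ∑ i ∈ s, rankOne ℂ (T (b i)) (b i)) x =
      T x - ∑ i ∈ s, ⟪b i, x⟫_ℂ • T (b i) := by
    simp
  rw [h3]
  refine le_of_tendsto h2 ?_
  filter_upwards [eventually_ge_atTop s] with t hst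
  classical
  rw [← Finset.sum_sdiff hst, add_sub_cancel_right]
  have h4 : ‖∑ i ∈ t \ s, ⟪b i, x⟫_ℂ • T (b i)‖ ≤ ∑ i ∈ t \ s, ‖⟪b i, x⟫_ℂ‖ * ‖T (b i)‖ :=
    (norm_sum_le _ _).trans_eq (Finset.sum_congr rfl fun i _ => norm_smul _ _)
  have h5 := Finset.sum_mul_sq_le_sq_mul_sq (t \ s) (fun i => ‖⟪b i, x⟫_ℂ‖) (fun i => ‖T (b i)‖)
  have h6 := b.orthonormal.sum_inner_products_le (s := t \ s) x
  have h7 := hs (t \ s) Finset.sdiff_disjoint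
  rw [Real.norm_of_nonneg (Finset.sum_nonneg fun i _ => by positivity)] at h7
  refine h4.trans (abs_le_of_sq_le_sq' ?_ (by positivity)).2
  refine h5.trans ?_
  rw [mul_pow, mul_comm]
  exact mul_le_mul h7.le h6 (Finset.sum_nonneg fun i _ => by positivity) (by positivity)

end CompactOperators

/-! ### Symmetric relations and the basic criterion for self-adjointness -/

section SymmetricOperators

variable {E : Type*} [NormedAddCommGroup E] [InnerProductSpace ℂ E]

/-- Symmetry of a linear relation. -/
def IsSymmetricRel (G : Submodule ℂ (E × E)) : Prop :=
  ∀ p ∈ G, ∀ q ∈ G, ⟪p.2, q.1⟫_ℂ = ⟪p.1, q.2⟫_ℂ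

theorem IsSymmetricRel.topologicalClosure {G : Submodule ℂ (E × E)} (hG : IsSymmetricRel G) :
    IsSymmetricRel G.topologicalClosure := by
  have h1 : ∀ q ∈ G, ∀ p ∈ G.topologicalClosure, ⟪p.2, q.1⟫_ℂ = ⟪p.1, q.2⟫_ℂ := by
    intro q hq p hp
    rw [← SetLike.mem_coe, Submodule.topologicalClosure_coe] at hp
    exact closure_minimal (s := (G : Set (E × E))) (fun p hp => hG p hp q hq)
      (isClosed_eq (by fun_prop) (by fun_prop)) hp
  intro p hp q hq
  rw [← SetLike.mem_coe, Submodule.topologicalClosure_coe] at hq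
  exact closure_minimal (s := (G : Set (E × E))) (t := {q | ⟪p.2, q.1⟫_ℂ = ⟪p.1, q.2⟫_ℂ})
    (fun q hq => h1 q hq p hp) (isClosed_eq (by fun_prop) (by fun_prop)) hq

/-- Symmetry makes ⟪v, u⟫ real, so the cross term with iμ vanishes. Injectivity of A + iμ,
closedness of its range and the resolvent bound 1/|μ| all come from this identity. -/
theorem IsSymmetricRel.norm_sq {G : Submodule ℂ (E × E)} (hG : IsSymmetricRel G) {p : E × E}
    (hp : p ∈ G) (μ : ℝ) :
    ‖p.2 + (I * μ) • p.1‖ ^ 2 = ‖p.2‖ ^ 2 + μ ^ 2 * ‖p.1‖ ^ 2 := by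
  have h1 := hG p hp p hp
  have h2 : (⟪p.2, p.1⟫_ℂ).im = 0 := by
    have h3 : (starRingEnd ℂ) ⟪p.2, p.1⟫_ℂ = ⟪p.1, p.2⟫_ℂ := inner_conj_symm _ _
    rw [← h1] at h3
    exact Complex.conj_eq_iff_im.1 h3
  rw [norm_add_sq (𝕜 := ℂ), inner_smul_right, norm_smul]
  simp only [RCLike.re_to_complex, Complex.mul_re, Complex.mul_im, I_re, I_im, ofReal_re, ofReal_im,
    h2, norm_mul, norm_I, Complex.norm_real, mul_pow, Real.norm_eq_abs, sq_abs]
  ring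

theorem IsSymmetricRel.norm_snd_le {G : Submodule ℂ (E × E)} (hG : IsSymmetricRel G) {p : E × E}
    (hp : p ∈ G) (μ : ℝ) : ‖p.2‖ ≤ ‖p.2 + (I * μ) • p.1‖ := by
  refine abs_le_of_sq_le_sq' ?_ (norm_nonneg _) |>.2
  rw [hG.norm_sq hp]
  nlinarith [mul_nonneg (sq_nonneg μ) (sq_nonneg ‖p.1‖)]

theorem IsSymmetricRel.norm_fst_le {G : Submodule ℂ (E × E)} (hG : IsSymmetricRel G) {p : E × E}
    (hp : p ∈ G) {μ : ℝ} (hμ : μ ≠ 0) : ‖p.1‖ ≤ |μ|⁻¹ * ‖p.2 + (I * μ) • p.1‖ := by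
  have h0 : 0 < |μ| := abs_pos.2 hμ
  rw [← div_eq_inv_mul, le_div_iff₀ h0]
  refine abs_le_of_sq_le_sq' ?_ (norm_nonneg _) |>.2
  rw [hG.norm_sq hp, mul_pow, sq_abs]
  nlinarith [sq_nonneg ‖p.2‖]

/-- The map `(u, v) ↦ v + i μ u` on a linear relation. -/
def relShift (G : Submodule ℂ (E × E)) (μ : ℝ) : G →L[ℂ] E :=
  (ContinuousLinearMap.snd ℂ E E + (I * μ : ℂ) • ContinuousLinearMap.fst ℂ E E) ∘L G.subtypeL

theorem relShift_apply (G : Submodule ℂ (E × E)) (μ : ℝ) (p : G) :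
    relShift G μ p = (p : E × E).2 + (I * μ : ℂ) • (p : E × E).1 := rfl

/-- The resolvent of a symmetric operator with full range of `A + i μ`. -/
theorem exists_resolvent_of_surjective {G : Submodule ℂ (E × E)} (hG : IsSymmetricRel G)
    {μ : ℝ} (hμ : μ ≠ 0) (hs : Function.Surjective (relShift G μ)) :
    ∃ R : E →L[ℂ] E, (∀ φ, (R φ, φ - (I * μ : ℂ) • R φ) ∈ G) ∧
      (∀ p ∈ G, R (p.2 + (I * μ : ℂ) • p.1) = p.1) ∧ ∀ φ, ‖R φ‖ ≤ |μ|⁻¹ * ‖φ‖ := by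
  have hi : Function.Injective (relShift G μ) := by
    rw [injective_iff_map_eq_zero]
    intro p hp
    have h1 := hG.norm_snd_le p.2 μ
    have h2 := hG.norm_fst_le p.2 hμ
    rw [← relShift_apply, hp, norm_zero] at h1 h2
    rw [mul_zero] at h2
    exact Subtype.ext (Prod.ext (norm_le_zero_iff.1 h2) (norm_le_zero_iff.1 h1))
  let e := LinearEquiv.ofBijective (relShift G μ : G →ₗ[ℂ] E) ⟨hi, hs⟩
  have he : ∀ φ, ((e.symm φ : G) : E × E).2 + (I * μ : ℂ) • ((e.symm φ : G) : E × E).1 = φ :=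
    fun φ => e.apply_symm_apply φ
  have hb : ∀ φ, ‖((e.symm φ : G) : E × E).1‖ ≤ |μ|⁻¹ * ‖φ‖ := by
    intro φ
    have h2 := hG.norm_fst_le (e.symm φ).2 hμ
    rwa [he] at h2
  let R : E →ₗ[ℂ] E := LinearMap.fst ℂ E E ∘ₗ G.subtype ∘ₗ e.symm.toLinearMap
  refine ⟨R.mkContinuous |μ|⁻¹ hb, fun φ => ?_, fun p hp => ?_, hb⟩
  · have : ((e.symm φ : G) : E × E) = (R φ, φ - (I * μ : ℂ) • R φ) := by
      refine Prod.ext rfl ?_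
      exact eq_sub_of_add_eq (he φ)
    change (R φ, φ - (I * μ : ℂ) • R φ) ∈ G
    rw [← this]
    exact (e.symm φ).2
  · change ((e.symm (e ⟨p, hp⟩) : G) : E × E).1 = p.1
    rw [e.symm_apply_apply]

theorem isSymmetricRel_graph {T : E →ₗ.[ℂ] E} (hs : T.IsFormalAdjoint T) :
    IsSymmetricRel T.graph := by
  intro p hp q hq
  obtain ⟨x, hx1, hx2⟩ := T.mem_graph_iff.1 hp
  obtain ⟨y, hy1, hy2⟩ := T.mem_graph_iff.1 hq
  rw [← hx1, ← hx2, ← hy1, ← hy2]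
  exact hs x y

theorem isFormalAdjoint_of_isSymmetricRel {T : E →ₗ.[ℂ] E} (h : IsSymmetricRel T.graph) :
    T.IsFormalAdjoint T := fun x y => h _ (T.mem_graph x) _ (T.mem_graph y)

variable [CompleteSpace E]

/-- A closed graph is complete, and A + iμ is bounded below on it in the graph norm. -/
theorem isClosed_range_relShift {G : Submodule ℂ (E × E)} (hG : IsSymmetricRel G)
    (hGc : IsClosed (G : Set (E × E))) {μ : ℝ} (hμ : μ ≠ 0) :
    IsClosed (Set.range (relShift G μ)) := by
  have : CompleteSpace G := hGc.completeSpace_coe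
  have hA : AntilipschitzWith (max 1 (Real.toNNReal |μ|⁻¹)) (relShift G μ) := by
    refine ContinuousLinearMap.antilipschitz_of_bound _ fun p => ?_
    have h1 := hG.norm_snd_le p.2 μ
    have h2 := hG.norm_fst_le p.2 hμ
    rw [← relShift_apply] at h1 h2
    change max ‖(p : E × E).1‖ ‖(p : E × E).2‖ ≤ _
    have h3 : ((max 1 (Real.toNNReal |μ|⁻¹) : NNReal) : ℝ) = max 1 |μ|⁻¹ := by
      rw [NNReal.coe_max, Real.coe_toNNReal _ (by positivity)]; rfl
    rw [h3]
    refine max_le (h2.trans ?_) (h1.trans ?_)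
    · gcongr; exact le_max_right _ _
    · exact le_mul_of_one_le_left (norm_nonneg _) (le_max_left _ _)
  exact hA.isClosed_range (relShift G μ).uniformContinuous

theorem surjective_relShift {G : Submodule ℂ (E × E)} (hG : IsSymmetricRel G)
    (hGc : IsClosed (G : Set (E × E))) {μ : ℝ} (hμ : μ ≠ 0)
    (hd : Dense (Set.range (relShift G μ))) : Function.Surjective (relShift G μ) := by
  rw [← Set.range_eq_univ, ← (isClosed_range_relShift hG hGc hμ).closure_eq]
  exact hd.closure_eq

theorem isClosable_of_isFormalAdjoint {T : E →ₗ.[ℂ] E} (hd : Dense (T.domain : Set E))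
    (hs : T.IsFormalAdjoint T) : T.IsClosable :=
  (LinearPMap.adjoint_isClosed hd).isClosable.leIsClosable (hs.le_adjoint hd)

theorem isSymmetricRel_graph_closure {T : E →ₗ.[ℂ] E} (hd : Dense (T.domain : Set E))
    (hs : T.IsFormalAdjoint T) : IsSymmetricRel T.closure.graph := by
  rw [← (isClosable_of_isFormalAdjoint hd hs).graph_closure_eq_closure_graph]
  exact (isSymmetricRel_graph hs).topologicalClosure

theorem mem_graph_adjoint {T : E →ₗ.[ℂ] E} (hd : Dense (T.domain : Set E)) {p : E × E} :
    p ∈ T.adjoint.graph ↔ ∀ q ∈ T.graph, ⟪p.2, q.1⟫_ℂ = ⟪p.1, q.2⟫_ℂ := by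
  constructor
  · intro hp q hq
    obtain ⟨x, hx1, hx2⟩ := LinearPMap.mem_graph_iff _ |>.1 hp
    obtain ⟨y, hy1, hy2⟩ := T.mem_graph_iff.1 hq
    rw [← hx1, ← hx2, ← hy1, ← hy2]
    exact LinearPMap.adjoint_isFormalAdjoint hd x y
  · intro h
    have hx : p.1 ∈ T.adjoint.domain :=
      LinearPMap.mem_adjoint_domain_of_exists _ ⟨p.2, fun x => h _ (T.mem_graph x)⟩
    have : T.adjoint ⟨p.1, hx⟩ = p.2 :=
      LinearPMap.adjoint_apply_eq hd _ fun x => h _ (T.mem_graph x)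
    rw [LinearPMap.mem_graph_iff]
    exact ⟨⟨p.1, hx⟩, rfl, this⟩

/-- The basic criterion for self-adjointness, for an operator with a closed graph. -/
theorem isSelfAdjoint_of_surjective {A : E →ₗ.[ℂ] E} (hd : Dense (A.domain : Set E))
    (hG : IsSymmetricRel A.graph) {μ : ℝ} (hp : Function.Surjective (relShift A.graph μ))
    (hm : Function.Surjective (relShift A.graph (-μ))) : IsSelfAdjoint A := by
  rw [LinearPMap.isSelfAdjoint_def]
  refine le_antisymm (LinearPMap.le_of_le_graph ?_)
    ((isFormalAdjoint_of_isSymmetricRel hG).le_adjoint hd)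
  rintro ⟨φ, χ⟩ hφ
  rw [mem_graph_adjoint hd] at hφ
  -- An adjoint vector φ is compared with the u in the domain having the same image under A* - iμ.
  -- The difference φ - u is then orthogonal to the range of A + iμ, which is everything.
  obtain ⟨⟨⟨u, v⟩, huv⟩, h1⟩ := hm (χ + (I * ((-μ : ℝ) : ℂ)) • φ)
  rw [relShift_apply] at h1
  have h2 : χ - v = (I * μ) • (φ - u) := by
    push_cast at h1
    simp only [mul_neg, neg_smul, ← sub_eq_add_neg] at h1
    rw [smul_sub, sub_eq_sub_iff_add_eq_add]
    rw [sub_eq_sub_iff_add_eq_add] at h1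
    rw [← h1, add_comm]
  obtain ⟨⟨⟨x, y⟩, hxy⟩, h3⟩ := hp (φ - u)
  rw [relShift_apply] at h3
  have h4 : φ - u = 0 := by
    rw [← inner_self_eq_zero (𝕜 := ℂ)]
    nth_rewrite 2 [← h3]
    have h5 := hφ _ hxy
    have h6 := hG _ huv _ hxy
    simp only at h5 h6 ⊢
    rw [inner_add_right, inner_smul_right, inner_sub_left, ← h5, ← h6, ← inner_sub_left, h2,
      inner_smul_left]
    simp
  have h5 : φ = u := sub_eq_zero.1 h4
  have h6 : χ = v := by rw [h4, smul_zero] at h2; exact sub_eq_zero.1 h2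
  rw [h5, h6]
  exact huv

theorem isSelfAdjoint_closure_of_dense_range {T : E →ₗ.[ℂ] E} (hd : Dense (T.domain : Set E))
    (hs : T.IsFormalAdjoint T) {μ : ℝ} (hμ : μ ≠ 0)
    (hp : Dense (Set.range fun x : T.domain => T x + (I * μ : ℂ) • (x : E)))
    (hm : Dense (Set.range fun x : T.domain => T x + (I * ((-μ : ℝ) : ℂ)) • (x : E))) :
    IsSelfAdjoint T.closure := by
  have hc := isClosable_of_isFormalAdjoint hd hs
  have hG := isSymmetricRel_graph_closure hd hs
  have hGc : IsClosed (T.closure.graph : Set (E × E)) := hc.closure_isClosed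
  have hr : ∀ ν : ℝ, Dense (Set.range fun x : T.domain => T x + (I * ν : ℂ) • (x : E)) →
      Dense (Set.range (relShift T.closure.graph ν)) := by
    intro ν h
    refine h.mono ?_
    rintro _ ⟨x, rfl⟩
    exact ⟨⟨((x : E), T x), LinearPMap.le_graph_of_le T.le_closure (T.mem_graph x)⟩, rfl⟩
  refine isSelfAdjoint_of_surjective (hd.mono T.le_closure.1) hG (μ := μ)
    (surjective_relShift hG hGc hμ (hr _ hp))
    (surjective_relShift hG hGc (neg_ne_zero.2 hμ) (hr _ hm))

theorem isSymmetricRel_of_isSelfAdjoint {A : E →ₗ.[ℂ] E} (hA : IsSelfAdjoint A) :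
    IsSymmetricRel A.graph := by
  intro p hp q hq
  rw [← LinearPMap.isSelfAdjoint_def.1 hA, mem_graph_adjoint hA.dense_domain] at hp
  exact hp q hq

/-- A vector orthogonal to the range would be an eigenvector of A* = A with eigenvalue iμ, which
symmetry excludes. So the range is dense, and it is closed. -/
theorem surjective_relShift_of_isSelfAdjoint {A : E →ₗ.[ℂ] E} (hA : IsSelfAdjoint A) {μ : ℝ}
    (hμ : μ ≠ 0) : Function.Surjective (relShift A.graph μ) := by
  have hG := isSymmetricRel_of_isSelfAdjoint hA
  refine surjective_relShift hG hA.isClosed hμ ?_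
  have : Dense ((LinearMap.range (relShift A.graph μ : A.graph →ₗ[ℂ] E) : Submodule ℂ E) :
      Set E) := by
    rw [Submodule.dense_iff_topologicalClosure_eq_top, Submodule.topologicalClosure_eq_top_iff,
      Submodule.eq_bot_iff]
    intro φ hφ
    have h1 : (φ, (I * μ) • φ) ∈ A.graph := by
      rw [← LinearPMap.isSelfAdjoint_def.1 hA, mem_graph_adjoint hA.dense_domain]
      rintro ⟨x, y⟩ hxy
      have h2 := (Submodule.mem_orthogonal' _ _).1 hφ _ ⟨⟨_, hxy⟩, rfl⟩
      change ⟪φ, y + (I * μ) • x⟫_ℂ = 0 at h2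
      rw [inner_add_right, inner_smul_right] at h2
      simp only [inner_smul_left, map_mul, conj_I, conj_ofReal]
      linear_combination -h2
    have h3 := hG.norm_fst_le h1 (neg_ne_zero.2 hμ)
    simpa using h3
  exact this

end SymmetricOperators

/-! ### Stone's theorem by Yosida approximation -/

section Stone

variable {E : Type*} [NormedAddCommGroup E] [InnerProductSpace ℂ E] [CompleteSpace E]

/-- The unitary group `t ↦ e^{itB}` of a bounded operator `B`. -/
def expI (B : E →L[ℂ] E) (t : ℝ) : E →L[ℂ] E := NormedSpace.exp (t • (I • B))

theorem expI_zero (B : E →L[ℂ] E) : expI B 0 = 1 := by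
  simp [expI, NormedSpace.exp_zero]

theorem expI_add (B : E →L[ℂ] E) (s t : ℝ) : expI B (s + t) = expI B s * expI B t := by
  let _ : NormedAlgebra ℚ (E →L[ℂ] E) := NormedAlgebra.restrictScalars ℚ ℂ (E →L[ℂ] E)
  have hc : Commute (s • (I • B)) (t • (I • B)) :=
    ((Commute.refl (I • B)).smul_left s).smul_right t
  rw [expI, add_smul, NormedSpace.exp_add_of_commute hc, expI, expI]

theorem norm_expI_apply {B : E →L[ℂ] E} (hB : IsSelfAdjoint B) (t : ℝ) (x : E) :
    ‖expI B t x‖ = ‖x‖ := by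
  have h : expI B t ∈ unitary (E →L[ℂ] E) := by
    let _ : NormedAlgebra ℚ (E →L[ℂ] E) := NormedAlgebra.restrictScalars ℚ ℂ (E →L[ℂ] E)
    refine NormedSpace.exp_mem_unitary_of_mem_skewAdjoint ?_
    rw [skewAdjoint.mem_iff, star_smul, star_smul, hB.star_eq]
    simp
  exact Unitary.norm_map ⟨_, h⟩ x

theorem hasDerivAt_expI (B : E →L[ℂ] E) (t : ℝ) (x : E) :
    HasDerivAt (fun t => expI B t x) (expI B t (I • B x)) t := by
  have h := hasDerivAt_exp_smul_const (𝕂 := ℝ) (I • B) t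
  exact ((ContinuousLinearMap.apply ℂ E x).restrictScalars ℝ).hasFDerivAt.comp_hasDerivAt t h

theorem norm_expI_sub_le {B : E →L[ℂ] E} (hB : IsSelfAdjoint B) (t : ℝ) (x : E) :
    ‖expI B t x - x‖ ≤ ‖B x‖ * |t| := by
  have h := Convex.norm_image_sub_le_of_norm_hasDerivWithin_le (s := Set.univ) (x := 0) (y := t)
    (f := fun t => expI B t x) (f' := fun t => expI B t (I • B x)) (C := ‖B x‖)
    (fun s _ => (hasDerivAt_expI B s x).hasDerivWithinAt)
    (fun s _ => by rw [norm_expI_apply hB, norm_smul, norm_I, one_mul]) convex_univ trivial trivial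
  simpa [expI_zero] using h

/-- Commutation allows the factor e^{itB'}, an isometry, to be split off, leaving e^{it(B - B')} -
1. -/
theorem norm_expI_sub_expI_le {B B' : E →L[ℂ] E} (hB : IsSelfAdjoint B) (hB' : IsSelfAdjoint B')
    (hc : Commute B B') (t : ℝ) (x : E) :
    ‖expI B t x - expI B' t x‖ ≤ ‖B x - B' x‖ * |t| := by
  have h : expI B t = expI B' t * expI (B - B') t := by
    let _ : NormedAlgebra ℚ (E →L[ℂ] E) := NormedAlgebra.restrictScalars ℚ ℂ (E →L[ℂ] E)
    rw [expI, expI, expI, ← NormedSpace.exp_add_of_commute, ← smul_add, ← smul_add,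
      add_sub_cancel]
    have : Commute B' (B - B') := hc.symm.sub_right (Commute.refl _)
    exact (((this.smul_left I).smul_right I).smul_left t).smul_right t
  rw [h, mul_apply_eq_comp, ← map_sub, norm_expI_apply hB']
  exact norm_expI_sub_le (hB.sub hB') t x

variable {A : E →ₗ.[ℂ] E}

/-- The resolvent `(A + i μ)⁻¹` of a self-adjoint operator. -/
def selfAdjointResolvent (hA : IsSelfAdjoint A) {μ : ℝ} (hμ : μ ≠ 0) : E →L[ℂ] E :=
  (exists_resolvent_of_surjective (isSymmetricRel_of_isSelfAdjoint hA) hμ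
    (surjective_relShift_of_isSelfAdjoint hA hμ)).choose

section

variable (hA : IsSelfAdjoint A) {μ : ℝ} (hμ : μ ≠ 0)

theorem selfAdjointResolvent_mem_graph (φ : E) :
    (selfAdjointResolvent hA hμ φ, φ - (I * μ : ℂ) • selfAdjointResolvent hA hμ φ) ∈ A.graph :=
  (exists_resolvent_of_surjective (isSymmetricRel_of_isSelfAdjoint hA) hμ
    (surjective_relShift_of_isSelfAdjoint hA hμ)).choose_spec.1 φ

theorem selfAdjointResolvent_apply_add {p : E × E} (hp : p ∈ A.graph) :
    selfAdjointResolvent hA hμ (p.2 + (I * μ : ℂ) • p.1) = p.1 :=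
  (exists_resolvent_of_surjective (isSymmetricRel_of_isSelfAdjoint hA) hμ
    (surjective_relShift_of_isSelfAdjoint hA hμ)).choose_spec.2.1 p hp

theorem norm_selfAdjointResolvent_apply_le (φ : E) :
    ‖selfAdjointResolvent hA hμ φ‖ ≤ |μ|⁻¹ * ‖φ‖ :=
  (exists_resolvent_of_surjective (isSymmetricRel_of_isSelfAdjoint hA) hμ
    (surjective_relShift_of_isSelfAdjoint hA hμ)).choose_spec.2.2 φ

theorem inner_selfAdjointResolvent (φ χ : E) :
    ⟪selfAdjointResolvent hA hμ φ, χ⟫_ℂ =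
      ⟪φ, selfAdjointResolvent hA (neg_ne_zero.2 hμ) χ⟫_ℂ := by
  have h := isSymmetricRel_of_isSelfAdjoint hA _ (selfAdjointResolvent_mem_graph hA hμ φ) _
    (selfAdjointResolvent_mem_graph hA (neg_ne_zero.2 hμ) χ)
  simp only [inner_sub_left, inner_sub_right, inner_smul_left, inner_smul_right, map_mul, conj_I,
    conj_ofReal, ofReal_neg] at h
  linear_combination -h

theorem selfAdjointResolvent_sub {ν : ℝ} (hν : ν ≠ 0) (φ : E) :
    selfAdjointResolvent hA hν φ - selfAdjointResolvent hA hμ φ =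
      (I * μ - I * ν : ℂ) • selfAdjointResolvent hA hμ (selfAdjointResolvent hA hν φ) := by
  have h := selfAdjointResolvent_apply_add hA hμ (selfAdjointResolvent_mem_graph hA hν φ)
  simp only [map_add, map_sub, map_smul] at h
  nth_rewrite 1 [← h]
  rw [sub_smul]
  abel

/-- The resolvent identity, written with μ and ν in either role, expresses the same difference
through both products. -/
theorem commute_selfAdjointResolvent {ν : ℝ} (hν : ν ≠ 0) :
    Commute (selfAdjointResolvent hA hμ) (selfAdjointResolvent hA hν) := by
  by_cases hμν : μ = ν
  · subst hμν; exact Commute.refl _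
  · ext φ
    have h1 := selfAdjointResolvent_sub hA hμ hν φ
    have h2 := selfAdjointResolvent_sub hA hν hμ φ
    rw [← neg_sub, h1, ← neg_smul, neg_sub] at h2
    have h3 : (I * ν - I * μ : ℂ) ≠ 0 := by
      rw [← mul_sub]
      refine mul_ne_zero I_ne_zero (sub_ne_zero.2 ?_)
      exact_mod_cast Ne.symm hμν
    exact smul_right_injective E h3 h2

end

/-- The Yosida parameter at index n is n + 1, so no index has to be excluded. -/
theorem natCast_succ_ne_zero (n : ℕ) : ((n : ℝ) + 1) ≠ 0 := by positivity

/-- The Yosida approximants `A n² / (A² + n²)`. -/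
def yosida (hA : IsSelfAdjoint A) (n : ℕ) : E →L[ℂ] E :=
  ((((n : ℝ) + 1) ^ 2 / 2 : ℝ) : ℂ) • (selfAdjointResolvent hA (natCast_succ_ne_zero n) +
    selfAdjointResolvent hA (neg_ne_zero.2 (natCast_succ_ne_zero n)))

/-- The operators `n² / (A² + n²)`. -/
def yosidaMollifier (hA : IsSelfAdjoint A) (n : ℕ) : E →L[ℂ] E :=
  (I * ((n : ℝ) + 1 : ℝ) / 2 : ℂ) • (selfAdjointResolvent hA (natCast_succ_ne_zero n) -
    selfAdjointResolvent hA (neg_ne_zero.2 (natCast_succ_ne_zero n)))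

variable (hA : IsSelfAdjoint A)

theorem yosida_eq (n : ℕ) (φ : E) : yosida hA n φ = ((((n : ℝ) + 1) ^ 2 / 2 : ℝ) : ℂ) •
    (selfAdjointResolvent hA (natCast_succ_ne_zero n) φ +
      selfAdjointResolvent hA (neg_ne_zero.2 (natCast_succ_ne_zero n)) φ) := rfl

theorem yosidaMollifier_eq (n : ℕ) (φ : E) :
    yosidaMollifier hA n φ = (I * ((n : ℝ) + 1 : ℝ) / 2 : ℂ) •
    (selfAdjointResolvent hA (natCast_succ_ne_zero n) φ -
      selfAdjointResolvent hA (neg_ne_zero.2 (natCast_succ_ne_zero n)) φ) := rfl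

theorem isSelfAdjoint_yosida (n : ℕ) : IsSelfAdjoint (yosida hA n) := by
  rw [ContinuousLinearMap.isSelfAdjoint_iff_isSymmetric]
  intro φ χ
  have h1 := inner_selfAdjointResolvent hA (natCast_succ_ne_zero n) φ χ
  have h2 := inner_selfAdjointResolvent hA (natCast_succ_ne_zero n) χ φ
  rw [← inner_conj_symm, ← inner_conj_symm χ] at h2
  have h2 := (starRingEnd ℂ).injective h2
  change ⟪yosida hA n φ, χ⟫_ℂ = ⟪φ, yosida hA n χ⟫_ℂ
  rw [yosida_eq, yosida_eq, inner_smul_left, inner_smul_right, inner_add_left, inner_add_right,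
    h1, ← h2, conj_ofReal]
  ring

theorem commute_yosida (n m : ℕ) : Commute (yosida hA n) (yosida hA m) := by
  refine Commute.smul_left (Commute.smul_right ?_ _) _
  exact Commute.add_left
    ((commute_selfAdjointResolvent hA _ _).add_right (commute_selfAdjointResolvent hA _ _))
    ((commute_selfAdjointResolvent hA _ _).add_right (commute_selfAdjointResolvent hA _ _))

theorem norm_yosidaMollifier_apply_le (n : ℕ) (φ : E) : ‖yosidaMollifier hA n φ‖ ≤ ‖φ‖ := by
  have h0 : (0 : ℝ) < n + 1 := by positivity
  have h1 := norm_selfAdjointResolvent_apply_le hA (natCast_succ_ne_zero n) φ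
  have h2 := norm_selfAdjointResolvent_apply_le hA (neg_ne_zero.2 (natCast_succ_ne_zero n)) φ
  rw [abs_neg] at h2
  rw [abs_of_pos h0] at h1 h2
  rw [yosidaMollifier_eq, norm_smul, norm_div, norm_mul, norm_I, Complex.norm_real, Real.norm_of_nonneg h0.le,
    Complex.norm_two, one_mul]
  calc _ ≤ ((n : ℝ) + 1) / 2 * (((n : ℝ) + 1)⁻¹ * ‖φ‖ + ((n : ℝ) + 1)⁻¹ * ‖φ‖) := by
        gcongr
        exact (norm_sub_le _ _).trans (add_le_add h1 h2)
    _ = ‖φ‖ := by field_simp; ring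

/-- On the domain of A the unbounded family of approximants becomes a family of contractions applied
to Aψ; all convergence below rests on this. -/
theorem yosida_apply {p : E × E} (hp : p ∈ A.graph) (n : ℕ) :
    yosida hA n p.1 = yosidaMollifier hA n p.2 := by
  have h1 := selfAdjointResolvent_apply_add hA (natCast_succ_ne_zero n) hp
  have h2 := selfAdjointResolvent_apply_add hA (neg_ne_zero.2 (natCast_succ_ne_zero n)) hp
  rw [map_add, map_smul] at h1 h2
  have h1 := eq_sub_of_add_eq h1
  have h2 := eq_sub_of_add_eq h2
  rw [yosida_eq, yosidaMollifier_eq, h1, h2]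
  simp only [smul_add, smul_sub, smul_smul]
  set r := selfAdjointResolvent hA (natCast_succ_ne_zero n) p.1
  set s := selfAdjointResolvent hA (neg_ne_zero.2 (natCast_succ_ne_zero n)) p.1
  have e1 : (I * ((n : ℝ) + 1 : ℝ) / 2 * (I * ((n : ℝ) + 1 : ℝ)) : ℂ) =
      -(((((n : ℝ) + 1) ^ 2 / 2 : ℝ)) : ℂ) := by
    push_cast
    linear_combination (((n : ℂ) + 1) ^ 2 / 2) * I_mul_I
  have e2 : (I * ((n : ℝ) + 1 : ℝ) / 2 * (I * (-((n : ℝ) + 1) : ℝ)) : ℂ) =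
      (((((n : ℝ) + 1) ^ 2 / 2 : ℝ)) : ℂ) := by
    push_cast
    linear_combination (-((n : ℂ) + 1) ^ 2 / 2) * I_mul_I
  rw [e1, e2, neg_smul]
  abel

theorem norm_smul_selfAdjointResolvent_sub_le {p : E × E} (hp : p ∈ A.graph) {μ : ℝ} (hμ : μ ≠ 0) :
    ‖(I * μ : ℂ) • selfAdjointResolvent hA hμ p.1 - p.1‖ ≤ |μ|⁻¹ * ‖p.2‖ := by
  have h1 := selfAdjointResolvent_apply_add hA hμ hp
  rw [map_add, map_smul] at h1
  rw [← norm_neg, neg_sub]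
  nth_rewrite 1 [← h1]
  rw [add_sub_cancel_right]
  exact norm_selfAdjointResolvent_apply_le hA hμ _

/-- On the domain the error is at most ‖Aψ‖/(n + 1); density of the domain and uniform contractivity
extend the limit to all vectors. -/
theorem tendsto_yosidaMollifier (φ : E) :
    Tendsto (fun n => yosidaMollifier hA n φ) atTop (𝓝 φ) := by
  have key : ∀ p ∈ A.graph, Tendsto (fun n => yosidaMollifier hA n p.1) atTop (𝓝 p.1) := by
    intro p hp
    rw [tendsto_iff_norm_sub_tendsto_zero]
    refine squeeze_zero (fun _ => norm_nonneg _) (fun n => ?_)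
      (g := fun n : ℕ => (1 / ((n : ℝ) + 1)) * ‖p.2‖)
      (by simpa using tendsto_one_div_add_atTop_nhds_zero_nat.mul_const ‖p.2‖)
    have h0 : (0 : ℝ) < n + 1 := by positivity
    have h1 := norm_smul_selfAdjointResolvent_sub_le hA hp (natCast_succ_ne_zero n)
    have h2 := norm_smul_selfAdjointResolvent_sub_le hA hp
      (neg_ne_zero.2 (natCast_succ_ne_zero n))
    rw [abs_neg] at h2
    rw [abs_of_pos h0] at h1 h2
    set r := selfAdjointResolvent hA (natCast_succ_ne_zero n) p.1
    set s := selfAdjointResolvent hA (neg_ne_zero.2 (natCast_succ_ne_zero n)) p.1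
    have h3 : yosidaMollifier hA n p.1 - p.1 =
        (1 / 2 : ℂ) • (((I * ((n : ℝ) + 1 : ℝ) : ℂ) • r - p.1) +
          ((I * (-((n : ℝ) + 1) : ℝ) : ℂ) • s - p.1)) := by
      rw [yosidaMollifier_eq]
      push_cast
      module
    rw [h3, norm_smul]
    have h4 : ‖(1 / 2 : ℂ)‖ = 1 / 2 := by simp
    rw [h4, one_div ((n : ℝ) + 1)]
    have h5 := norm_add_le ((I * ((n : ℝ) + 1 : ℝ) : ℂ) • r - p.1)
      ((I * (-((n : ℝ) + 1) : ℝ) : ℂ) • s - p.1)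
    linarith
  rw [Metric.tendsto_atTop]
  intro ε hε
  obtain ⟨x, hx, hxφ⟩ := Metric.mem_closure_iff.1 (hA.dense_domain φ) (ε / 3) (by positivity)
  obtain ⟨N, hN⟩ := Metric.tendsto_atTop.1 (key _ (A.mem_graph ⟨x, hx⟩)) (ε / 3) (by positivity)
  refine ⟨N, fun n hn => ?_⟩
  have h1 := hN n hn
  have h2 := norm_yosidaMollifier_apply_le hA n (φ - x)
  rw [map_sub, ← dist_eq_norm, ← dist_eq_norm] at h2
  have h3 := dist_triangle4 (yosidaMollifier hA n φ) (yosidaMollifier hA n x) x φ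
  rw [dist_comm x φ] at h3
  simp only at h1
  linarith

theorem cauchySeq_expI_yosida (t : ℝ) (φ : E) : CauchySeq fun n => expI (yosida hA n) t φ := by
  have key : ∀ p ∈ A.graph, CauchySeq fun n => expI (yosida hA n) t p.1 := by
    intro p hp
    have h1 := (tendsto_yosidaMollifier hA p.2).cauchySeq
    rw [Metric.cauchySeq_iff'] at h1 ⊢
    intro ε hε
    -- The summand 1 avoids division by zero at t = 0.
    obtain ⟨N, hN⟩ := h1 (ε / (|t| + 1)) (by positivity)
    refine ⟨N, fun n hn => ?_⟩
    have h2 := norm_expI_sub_expI_le (isSelfAdjoint_yosida hA n) (isSelfAdjoint_yosida hA N)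
      (commute_yosida hA n N) t p.1
    rw [yosida_apply hA hp, yosida_apply hA hp, ← dist_eq_norm, ← dist_eq_norm] at h2
    have h3 := hN n hn
    rw [lt_div_iff₀ (by positivity)] at h3
    refine h2.trans_lt (lt_of_le_of_lt ?_ h3)
    gcongr
    linarith
  rw [Metric.cauchySeq_iff']
  intro ε hε
  obtain ⟨x, hx, hxφ⟩ := Metric.mem_closure_iff.1 (hA.dense_domain φ) (ε / 3) (by positivity)
  obtain ⟨N, hN⟩ := Metric.cauchySeq_iff'.1 (key _ (A.mem_graph ⟨x, hx⟩)) (ε / 3) (by positivity)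
  refine ⟨N, fun n hn => ?_⟩
  have h1 := hN n hn
  have h2 : ∀ m, dist (expI (yosida hA m) t φ) (expI (yosida hA m) t x) = dist φ x := by
    intro m
    rw [dist_eq_norm, ← map_sub, norm_expI_apply (isSelfAdjoint_yosida hA m), ← dist_eq_norm]
  have h3 := dist_triangle4 (expI (yosida hA n) t φ) (expI (yosida hA n) t x)
    (expI (yosida hA N) t x) (expI (yosida hA N) t φ)
  rw [h2, dist_comm (expI (yosida hA N) t x), h2] at h3
  simp only at h1
  linarith

/-- **Stone's theorem**: the unitary group generated by a self-adjoint operator, constructed as the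
strong limit of the groups generated by the Yosida approximants. -/
def stoneGroup (t : ℝ) : E →L[ℂ] E :=
  continuousLinearMapOfTendsto (fun n => expI (yosida hA n) t)
    (f := fun φ => (cauchySeq_tendsto_of_complete (cauchySeq_expI_yosida hA t φ)).choose)
    (tendsto_pi_nhds.2 fun φ =>
      (cauchySeq_tendsto_of_complete (cauchySeq_expI_yosida hA t φ)).choose_spec)

theorem tendsto_stoneGroup (t : ℝ) (φ : E) :
    Tendsto (fun n => expI (yosida hA n) t φ) atTop (𝓝 (stoneGroup hA t φ)) :=
  (cauchySeq_tendsto_of_complete (cauchySeq_expI_yosida hA t φ)).choose_spec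

theorem norm_stoneGroup_apply (t : ℝ) (φ : E) : ‖stoneGroup hA t φ‖ = ‖φ‖ := by
  refine tendsto_nhds_unique (tendsto_stoneGroup hA t φ).norm ?_
  simp_rw [norm_expI_apply (isSelfAdjoint_yosida hA _)]
  exact tendsto_const_nhds

theorem stoneGroup_zero : stoneGroup hA 0 = 1 := by
  ext φ
  refine tendsto_nhds_unique (tendsto_stoneGroup hA 0 φ) ?_
  simp [expI_zero]

/-- Strong convergence of isometries along a convergent sequence of vectors. -/
theorem tendsto_expI_yosida_apply (t : ℝ) {u : ℕ → E} {φ : E} (hu : Tendsto u atTop (𝓝 φ)) :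
    Tendsto (fun n => expI (yosida hA n) t (u n)) atTop (𝓝 (stoneGroup hA t φ)) := by
  have h1 : Tendsto (fun n => expI (yosida hA n) t (u n - φ)) atTop (𝓝 0) := by
    rw [tendsto_zero_iff_norm_tendsto_zero]
    simp_rw [norm_expI_apply (isSelfAdjoint_yosida hA _)]
    exact tendsto_iff_norm_sub_tendsto_zero.1 hu
  have h2 := h1.add (tendsto_stoneGroup hA t φ)
  simpa [map_sub] using h2

theorem stoneGroup_add (s t : ℝ) : stoneGroup hA (s + t) = stoneGroup hA s * stoneGroup hA t := by
  ext φ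
  refine tendsto_nhds_unique (tendsto_stoneGroup hA (s + t) φ) ?_
  simp_rw [expI_add, mul_apply_eq_comp]
  exact tendsto_expI_yosida_apply hA s (tendsto_stoneGroup hA t φ)

theorem stoneGroup_mem_unitary (t : ℝ) : stoneGroup hA t ∈ unitary (E →L[ℂ] E) := by
  have h1 : star (stoneGroup hA t) * stoneGroup hA t = 1 :=
    (ContinuousLinearMap.norm_map_iff_adjoint_comp_self _).1 (norm_stoneGroup_apply hA t)
  have h2 : stoneGroup hA t * stoneGroup hA (-t) = 1 := by
    rw [← stoneGroup_add, add_neg_cancel, stoneGroup_zero]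
  have h3 : star (stoneGroup hA t) = stoneGroup hA (-t) := by
    calc _ = star (stoneGroup hA t) * (stoneGroup hA t * stoneGroup hA (-t)) := by
          rw [h2, mul_one]
      _ = _ := by rw [← mul_assoc, h1, one_mul]
  exact ⟨h1, by rw [h3, h2]⟩

theorem continuous_stoneGroup (φ : E) : Continuous fun t => stoneGroup hA t φ := by
  have key : ∀ p ∈ A.graph, Continuous fun t => stoneGroup hA t p.1 := by
    intro p hp
    have hle : ∀ t, ‖stoneGroup hA t p.1 - p.1‖ ≤ ‖p.2‖ * |t| := by
      intro t
      refine le_of_tendsto ((tendsto_stoneGroup hA t p.1).sub_const p.1).norm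
        (Eventually.of_forall fun n => ?_)
      refine (norm_expI_sub_le (isSelfAdjoint_yosida hA n) t p.1).trans ?_
      rw [yosida_apply hA hp]
      gcongr
      exact norm_yosidaMollifier_apply_le hA n p.2
    refine (LipschitzWith.of_dist_le_mul (K := ‖p.2‖₊) fun s t => ?_).continuous
    have h1 : stoneGroup hA s p.1 = stoneGroup hA t (stoneGroup hA (s - t) p.1) := by
      rw [← mul_apply_eq_comp, ← stoneGroup_add]; congr 2; ring
    rw [dist_eq_norm, h1, ← map_sub, norm_stoneGroup_apply]
    exact hle (s - t)
  rw [Metric.continuous_iff]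
  intro t ε hε
  obtain ⟨x, hx, hxφ⟩ := Metric.mem_closure_iff.1 (hA.dense_domain φ) (ε / 3) (by positivity)
  obtain ⟨δ, hδ, hd⟩ := Metric.continuous_iff.1 (key _ (A.mem_graph ⟨x, hx⟩)) t (ε / 3)
    (by positivity)
  refine ⟨δ, hδ, fun s hs => ?_⟩
  have h1 := hd s hs
  have h2 : ∀ r, dist (stoneGroup hA r φ) (stoneGroup hA r x) = dist φ x := by
    intro r
    rw [dist_eq_norm, ← map_sub, norm_stoneGroup_apply, ← dist_eq_norm]
  have h3 := dist_triangle4 (stoneGroup hA s φ) (stoneGroup hA s x)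
    (stoneGroup hA t x) (stoneGroup hA t φ)
  rw [h2, dist_comm (stoneGroup hA t x) (stoneGroup hA t φ), h2] at h3
  simp only at h1
  linarith

/-- The fundamental theorem of calculus for the bounded approximants passes to the limit by
dominated convergence. Differentiability at 0 then follows from strong continuity. -/
theorem stoneGroup_sub_eq_integral {p : E × E} (hp : p ∈ A.graph) (t : ℝ) :
    stoneGroup hA t p.1 - p.1 = ∫ s in (0 : ℝ)..t, stoneGroup hA s (I • p.2) := by
  have hc : ∀ n (φ : E), Continuous fun s => expI (yosida hA n) s φ := fun n φ =>
    continuous_iff_continuousAt.2 fun s => (hasDerivAt_expI _ s φ).continuousAt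
  have h1 : ∀ n, expI (yosida hA n) t p.1 - p.1 =
      ∫ s in (0 : ℝ)..t, expI (yosida hA n) s (I • yosidaMollifier hA n p.2) := by
    intro n
    rw [intervalIntegral.integral_eq_sub_of_hasDerivAt (f := fun s => expI (yosida hA n) s p.1)
      (fun s _ => ?_) ((hc n _).intervalIntegrable 0 t)]
    · simp [expI_zero]
    · rw [← yosida_apply hA hp]
      exact hasDerivAt_expI _ s p.1
  refine tendsto_nhds_unique ((tendsto_stoneGroup hA t p.1).sub_const p.1) ?_
  simp_rw [h1]
  refine intervalIntegral.tendsto_integral_filter_of_dominated_convergence (fun _ => ‖p.2‖)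
    (Eventually.of_forall fun n => (hc n _).aestronglyMeasurable)
    (Eventually.of_forall fun n => Eventually.of_forall fun s _ => ?_) (by simp)
    (Eventually.of_forall fun s _ => ?_)
  · rw [norm_expI_apply (isSelfAdjoint_yosida hA n), norm_smul, norm_I, one_mul]
    exact norm_yosidaMollifier_apply_le hA n p.2
  · exact tendsto_expI_yosida_apply hA s ((tendsto_yosidaMollifier hA p.2).const_smul I)

theorem hasDerivAt_stoneGroup {p : E × E} (hp : p ∈ A.graph) :
    HasDerivAt (fun t => stoneGroup hA t p.1) (I • p.2) 0 := by
  have hc := continuous_stoneGroup hA (I • p.2)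
  have h1 := intervalIntegral.integral_hasDerivAt_right (hc.intervalIntegrable 0 0)
    (hc.stronglyMeasurableAtFilter _ _) hc.continuousAt
  have h2 := h1.add_const p.1
  simp_rw [← stoneGroup_sub_eq_integral hA hp, sub_add_cancel, stoneGroup_zero] at h2
  exact h2

/-- Differentiating the constant ⟪U(t)ψ, U(t)q⟫ at 0 shows that the pair lies in the graph of A*,
and A* = A: the generator cannot be a proper extension of A. -/
theorem mem_graph_of_hasDerivAt_stoneGroup {ψ φ : E}
    (h : HasDerivAt (fun t => stoneGroup hA t ψ) (I • φ) 0) : (ψ, φ) ∈ A.graph := by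
  rw [← LinearPMap.isSelfAdjoint_def.1 hA, mem_graph_adjoint hA.dense_domain]
  intro q hq
  have h1 := h.inner ℂ (hasDerivAt_stoneGroup hA hq)
  have h2 : (fun t => ⟪stoneGroup hA t ψ, stoneGroup hA t q.1⟫_ℂ) = fun _ => ⟪ψ, q.1⟫_ℂ := by
    funext t
    exact Unitary.inner_map_map ⟨_, stoneGroup_mem_unitary hA t⟩ ψ q.1
  rw [h2] at h1
  have h3 := h1.unique (hasDerivAt_const (0 : ℝ) _)
  simp only [stoneGroup_zero, one_apply_eq_self, inner_smul_left, inner_smul_right,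
    conj_I] at h3
  have h4 : I * (⟪ψ, q.2⟫_ℂ - ⟪φ, q.1⟫_ℂ) = 0 := by linear_combination h3
  exact (sub_eq_zero.1 ((mul_eq_zero.1 h4).resolve_left I_ne_zero)).symm

end Stone

theorem isUnitaryGroupOf_stoneGroup {A : L2R →ₗ.[ℂ] L2R} (hA : IsSelfAdjoint A) :
    IsUnitaryGroupOf (stoneGroup hA) A where
  unitary := stoneGroup_mem_unitary hA
  zero := stoneGroup_zero hA
  add := stoneGroup_add hA
  continuous := continuous_stoneGroup hA
  generator _ _ := ⟨fun h => hasDerivAt_stoneGroup hA h, mem_graph_of_hasDerivAt_stoneGroup hA⟩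

theorem isUnitaryGroupOf_unitaryGroup {A : L2R →ₗ.[ℂ] L2R} (hA : IsSelfAdjoint A) :
    IsUnitaryGroupOf (unitaryGroup A) A := by
  have h : ∃ U, IsUnitaryGroupOf U A := ⟨_, isUnitaryGroupOf_stoneGroup hA⟩
  rw [unitaryGroup, dif_pos h]
  exact h.choose_spec

/-! ### Multiplication by bounded continuous functions -/

section Multiplication

theorem norm_sq_L2R (f : L2R) : ‖f‖ ^ 2 = ∫ x, ‖f x‖ ^ 2 := by
  have h := inner_self_eq_norm_sq_to_K (𝕜 := ℂ) f
  rw [L2.inner_def] at h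
  simp_rw [inner_self_eq_norm_sq_to_K] at h
  have h2 : (∫ x, ((‖f x‖ : ℂ)) ^ 2) = ((∫ x, ‖f x‖ ^ 2 : ℝ) : ℂ) := by
    rw [← integral_complex_ofReal]; simp
  have h3 := h.symm.trans h2
  refine Complex.ofReal_injective (Eq.trans ?_ h3)
  push_cast
  rfl

theorem integrable_norm_sq_L2R (f : L2R) : Integrable fun x => ‖f x‖ ^ 2 :=
  (memLp_two_iff_integrable_sq_norm (Lp.memLp f).1).1 (Lp.memLp f)

theorem memLp_mul_boundedContinuous (m : ℝ →ᵇ ℂ) {f : ℝ → ℂ} (hf : MemLp f 2 volume) :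
    MemLp (fun x => m x * f x) 2 volume :=
  hf.of_le_mul (m.continuous.aestronglyMeasurable.mul hf.1)
    (Eventually.of_forall fun x => by rw [norm_mul]; gcongr; exact m.norm_coe_le_norm x)

/-- The operator of multiplication by a bounded continuous function. -/
def mulOp (m : ℝ →ᵇ ℂ) : BoundedOp :=
  LinearMap.mkContinuous
    { toFun := fun f : L2R => MemLp.toLp _ (memLp_mul_boundedContinuous m (Lp.memLp f))
      map_add' := by
        intro f g
        rw [← MemLp.toLp_add]
        refine MemLp.toLp_congr _ _ ?_
        filter_upwards [Lp.coeFn_add f g] with x hx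
        rw [hx, Pi.add_apply, mul_add]; rfl
      map_smul' := by
        intro c f
        rw [RingHom.id_apply, ← MemLp.toLp_const_smul]
        refine MemLp.toLp_congr _ _ ?_
        filter_upwards [Lp.coeFn_smul c f] with x hx
        simp [hx, mul_left_comm] } ‖m‖ (by
    intro f
    refine Lp.norm_le_mul_norm_of_ae_le_mul ?_
    filter_upwards [(memLp_mul_boundedContinuous m (Lp.memLp f)).coeFn_toLp] with x hx
    change ‖MemLp.toLp _ (memLp_mul_boundedContinuous m (Lp.memLp f)) x‖ ≤ _
    rw [hx, norm_mul]
    gcongr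
    exact m.norm_coe_le_norm x)

theorem coeFn_mulOp (m : ℝ →ᵇ ℂ) (f : L2R) : mulOp m f =ᵐ[volume] fun x => m x * f x :=
  (memLp_mul_boundedContinuous m (Lp.memLp f)).coeFn_toLp

theorem norm_mulOp_le (m : ℝ →ᵇ ℂ) : ‖mulOp m‖ ≤ ‖m‖ :=
  LinearMap.mkContinuous_norm_le _ (norm_nonneg m) _

theorem mulOp_mul (m n : ℝ →ᵇ ℂ) : mulOp (m * n) = mulOp m * mulOp n := by
  ext f : 1
  refine Lp.ext ?_
  rw [mul_apply_eq_comp]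
  filter_upwards [coeFn_mulOp (m * n) f, coeFn_mulOp m (mulOp n f), coeFn_mulOp n f]
    with x h1 h2 h3
  rw [h1, h2, h3, ← mul_assoc]
  rfl

theorem mulOp_add (m n : ℝ →ᵇ ℂ) : mulOp (m + n) = mulOp m + mulOp n := by
  ext f : 1
  refine Lp.ext ?_
  filter_upwards [coeFn_mulOp (m + n) f, coeFn_mulOp m f, coeFn_mulOp n f,
    Lp.coeFn_add (mulOp m f) (mulOp n f)] with x h1 h2 h3 h4
  rw [add_apply, h1, h4, Pi.add_apply, h2, h3, ← add_mul]
  rfl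

theorem mulOp_smul (c : ℂ) (m : ℝ →ᵇ ℂ) : mulOp (c • m) = c • mulOp m := by
  ext f : 1
  refine Lp.ext ?_
  filter_upwards [coeFn_mulOp (c • m) f, coeFn_mulOp m f,
    Lp.coeFn_smul c (mulOp m f)] with x h1 h2 h3
  rw [smul_apply, h1, h3, Pi.smul_apply, h2, smul_eq_mul, ← mul_assoc]
  rfl

theorem mulOp_one : mulOp 1 = 1 := by
  ext f : 1
  refine Lp.ext ?_
  filter_upwards [coeFn_mulOp 1 f] with x h1
  rw [h1]
  simp

theorem mulOp_star (m : ℝ →ᵇ ℂ) : mulOp (star m) = star (mulOp m) := by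
  refine (ContinuousLinearMap.eq_adjoint_iff _ _).2 fun f g => ?_
  rw [L2.inner_def, L2.inner_def]
  refine integral_congr_ae ?_
  filter_upwards [coeFn_mulOp (star m) f, coeFn_mulOp m g] with x h1 h2
  rw [h1, h2]
  simp only [BoundedContinuousFunction.star_apply, RCLike.inner_apply, map_mul, RCLike.star_def,
    Complex.conj_conj]
  ring

/-- Multiplication operators as a star homomorphism. -/
def mulOpHom : (ℝ →ᵇ ℂ) →⋆ₐ[ℂ] BoundedOp where
  toFun := mulOp
  map_one' := mulOp_one
  map_mul' := mulOp_mul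
  map_zero' := by simpa using mulOp_smul 0 0
  map_add' := mulOp_add
  commutes' c := by
    have h : (algebraMap ℂ (ℝ →ᵇ ℂ)) c = c • 1 := Algebra.algebraMap_eq_smul_one c
    rw [h, mulOp_smul, mulOp_one, Algebra.algebraMap_eq_smul_one]
  map_star' := mulOp_star

theorem continuous_mulOp : Continuous mulOp := by
  refine (LipschitzWith.of_dist_le_mul (K := 1) fun m n => ?_).continuous
  have h : mulOp m - mulOp n = mulOp (m - n) := (map_sub mulOpHom m n).symm
  rw [dist_eq_norm, dist_eq_norm, h, NNReal.coe_one, one_mul]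
  exact norm_mulOp_le _

end Multiplication

/-! ### The Fourier transform on L² and bounded Fourier multipliers -/

section Fourier

/-- The Fourier transform on `L²(ℝ)`. -/
def fourierL2 : L2R ≃ₗᵢ[ℂ] L2R := Lp.fourierTransformₗᵢ ℝ ℂ

theorem coeFn_schwartzIncl (f : 𝓢(ℝ, ℂ)) : schwartzIncl f =ᵐ[volume] f := f.coeFn_toLp 2 volume

theorem dense_schwartzDomain : Dense (schwartzDomain : Set L2R) :=
  SchwartzMap.denseRange_toLpCLM (F := ℂ) (E := ℝ) (p := 2) ENNReal.ofNat_ne_top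

theorem denseRange_schwartzIncl : DenseRange schwartzIncl := dense_schwartzDomain

theorem fourierL2_schwartzIncl (f : 𝓢(ℝ, ℂ)) : fourierL2 (schwartzIncl f) = schwartzIncl (𝓕 f) :=
  SchwartzMap.toLp_fourier_eq f

theorem fourierL2_symm_schwartzIncl (f : 𝓢(ℝ, ℂ)) :
    fourierL2.symm (schwartzIncl f) = schwartzIncl (𝓕⁻ f) :=
  SchwartzMap.toLp_fourierInv_eq f

theorem opNorm_le_of_schwartz {T : BoundedOp} {C : ℝ} (hC : 0 ≤ C)
    (h : ∀ f : 𝓢(ℝ, ℂ), ‖T (schwartzIncl f)‖ ≤ C * ‖schwartzIncl f‖) : ‖T‖ ≤ C :=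
  T.opNorm_le_bound hC fun x => denseRange_schwartzIncl.induction_on x
    (isClosed_le (by fun_prop) (by fun_prop)) h

theorem mulOp_schwartzIncl (m : ℝ →ᵇ ℂ) (hm : Function.HasTemperateGrowth m) (f : 𝓢(ℝ, ℂ)) :
    mulOp m (schwartzIncl f) = schwartzIncl (SchwartzMap.smulLeftCLM ℂ m f) := by
  refine Lp.ext ?_
  filter_upwards [coeFn_mulOp m (schwartzIncl f), coeFn_schwartzIncl f,
    coeFn_schwartzIncl (SchwartzMap.smulLeftCLM ℂ m f)] with x h1 h2 h3
  rw [h1, h2, h3, SchwartzMap.smulLeftCLM_apply_apply hm, smul_eq_mul]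

/-- The Fourier multiplier `m(P)`, normalised so that `P` is multiplication by `2πξ`. -/
def fourierMul (m : ℝ →ᵇ ℂ) : BoundedOp :=
  (fourierL2.symm : L2R →L[ℂ] L2R) * mulOp m * (fourierL2 : L2R →L[ℂ] L2R)

theorem fourierMul_apply (m : ℝ →ᵇ ℂ) (f : L2R) :
    fourierMul m f = fourierL2.symm (mulOp m (fourierL2 f)) := rfl

theorem fourierMul_schwartzIncl (m : ℝ →ᵇ ℂ) (hm : Function.HasTemperateGrowth m) (f : 𝓢(ℝ, ℂ)) :
    fourierMul m (schwartzIncl f) = schwartzIncl (SchwartzMap.fourierMultiplierCLM ℂ m f) := by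
  rw [fourierMul_apply, fourierL2_schwartzIncl, mulOp_schwartzIncl m hm,
    fourierL2_symm_schwartzIncl, SchwartzMap.fourierMultiplierCLM_apply]

theorem norm_fourierMul_le (m : ℝ →ᵇ ℂ) : ‖fourierMul m‖ ≤ ‖m‖ := by
  refine ContinuousLinearMap.opNorm_le_bound _ (norm_nonneg _) fun f => ?_
  rw [fourierMul_apply, LinearIsometryEquiv.norm_map]
  refine ((mulOp m).le_opNorm _).trans ?_
  rw [LinearIsometryEquiv.norm_map]
  gcongr
  exact norm_mulOp_le m

end Fourier

/-! ### Hilbert–Schmidt operators f(Q) m(P) with f and m square integrable -/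

section KernelOperators

/-- The plane wave `ξ ↦ e^{-2πixξ}` times `conj (m ξ)`. -/
def waveFun (m : ℝ → ℂ) (x ξ : ℝ) : ℂ :=
  cexp (-(2 * Real.pi * (ξ * x) : ℝ) * I) * (starRingEnd ℂ) (m ξ)

theorem norm_waveFun (m : ℝ → ℂ) (x ξ : ℝ) : ‖waveFun m x ξ‖ = ‖m ξ‖ := by
  rw [waveFun, norm_mul, ← ofReal_neg, norm_exp_ofReal_mul_I, one_mul, RCLike.norm_conj]

theorem memLp_waveFun {m : ℝ → ℂ} (hm : MemLp m 2 volume) (x : ℝ) :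
    MemLp (waveFun m x) 2 volume := by
  refine hm.of_le ?_ (Eventually.of_forall fun ξ => (norm_waveFun m x ξ).le)
  refine AEStronglyMeasurable.mul (Continuous.aestronglyMeasurable (by fun_prop)) ?_
  exact Complex.continuous_conj.comp_aestronglyMeasurable hm.1

/-- The vectors `e_x ∈ L²(ℝ)` such that `⟪e_x, φ⟫` is the inverse Fourier transform of `m φ`
at `x`. -/
def waveVec {m : ℝ → ℂ} (hm : MemLp m 2 volume) (x : ℝ) : L2R := MemLp.toLp _ (memLp_waveFun hm x)

theorem norm_waveVec {m : ℝ → ℂ} (hm : MemLp m 2 volume) (x : ℝ) :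
    ‖waveVec hm x‖ = ‖hm.toLp m‖ := by
  rw [waveVec, Lp.norm_toLp, Lp.norm_toLp]
  congr 1
  exact eLpNorm_congr_norm_ae (Eventually.of_forall (norm_waveFun m x))

theorem inner_waveVec {m : ℝ → ℂ} (hm : MemLp m 2 volume) (x : ℝ) (φ : L2R) :
    ⟪waveVec hm x, φ⟫_ℂ = ∫ ξ, cexp ((2 * Real.pi * (ξ * x) : ℝ) * I) * (m ξ * φ ξ) := by
  rw [L2.inner_def]
  refine integral_congr_ae ?_
  filter_upwards [(memLp_waveFun hm x).coeFn_toLp] with ξ h1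
  rw [waveVec, h1, RCLike.inner_apply, waveFun, map_mul, Complex.conj_conj, ← Complex.exp_conj,
    map_mul, conj_I, map_neg, conj_ofReal, neg_mul_neg]
  ring

theorem continuous_inner_waveVec {m : ℝ → ℂ} (hm : MemLp m 2 volume) (φ : L2R) :
    Continuous fun x => ⟪waveVec hm x, φ⟫_ℂ := by
  simp_rw [inner_waveVec]
  have hi : Integrable (fun ξ => m ξ * φ ξ) volume := hm.integrable_mul (Lp.memLp φ)
  refine continuous_of_dominated (bound := fun ξ => ‖m ξ * φ ξ‖) (fun x => ?_)
    (fun x => Eventually.of_forall fun ξ => ?_) hi.norm (Eventually.of_forall fun ξ => by fun_prop)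
  · exact (Continuous.aestronglyMeasurable (by fun_prop)).mul hi.1
  · rw [norm_mul, norm_exp_ofReal_mul_I, one_mul]

theorem norm_inner_waveVec_le {m : ℝ → ℂ} (hm : MemLp m 2 volume) (φ : L2R) (x : ℝ) :
    ‖⟪waveVec hm x, φ⟫_ℂ‖ ≤ ‖hm.toLp m‖ * ‖φ‖ :=
  (norm_inner_le_norm _ _).trans_eq (by rw [norm_waveVec])

theorem memLp_mul_inner_waveVec {f m : ℝ → ℂ} (hf : MemLp f 2 volume) (hm : MemLp m 2 volume)
    (φ : L2R) : MemLp (fun x => f x * ⟪waveVec hm x, φ⟫_ℂ) 2 volume :=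
  hf.of_le_mul (c := ‖hm.toLp m‖ * ‖φ‖)
    (hf.1.mul (continuous_inner_waveVec hm φ).aestronglyMeasurable)
    (Eventually.of_forall fun x => by
      rw [norm_mul, mul_comm]
      gcongr
      exact norm_inner_waveVec_le hm φ x)

/-- The operator `φ ↦ f · 𝓕⁻(m φ)`. -/
def waveOp {f m : ℝ → ℂ} (hf : MemLp f 2 volume) (hm : MemLp m 2 volume) : BoundedOp :=
  LinearMap.mkContinuous
    { toFun := fun φ : L2R => MemLp.toLp _ (memLp_mul_inner_waveVec hf hm φ)
      map_add' := by
        intro φ χ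
        rw [← MemLp.toLp_add]
        refine MemLp.toLp_congr _ _ (Eventually.of_forall fun x => ?_)
        simp [inner_add_right, mul_add]
      map_smul' := by
        intro c φ
        rw [RingHom.id_apply, ← MemLp.toLp_const_smul]
        refine MemLp.toLp_congr _ _ (Eventually.of_forall fun x => ?_)
        simp [inner_smul_right, mul_left_comm] } (‖hf.toLp f‖ * ‖hm.toLp m‖) (by
    intro φ
    rw [mul_assoc, mul_comm]
    refine Lp.norm_le_mul_norm_of_ae_le_mul ?_
    filter_upwards [(memLp_mul_inner_waveVec hf hm φ).coeFn_toLp, hf.coeFn_toLp] with x h1 h2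
    change ‖MemLp.toLp _ (memLp_mul_inner_waveVec hf hm φ) x‖ ≤ _
    rw [h1, h2, norm_mul, mul_comm]
    gcongr
    exact norm_inner_waveVec_le hm φ x)

theorem coeFn_waveOp {f m : ℝ → ℂ} (hf : MemLp f 2 volume) (hm : MemLp m 2 volume) (φ : L2R) :
    waveOp hf hm φ =ᵐ[volume] fun x => f x * ⟪waveVec hm x, φ⟫_ℂ :=
  (memLp_mul_inner_waveVec hf hm φ).coeFn_toLp

theorem norm_waveOp_le {f m : ℝ → ℂ} (hf : MemLp f 2 volume) (hm : MemLp m 2 volume) :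
    ‖waveOp hf hm‖ ≤ ‖hf.toLp f‖ * ‖hm.toLp m‖ :=
  LinearMap.mkContinuous_norm_le _ (by positivity) _

/-- At each x, Bessel's inequality bounds the sum of |⟪e_x, b_i⟫|² by ‖e_x‖² = ‖m‖². Integrating
against |f(x)|² gives the Hilbert–Schmidt bound without introducing a kernel on the plane. -/
theorem isCompactOperator_waveOp {f m : ℝ → ℂ} (hf : MemLp f 2 volume) (hm : MemLp m 2 volume) :
    IsCompactOperator (waveOp hf hm) := by
  obtain ⟨w, b, -⟩ := exists_hilbertBasis ℂ L2R
  refine isCompactOperator_of_hilbertSchmidt b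
    (C := ∫ x, ‖hm.toLp m‖ ^ 2 * ‖(hf.toLp f : L2R) x‖ ^ 2) fun s => ?_
  simp_rw [norm_sq_L2R]
  rw [← integral_finsetSum _ fun i _ => integrable_norm_sq_L2R _]
  refine integral_mono_ae (integrable_finsetSum _ fun i _ => integrable_norm_sq_L2R _)
    ((integrable_norm_sq_L2R _).const_mul _) ?_
  have h1 : ∀ᵐ x, ∀ i ∈ s, waveOp hf hm (b i) x = f x * ⟪waveVec hm x, b i⟫_ℂ :=
    (ae_ball_iff s.countable_toSet).2 fun i _ => coeFn_waveOp hf hm (b i)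
  filter_upwards [h1, hf.coeFn_toLp] with x hx h2
  have h3 : ∑ i ∈ s, ‖waveOp hf hm (b i) x‖ ^ 2 =
      (∑ i ∈ s, ‖⟪b i, waveVec hm x⟫_ℂ‖ ^ 2) * ‖f x‖ ^ 2 := by
    rw [Finset.sum_mul]
    refine Finset.sum_congr rfl fun i hi => ?_
    rw [hx i hi, norm_mul, mul_pow, mul_comm, norm_inner_symm]
  rw [← norm_sq_L2R (hm.toLp m)]
  change ∑ i ∈ s, ‖waveOp hf hm (b i) x‖ ^ 2 ≤ ‖hm.toLp m‖ ^ 2 * ‖(hf.toLp f : L2R) x‖ ^ 2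
  rw [h3, h2, ← norm_waveVec hm x]
  gcongr
  exact b.orthonormal.sum_inner_products_le _

/-- The operator `f(Q) m(P)` for square integrable functions `f` and `m`. -/
def prodOp {f m : ℝ → ℂ} (hf : MemLp f 2 volume) (hm : MemLp m 2 volume) : BoundedOp :=
  waveOp hf hm * (fourierL2 : L2R →L[ℂ] L2R)

theorem isCompactOperator_prodOp {f m : ℝ → ℂ} (hf : MemLp f 2 volume) (hm : MemLp m 2 volume) :
    IsCompactOperator (prodOp hf hm) :=
  (isCompactOperator_waveOp hf hm).comp_clm (fourierL2 : L2R →L[ℂ] L2R)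

theorem norm_prodOp_le {f m : ℝ → ℂ} (hf : MemLp f 2 volume) (hm : MemLp m 2 volume) :
    ‖prodOp hf hm‖ ≤ ‖hf.toLp f‖ * ‖hm.toLp m‖ := by
  refine ContinuousLinearMap.opNorm_le_bound _ (by positivity) fun φ => ?_
  change ‖waveOp hf hm (fourierL2 φ)‖ ≤ _
  refine ((waveOp hf hm).le_opNorm _).trans ?_
  rw [LinearIsometryEquiv.norm_map]
  gcongr
  exact norm_waveOp_le hf hm

theorem inner_waveVec_schwartzIncl {m : ℝ → ℂ} (hm : MemLp m 2 volume)
    (hmt : Function.HasTemperateGrowth m) (θ : 𝓢(ℝ, ℂ)) (x : ℝ) :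
    ⟪waveVec hm x, schwartzIncl (𝓕 θ)⟫_ℂ = SchwartzMap.fourierMultiplierCLM ℂ m θ x := by
  rw [inner_waveVec, SchwartzMap.fourierMultiplierCLM_apply, SchwartzMap.fourierInv_coe,
    Real.fourierInv_eq']
  refine integral_congr_ae ?_
  filter_upwards [coeFn_schwartzIncl (𝓕 θ)] with ξ h1
  rw [h1, SchwartzMap.smulLeftCLM_apply_apply hmt]
  simp [mul_comm x ξ]

theorem prodOp_schwartzIncl {f m : ℝ → ℂ} (hf : MemLp f 2 volume) (hm : MemLp m 2 volume)
    (hmt : Function.HasTemperateGrowth m) (θ : 𝓢(ℝ, ℂ)) :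
    prodOp hf hm (schwartzIncl θ) =ᵐ[volume]
      fun x => f x * SchwartzMap.fourierMultiplierCLM ℂ m θ x := by
  have h : prodOp hf hm (schwartzIncl θ) = waveOp hf hm (schwartzIncl (𝓕 θ)) := by
    rw [← fourierL2_schwartzIncl]; rfl
  rw [h]
  filter_upwards [coeFn_waveOp hf hm (schwartzIncl (𝓕 θ))] with x h1
  rw [h1, inner_waveVec_schwartzIncl hm hmt]

end KernelOperators

/-! ### Symbols of temperate growth -/

section TemperateGrowth

variable {a : ℝ → ℝ}

theorem hasTemperateGrowth_ofReal_comp (ha : Function.HasTemperateGrowth a) :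
    Function.HasTemperateGrowth fun x => (a x : ℂ) :=
  Function.HasTemperateGrowth.comp Function.Complex.hasTemperateGrowth_ofReal ha

/-- `1 / (a + i c)` has temperate growth if `a` has. -/
theorem hasTemperateGrowth_inv_add_I_mul (ha : Function.HasTemperateGrowth a) {c : ℝ}
    (hc : c ≠ 0) : Function.HasTemperateGrowth fun x => ((a x : ℂ) + I * c)⁻¹ := by
  -- The inverse is written as (a - ic) c⁻² (1 + (a/c)²)⁻¹, so that only the function (1 + y²)⁻¹ has
  -- to be inverted.
  have h1 : Function.HasTemperateGrowth fun x => c⁻¹ * a x :=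
    (Function.HasTemperateGrowth.const c⁻¹).mul ha
  have h2 := (Function.hasTemperateGrowth_one_add_norm_sq_rpow ℝ (-1)).comp h1
  have h3 := ((hasTemperateGrowth_ofReal_comp ha).sub
    (Function.HasTemperateGrowth.const (I * c))).mul
    ((Function.HasTemperateGrowth.const ((c : ℂ)⁻¹ ^ 2)).mul (hasTemperateGrowth_ofReal_comp h2))
  refine (congrArg Function.HasTemperateGrowth (funext fun x => ?_)).mpr h3
  have hc' : (c : ℂ) ≠ 0 := ofReal_ne_zero.2 hc
  have h4 : (c : ℂ) ^ 2 + (a x : ℂ) ^ 2 ≠ 0 := by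
    norm_cast
    positivity
  have h5 : (a x : ℂ) + I * c ≠ 0 := by
    intro h
    have := congrArg Complex.im h
    simp [hc] at this
  simp only [Pi.mul_apply, Pi.sub_apply, Function.comp_apply, Real.rpow_neg_one, Real.norm_eq_abs,
    sq_abs]
  push_cast
  have h6 : (1 : ℂ) + ((c : ℂ)⁻¹ * a x) ^ 2 = ((c : ℂ) ^ 2 + (a x : ℂ) ^ 2) / (c : ℂ) ^ 2 := by
    field_simp
  rw [h6, inv_div, ← mul_div_assoc, ← mul_pow, inv_mul_cancel₀ hc', one_pow, inv_eq_one_div,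
    mul_one_div, div_eq_div_iff h5 h4]
  linear_combination ((c : ℂ) ^ 2) * I_sq

theorem hasTemperateGrowth_cexp_mul_I : Function.HasTemperateGrowth fun y : ℝ => cexp (y * I) := by
  have h : ∀ n : ℕ, iteratedDeriv n (fun y : ℝ => cexp (y * I)) = fun y : ℝ => I ^ n * cexp (y * I) := by
    intro n
    induction n with
    | zero => simp
    | succ n ih =>
      rw [iteratedDeriv_succ, ih]
      funext y
      have h1 : HasDerivAt (fun y : ℝ => (y : ℂ) * I) (1 * I) y :=
        (Complex.ofRealCLM.hasDerivAt (x := y)).mul_const I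
      rw [(h1.cexp.const_mul (I ^ n)).deriv]
      ring
  refine ⟨(Complex.ofRealCLM.contDiff.mul contDiff_const).cexp, fun n => ⟨0, 1, fun x => ?_⟩⟩
  rw [norm_iteratedFDeriv_eq_norm_iteratedDeriv, h, norm_mul, norm_exp_ofReal_mul_I]
  simp

theorem hasTemperateGrowth_cexp_comp (ha : Function.HasTemperateGrowth a) :
    Function.HasTemperateGrowth fun x => cexp (a x * I) :=
  hasTemperateGrowth_cexp_mul_I.comp ha

theorem norm_inv_add_I_mul_le (y : ℝ) {c : ℝ} (hc : c ≠ 0) : ‖((y : ℂ) + I * c)⁻¹‖ ≤ |c|⁻¹ := by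
  rw [norm_inv]
  have h := Complex.abs_im_le_norm ((y : ℂ) + I * c)
  simp only [add_im, ofReal_im, mul_im, I_re, I_im, ofReal_re, zero_mul, one_mul, zero_add] at h
  have : 0 < |c| := abs_pos.2 hc
  gcongr

/-- The bounded continuous function `1 / (a + i c)`. -/
def invSymbol (a : ℝ → ℝ) (ha : Continuous a) {c : ℝ} (hc : c ≠ 0) : ℝ →ᵇ ℂ :=
  BoundedContinuousFunction.ofNormedAddCommGroup (fun x => ((a x : ℂ) + I * c)⁻¹)
    (by
      refine Continuous.inv₀ (by fun_prop) fun x h => ?_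
      have := congrArg Complex.im h
      simp [hc] at this) |c|⁻¹ fun x => norm_inv_add_I_mul_le _ hc

theorem invSymbol_apply (a : ℝ → ℝ) (ha : Continuous a) {c : ℝ} (hc : c ≠ 0) (x : ℝ) :
    invSymbol a ha hc x = ((a x : ℂ) + I * c)⁻¹ := rfl

theorem norm_invSymbol_le (a : ℝ → ℝ) (ha : Continuous a) {c : ℝ} (hc : c ≠ 0) :
    ‖invSymbol a ha hc‖ ≤ |c|⁻¹ :=
  BoundedContinuousFunction.norm_ofNormedAddCommGroup_le _ (by positivity) _

theorem add_I_mul_ne_zero (y : ℝ) {c : ℝ} (hc : c ≠ 0) : (y : ℂ) + I * c ≠ 0 := by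
  intro h
  have := congrArg Complex.im h
  simp [hc] at this

end TemperateGrowth

/-! ### Momentum and kinetic energy as Fourier multipliers -/

section Momentum

/-- The symbol of the momentum operator. -/
def momentumSymbol (ξ : ℝ) : ℝ := 2 * Real.pi * ξ

/-- The symbol of the free Hamiltonian. -/
def energySymbol (ξ : ℝ) : ℝ := momentumSymbol ξ ^ 2

theorem hasTemperateGrowth_momentumSymbol : Function.HasTemperateGrowth momentumSymbol :=
  (Function.HasTemperateGrowth.const (2 * Real.pi)).mul Function.HasTemperateGrowth.id'

theorem hasTemperateGrowth_energySymbol : Function.HasTemperateGrowth energySymbol :=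
  hasTemperateGrowth_momentumSymbol.pow 2

theorem continuous_momentumSymbol : Continuous momentumSymbol :=
  hasTemperateGrowth_momentumSymbol.1.continuous

theorem continuous_energySymbol : Continuous energySymbol :=
  hasTemperateGrowth_energySymbol.1.continuous

/-- Fourier multipliers on Schwartz functions. -/
abbrev mult (m : ℝ → ℂ) : 𝓢(ℝ, ℂ) →L[ℂ] 𝓢(ℝ, ℂ) := SchwartzMap.fourierMultiplierCLM ℂ m

theorem fourier_mult {m : ℝ → ℂ} (hm : Function.HasTemperateGrowth m) (f : 𝓢(ℝ, ℂ)) (ξ : ℝ) :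
    𝓕 (mult m f) ξ = m ξ * 𝓕 f ξ := by
  rw [mult, SchwartzMap.fourierMultiplierCLM_apply, FourierTransform.fourier_fourierInv_eq,
    SchwartzMap.smulLeftCLM_apply_apply hm, smul_eq_mul]

theorem eq_of_fourier_eq {f g : 𝓢(ℝ, ℂ)} (h : ∀ ξ, 𝓕 f ξ = 𝓕 g ξ) : f = g := by
  have : 𝓕 f = 𝓕 g := SchwartzMap.ext h
  exact (FourierTransform.fourierEquiv ℂ 𝓢(ℝ, ℂ)).injective this

theorem fourier_momentumSchwartz (f : 𝓢(ℝ, ℂ)) (ξ : ℝ) :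
    𝓕 (momentumSchwartz f) ξ = momentumSymbol ξ * 𝓕 f ξ := by
  have h1 : momentumSchwartz f = (-I) • (LineDeriv.lineDerivOp (1 : ℝ) f) := by
    ext x
    rw [momentumSchwartz_apply]
    change _ = -I • (LineDeriv.lineDerivOp (1 : ℝ) f) x
    rw [SchwartzMap.lineDerivOp_apply_eq_fderiv]
    simp
  rw [h1, FourierTransform.fourier_smul, SchwartzMap.fourier_lineDerivOp_eq]
  have h2 : Function.HasTemperateGrowth (fun x : ℝ => inner ℝ x 1) := by fun_prop
  simp only [smul_apply, SchwartzMap.smulLeftCLM_apply_apply h2, smul_eq_mul,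
    momentumSymbol]
  simp
  linear_combination (-(2 * Real.pi * ξ : ℂ) * 𝓕 f ξ) * I_mul_I

theorem fourier_momentumSchwartz_sq (f : 𝓢(ℝ, ℂ)) (ξ : ℝ) :
    𝓕 (momentumSchwartz (momentumSchwartz f)) ξ = energySymbol ξ * 𝓕 f ξ := by
  rw [fourier_momentumSchwartz, fourier_momentumSchwartz, energySymbol]
  push_cast
  ring

theorem inner_schwartzIncl (f g : 𝓢(ℝ, ℂ)) :
    ⟪schwartzIncl f, schwartzIncl g⟫_ℂ = ∫ x, (starRingEnd ℂ) (f x) * g x := by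
  refine (SchwartzMap.inner_toL2_toL2_eq f g volume).trans ?_
  simp_rw [RCLike.inner_apply, mul_comm]

/-- Operators which are multiplication by a real function in Fourier space are symmetric. -/
theorem inner_schwartzIncl_eq_of_fourier {a : ℝ → ℝ} {A : 𝓢(ℝ, ℂ) → 𝓢(ℝ, ℂ)}
    (hA : ∀ f ξ, 𝓕 (A f) ξ = a ξ * 𝓕 f ξ) (f g : 𝓢(ℝ, ℂ)) :
    ⟪schwartzIncl (A f), schwartzIncl g⟫_ℂ = ⟪schwartzIncl f, schwartzIncl (A g)⟫_ℂ := by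
  rw [← fourierL2.inner_map_map, ← fourierL2.inner_map_map (schwartzIncl f)]
  simp_rw [fourierL2_schwartzIncl, inner_schwartzIncl, hA, map_mul, conj_ofReal]
  congr 1
  funext x
  ring

end Momentum

/-! ### Essential self-adjointness for potentials in L² + L^∞ -/

section Hamiltonian

theorem norm_sq_toLp {m : ℝ → ℂ} (hm : MemLp m 2 volume) : ‖hm.toLp m‖ ^ 2 = ∫ x, ‖m x‖ ^ 2 := by
  rw [norm_sq_L2R]
  refine integral_congr_ae ?_
  filter_upwards [hm.coeFn_toLp] with x hx
  rw [hx]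

theorem memLp_mul_schwartz {w : ℝ → ℂ} (hw : MemLp w 2 volume) (f : 𝓢(ℝ, ℂ)) :
    MemLp (fun x => w x * f x) 2 volume := by
  obtain ⟨C, hC⟩ : ∃ C, ∀ x, ‖f x‖ ≤ C := ⟨_, f.toBoundedContinuousFunction.norm_coe_le_norm⟩
  refine hw.of_le_mul (c := C) (hw.1.mul f.continuous.aestronglyMeasurable)
    (Eventually.of_forall fun x => ?_)
  rw [norm_mul, mul_comm]
  gcongr
  exact hC x

theorem mem_graph_schwartzOp {A : 𝓢(ℝ, ℂ) →ₗ[ℂ] 𝓢(ℝ, ℂ)} {p : L2R × L2R} :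
    p ∈ (schwartzOp A).graph ↔ ∃ f, p = (schwartzIncl f, schwartzIncl (A f)) := by
  rw [LinearPMap.mem_graph_iff]
  constructor
  · rintro ⟨⟨_, f, rfl⟩, h1, h2⟩
    exact ⟨f, Prod.ext h1.symm (h2.symm.trans (schwartzOp_apply A f))⟩
  · rintro ⟨f, rfl⟩
    exact ⟨⟨schwartzIncl f, LinearMap.mem_range_self _ f⟩, rfl, schwartzOp_apply A f⟩

variable {V : ℝ → ℝ} {w : ℝ → ℂ} {b : ℝ →ᵇ ℂ}

theorem memLp_potential_mul (hw : MemLp w 2 volume) (hV : ∀ x, (V x : ℂ) = w x + b x)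
    (f : 𝓢(ℝ, ℂ)) : MemLp (fun x => (V x : ℂ) * f x) 2 volume := by
  simp_rw [hV, add_mul]
  exact (memLp_mul_schwartz hw f).add (memLp_mul_boundedContinuous b (f.memLp 2))

theorem schwartzIncl_mem_domain_potential {f : 𝓢(ℝ, ℂ)}
    (hf : MemLp (fun x => (V x : ℂ) * f x) 2 volume) :
    schwartzIncl f ∈ (potential V).domain := by
  refine (memLp_congr_ae ?_).mpr hf
  filter_upwards [coeFn_schwartzIncl f] with x hx
  rw [hx]

theorem potential_schwartzIncl {f : 𝓢(ℝ, ℂ)} (hf : MemLp (fun x => (V x : ℂ) * f x) 2 volume)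
    (h : schwartzIncl f ∈ (potential V).domain) :
    potential V ⟨schwartzIncl f, h⟩ = hf.toLp (fun x => (V x : ℂ) * f x) := by
  change MemLp.toLp (fun x => (V x : ℂ) * schwartzIncl f x) h = _
  refine MemLp.toLp_congr _ _ ?_
  filter_upwards [coeFn_schwartzIncl f] with x hx
  rw [hx]

theorem domain_hamiltonian (h : ∀ f : 𝓢(ℝ, ℂ), MemLp (fun x => (V x : ℂ) * f x) 2 volume) :
    (hamiltonian V).domain = schwartzDomain := by
  change schwartzDomain ⊓ (potential V).domain = schwartzDomain
  rw [inf_eq_left]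
  rintro _ ⟨f, rfl⟩
  exact schwartzIncl_mem_domain_potential (h f)

theorem mem_graph_hamiltonian (h : ∀ f : 𝓢(ℝ, ℂ), MemLp (fun x => (V x : ℂ) * f x) 2 volume)
    {p : L2R × L2R} : p ∈ (hamiltonian V).graph ↔ ∃ f, p = (schwartzIncl f,
      schwartzIncl (momentumSchwartz (momentumSchwartz f)) +
        (h f).toLp (fun x => (V x : ℂ) * f x)) := by
  have key : ∀ (f : 𝓢(ℝ, ℂ)) (hf : schwartzIncl f ∈ (hamiltonian V).domain),
      hamiltonian V ⟨schwartzIncl f, hf⟩ =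
        schwartzIncl (momentumSchwartz (momentumSchwartz f)) +
          (h f).toLp (fun x => (V x : ℂ) * f x) := by
    intro f hf
    rw [← potential_schwartzIncl (h f) hf.2]
    have := schwartzOp_apply (momentumSchwartz ∘ₗ momentumSchwartz) f
    change freeHamiltonian ⟨schwartzIncl f, hf.1⟩ + potential V ⟨schwartzIncl f, hf.2⟩ = _
    congr 1
  rw [LinearPMap.mem_graph_iff]
  constructor
  · rintro ⟨⟨x, hx⟩, h1, h2⟩
    obtain ⟨f, rfl⟩ := hx.1
    exact ⟨f, Prod.ext h1.symm (h2.symm.trans (key f hx))⟩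
  · rintro ⟨f, rfl⟩
    exact ⟨⟨schwartzIncl f, LinearMap.mem_range_self _ f,
      schwartzIncl_mem_domain_potential (h f)⟩, rfl, key f _⟩

/-- This makes the free Hamiltonian an instance of the perturbed one, so that a single
self-adjointness proof serves both. -/
theorem hamiltonian_zero : hamiltonian (fun _ => 0) = freeHamiltonian := by
  have h : ∀ f : 𝓢(ℝ, ℂ), MemLp (fun x => (((fun _ => 0 : ℝ → ℝ) x : ℝ) : ℂ) * f x) 2 volume := by
    intro f
    simp
  refine LinearPMap.eq_of_eq_graph (SetLike.ext fun p => ?_)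
  rw [mem_graph_hamiltonian h, freeHamiltonian, mem_graph_schwartzOp]
  have h0 : ∀ f, (h f).toLp (fun x => (((fun _ => 0 : ℝ → ℝ) x : ℝ) : ℂ) * f x) = 0 := by
    intro f
    refine Lp.ext ?_
    filter_upwards [(h f).coeFn_toLp, Lp.coeFn_zero ℂ 2 (volume : Measure ℝ)] with x h1 h2
    rw [h1, h2]
    simp
  simp_rw [h0, add_zero]
  rfl

theorem isFormalAdjoint_hamiltonian
    (h : ∀ f : 𝓢(ℝ, ℂ), MemLp (fun x => (V x : ℂ) * f x) 2 volume) :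
    (hamiltonian V).IsFormalAdjoint (hamiltonian V) := by
  refine isFormalAdjoint_of_isSymmetricRel fun p hp q hq => ?_
  obtain ⟨f, rfl⟩ := (mem_graph_hamiltonian h).1 hp
  obtain ⟨g, rfl⟩ := (mem_graph_hamiltonian h).1 hq
  simp only [inner_add_left, inner_add_right]
  rw [inner_schwartzIncl_eq_of_fourier (A := fun f => momentumSchwartz (momentumSchwartz f))
    fourier_momentumSchwartz_sq]
  congr 1
  rw [L2.inner_def, L2.inner_def]
  refine integral_congr_ae ?_
  filter_upwards [(h f).coeFn_toLp, (h g).coeFn_toLp, coeFn_schwartzIncl f, coeFn_schwartzIncl g]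
    with x h1 h2 h3 h4
  rw [h1, h2, h3, h4]
  simp only [RCLike.inner_apply, map_mul, conj_ofReal]
  ring

/-- The operator `V(Q) m(P)`, where `V = w + b` with `w` square integrable and `b` bounded. -/
def potOp (hw : MemLp w 2 volume) (b : ℝ →ᵇ ℂ) {m : ℝ →ᵇ ℂ} (hm : MemLp m 2 volume) : BoundedOp :=
  prodOp hw hm + mulOp b * fourierMul m

theorem coeFn_potOp (hw : MemLp w 2 volume) (b : ℝ →ᵇ ℂ) {m : ℝ →ᵇ ℂ} (hm : MemLp m 2 volume)
    (hmt : Function.HasTemperateGrowth m) (θ : 𝓢(ℝ, ℂ)) :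
    potOp hw b hm (schwartzIncl θ) =ᵐ[volume] fun x => (w x + b x) * mult m θ x := by
  have h0 : potOp hw b hm (schwartzIncl θ) =
      prodOp hw hm (schwartzIncl θ) + mulOp b (schwartzIncl (mult m θ)) := by
    rw [← fourierMul_schwartzIncl m hmt]; rfl
  rw [h0]
  filter_upwards [Lp.coeFn_add (prodOp hw hm (schwartzIncl θ)) (mulOp b (schwartzIncl (mult m θ))),
    prodOp_schwartzIncl hw hm hmt θ, coeFn_mulOp b (schwartzIncl (mult m θ)),
    coeFn_schwartzIncl (mult m θ)] with x h1 h2 h3 h4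
  rw [h1, Pi.add_apply, h2, h3, h4, add_mul]

theorem potOp_schwartzIncl (hw : MemLp w 2 volume) (hV : ∀ x, (V x : ℂ) = w x + b x)
    {m : ℝ →ᵇ ℂ} (hm : MemLp m 2 volume) (hmt : Function.HasTemperateGrowth m) (θ : 𝓢(ℝ, ℂ)) :
    potOp hw b hm (schwartzIncl θ) =
      (memLp_potential_mul hw hV (mult m θ)).toLp (fun x => (V x : ℂ) * mult m θ x) := by
  refine Lp.ext ?_
  filter_upwards [coeFn_potOp hw b hm hmt θ, (memLp_potential_mul hw hV (mult m θ)).coeFn_toLp]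
    with x h1 h2
  rw [h1, h2, hV]

theorem norm_potOp_le (hw : MemLp w 2 volume) (b : ℝ →ᵇ ℂ) {m : ℝ →ᵇ ℂ}
    (hm : MemLp m 2 volume) : ‖potOp hw b hm‖ ≤ ‖hw.toLp w‖ * ‖hm.toLp m‖ + ‖b‖ * ‖m‖ :=
  (norm_add_le _ _).trans (add_le_add (norm_prodOp_le hw hm) ((norm_mul_le _ _).trans
    (mul_le_mul (norm_mulOp_le b) (norm_fourierMul_le m) (norm_nonneg _) (norm_nonneg _))))

/-- The symbol of the free resolvent `(H₀ + i μ)⁻¹`. -/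
def energyResolvent {μ : ℝ} (hμ : μ ≠ 0) : ℝ →ᵇ ℂ :=
  invSymbol energySymbol continuous_energySymbol hμ

theorem hasTemperateGrowth_energyResolvent {μ : ℝ} (hμ : μ ≠ 0) :
    Function.HasTemperateGrowth (energyResolvent hμ) :=
  hasTemperateGrowth_inv_add_I_mul hasTemperateGrowth_energySymbol hμ

/-- The factor 1/|μ| makes the L² norm of the symbol small for large μ. With y the energy, y² + μ²/4
≥ |μ| y ≥ |μ| ξ², and |μ| ≤ μ² because |μ| ≥ 1. -/
theorem norm_sq_energyResolvent_le {μ : ℝ} (hμ : μ ≠ 0) (hμ1 : 1 ≤ |μ|) (ξ : ℝ) :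
    ‖energyResolvent hμ ξ‖ ^ 2 ≤ 2 / |μ| * (1 + ξ ^ 2)⁻¹ := by
  rw [energyResolvent, invSymbol_apply, norm_inv, inv_pow, ← normSq_eq_norm_sq, normSq_apply]
  simp only [add_re, ofReal_re, mul_re, I_re, I_im, ofReal_im, add_im, mul_im]
  ring_nf
  have hy : ξ ^ 2 ≤ energySymbol ξ := by
    rw [energySymbol, momentumSymbol, mul_pow]
    have : 1 ≤ (2 * Real.pi) ^ 2 := by nlinarith [Real.pi_gt_three]
    nlinarith [sq_nonneg ξ]
  set y := energySymbol ξ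
  have h1 : |μ| * (1 + ξ ^ 2) / 2 ≤ y ^ 2 + μ ^ 2 := by
    rw [← sq_abs μ]
    nlinarith [sq_nonneg (y - |μ| / 2), sq_nonneg ξ, abs_nonneg μ,
      mul_le_mul_of_nonneg_left hy (abs_nonneg μ)]
  have h2 : |μ|⁻¹ * (1 + ξ ^ 2)⁻¹ * 2 = (|μ| * (1 + ξ ^ 2) / 2)⁻¹ := by
    rw [inv_div, div_eq_mul_inv, mul_inv]; ring
  rw [h2]
  have h3 : 0 < |μ| * (1 + ξ ^ 2) / 2 := by positivity
  exact inv_anti₀ h3 h1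

theorem memLp_of_norm_sq_le {m : ℝ → ℂ} (hm : Continuous m) {C : ℝ}
    (h : ∀ ξ, ‖m ξ‖ ^ 2 ≤ C * (1 + ξ ^ 2)⁻¹) : MemLp m 2 volume := by
  rw [memLp_two_iff_integrable_sq_norm hm.aestronglyMeasurable]
  refine (integrable_inv_one_add_sq.const_mul C).mono' (by fun_prop)
    (Eventually.of_forall fun ξ => ?_)
  rw [Real.norm_of_nonneg (by positivity)]
  exact h ξ

theorem norm_sq_toLp_le {m : ℝ → ℂ} (hm : MemLp m 2 volume) {C : ℝ}
    (h : ∀ ξ, ‖m ξ‖ ^ 2 ≤ C * (1 + ξ ^ 2)⁻¹) : ‖hm.toLp m‖ ^ 2 ≤ C * Real.pi := by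
  rw [norm_sq_toLp, ← integral_univ_inv_one_add_sq, ← integral_const_mul]
  exact integral_mono ((memLp_two_iff_integrable_sq_norm hm.1).1 hm)
    (integrable_inv_one_add_sq.const_mul C) h

/-- The L² part of V contributes O(|μ|^{-1/2}) and the bounded part O(|μ|⁻¹). The bound depends on
|μ| only, so one choice serves both signs in the self-adjointness criterion. -/
theorem exists_norm_potOp_lt (hw : MemLp w 2 volume) (b : ℝ →ᵇ ℂ) :
    ∃ μ₀ : ℝ, 1 ≤ μ₀ ∧ ∀ (μ : ℝ) (hμ : μ ≠ 0), |μ| = μ₀ →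
      ∃ hm : MemLp (energyResolvent hμ) 2 volume, ‖potOp hw b hm‖ < 1 := by
  have hlim : Tendsto (fun μ : ℝ => ‖hw.toLp w‖ * √(2 / μ * Real.pi) + ‖b‖ * μ⁻¹) atTop
      (𝓝 (‖hw.toLp w‖ * √(0 * Real.pi) + ‖b‖ * 0)) := by
    refine (Tendsto.const_mul _ (Tendsto.sqrt (Tendsto.mul_const _ ?_))).add
      (tendsto_inv_atTop_zero.const_mul _)
    exact tendsto_const_nhds.div_atTop tendsto_id
  have hlt : ‖hw.toLp w‖ * √(0 * Real.pi) + ‖b‖ * 0 < 1 := by simp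
  obtain ⟨μ₀, hμ0, hμ1⟩ := ((hlim.eventually_lt_const hlt).and (eventually_ge_atTop 1)).exists
  refine ⟨μ₀, hμ1, fun μ hμ hμμ => ?_⟩
  subst hμμ
  have h1 := norm_sq_energyResolvent_le hμ hμ1
  have hm := memLp_of_norm_sq_le (energyResolvent hμ).continuous h1
  refine ⟨hm, (norm_potOp_le hw b hm).trans_lt (lt_of_le_of_lt ?_ hμ0)⟩
  gcongr
  · exact Real.le_sqrt_of_sq_le (norm_sq_toLp_le hm h1)
  · exact norm_invSymbol_le _ _ hμ

theorem momentum_sq_mult_energyResolvent {μ : ℝ} (hμ : μ ≠ 0) (θ : 𝓢(ℝ, ℂ)) :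
    momentumSchwartz (momentumSchwartz (mult (energyResolvent hμ) θ)) +
      (I * μ : ℂ) • mult (energyResolvent hμ) θ = θ := by
  refine eq_of_fourier_eq fun ξ => ?_
  rw [FourierTransform.fourier_add, FourierTransform.fourier_smul]
  simp only [add_apply, smul_apply, smul_eq_mul]
  rw [fourier_momentumSchwartz_sq, fourier_mult (hasTemperateGrowth_energyResolvent hμ),
    energyResolvent, invSymbol_apply]
  have := add_I_mul_ne_zero (energySymbol ξ) hμ
  field_simp

/-- On Schwartz functions (H + iμ)(H₀ + iμ)⁻¹ = 1 + V (H₀ + iμ)⁻¹, which extends to an operator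
invertible by a Neumann series. It carries the dense Schwartz space onto a dense set, contained in
the range of H + iμ. -/
theorem dense_range_hamiltonian_add (hw : MemLp w 2 volume) (hV : ∀ x, (V x : ℂ) = w x + b x)
    {μ : ℝ} (hμ : μ ≠ 0) (hm : MemLp (energyResolvent hμ) 2 volume)
    (hlt : ‖potOp hw b hm‖ < 1) :
    Dense (Set.range fun x : (hamiltonian V).domain =>
      hamiltonian V x + (I * μ : ℂ) • (x : L2R)) := by
  have hu : IsUnit (1 - (-potOp hw b hm)) := (Units.oneSub _ (by rwa [norm_neg])).isUnit
  obtain ⟨S, hS⟩ := hu.exists_right_inv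
  set T : BoundedOp := 1 - (-potOp hw b hm) with hT
  have hsurj : Function.Surjective T := fun x =>
    ⟨S x, congrArg (fun T : BoundedOp => T x) hS⟩
  have hd := hsurj.denseRange.comp denseRange_schwartzIncl T.continuous
  refine hd.mono ?_
  rintro _ ⟨θ, rfl⟩
  obtain ⟨x, h1, h2⟩ := (LinearPMap.mem_graph_iff _).1
    ((mem_graph_hamiltonian (memLp_potential_mul hw hV)).2 ⟨mult (energyResolvent hμ) θ, rfl⟩)
  refine ⟨x, ?_⟩
  simp only at h1 h2
  change hamiltonian V x + (I * μ : ℂ) • (x : L2R) = schwartzIncl θ - -potOp hw b hm (schwartzIncl θ)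
  rw [h1, h2, sub_neg_eq_add,
    potOp_schwartzIncl hw hV hm (hasTemperateGrowth_energyResolvent hμ)]
  nth_rewrite 5 [← momentum_sq_mult_energyResolvent hμ θ]
  rw [map_add, map_smul]
  abel

/-- **Kato–Rellich** for potentials in `L² + L^∞`. -/
theorem isEssentiallySelfAdjoint_hamiltonian (hw : MemLp w 2 volume)
    (hV : ∀ x, (V x : ℂ) = w x + b x) : IsEssentiallySelfAdjoint (hamiltonian V) := by
  have h := memLp_potential_mul hw hV
  have hd : Dense ((hamiltonian V).domain : Set L2R) := by
    rw [domain_hamiltonian h]; exact dense_schwartzDomain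
  have hs := isFormalAdjoint_hamiltonian h
  refine ⟨isClosable_of_isFormalAdjoint hd hs, ?_⟩
  obtain ⟨μ, hμ1, hμ⟩ := exists_norm_potOp_lt hw b
  have hμ0 : μ ≠ 0 := by positivity
  obtain ⟨hp, hp'⟩ := hμ μ hμ0 (abs_of_pos (by positivity))
  obtain ⟨hm, hm'⟩ := hμ (-μ) (neg_ne_zero.2 hμ0) (by rw [abs_neg, abs_of_pos (by positivity)])
  exact isSelfAdjoint_closure_of_dense_range hd hs hμ0 (dense_range_hamiltonian_add hw hV _ hp hp')
    (dense_range_hamiltonian_add hw hV _ hm hm')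

theorem isEssentiallySelfAdjoint_freeHamiltonian : IsEssentiallySelfAdjoint freeHamiltonian := by
  rw [← hamiltonian_zero]
  exact isEssentiallySelfAdjoint_hamiltonian (w := 0) (b := 0) MemLp.zero (by simp)

theorem isUnitaryGroupOf_evolution (hw : MemLp w 2 volume) (hV : ∀ x, (V x : ℂ) = w x + b x) :
    IsUnitaryGroupOf (evolution V) (hamiltonian V).closure :=
  isUnitaryGroupOf_unitaryGroup (isEssentiallySelfAdjoint_hamiltonian hw hV).2

theorem isUnitaryGroupOf_freeEvolution :
    IsUnitaryGroupOf freeEvolution freeHamiltonian.closure :=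
  isUnitaryGroupOf_unitaryGroup isEssentiallySelfAdjoint_freeHamiltonian.2

end Hamiltonian

/-! ### Product rule for unitary groups and the free evolution as a Fourier multiplier -/

section FreeEvolution

theorem IsUnitaryGroupOf.tendsto_apply {U : ℝ → BoundedOp} {A : L2R →ₗ.[ℂ] L2R}
    (h : IsUnitaryGroupOf U A) {l : Filter ℝ} {s : ℝ} (hl : l ≤ 𝓝 s) {v : ℝ → L2R} {x : L2R}
    (hv : Tendsto v l (𝓝 x)) : Tendsto (fun r => U r (v r)) l (𝓝 (U s x)) := by
  have h1 : Tendsto (fun r => U r x) l (𝓝 (U s x)) := ((h.continuous x).tendsto s).mono_left hl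
  have h2 : Tendsto (fun r => U r (v r - x)) l (𝓝 0) := by
    rw [tendsto_zero_iff_norm_tendsto_zero]
    simp_rw [h.norm_apply]
    exact tendsto_iff_norm_sub_tendsto_zero.1 hv
  simpa using h2.add h1

theorem IsUnitaryGroupOf.continuous_apply {U : ℝ → BoundedOp} {A : L2R →ₗ.[ℂ] L2R}
    (h : IsUnitaryGroupOf U A) {v : ℝ → L2R} (hv : Continuous v) :
    Continuous fun r => U r (v r) :=
  continuous_iff_continuousAt.2 fun _ => h.tendsto_apply le_rfl hv.continuousAt

/-- The product rule for `s ↦ e^{isA} u(s)`. -/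
theorem IsUnitaryGroupOf.hasDerivAt_apply {U : ℝ → BoundedOp} {A : L2R →ₗ.[ℂ] L2R}
    (h : IsUnitaryGroupOf U A) {u : ℝ → L2R} {u' χ : L2R} {s : ℝ} (hu : HasDerivAt u u' s)
    (hχ : (u s, χ) ∈ A.graph) :
    HasDerivAt (fun r => U r (u r)) (U s (I • χ + u')) s := by
  rw [map_add]
  have h1 := h.hasDerivAt hχ s
  -- The difference quotient of this term is U(r) applied to that of u, so joint strong continuity
  -- suffices; the vectors u(r) with r ≠ s need not lie in the domain.
  have h2 : HasDerivAt (fun r => U r (u r - u s)) (U s u') s := by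
    rw [hasDerivAt_iff_tendsto_slope] at hu ⊢
    refine (h.tendsto_apply nhdsWithin_le_nhds hu).congr fun r => ?_
    rw [slope_def_module, slope_def_module, sub_self, map_zero, sub_zero]
    exact ((U r).restrictScalars ℝ).map_smul _ _
  refine (h1.add h2).congr_of_eventuallyEq (Eventually.of_forall fun r => ?_)
  simp

theorem norm_schwartzIncl_le {f g : 𝓢(ℝ, ℂ)} {C : ℝ} (h : ∀ x, ‖f x‖ ≤ C * ‖g x‖) :
    ‖schwartzIncl f‖ ≤ C * ‖schwartzIncl g‖ := by
  refine Lp.norm_le_mul_norm_of_ae_le_mul ?_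
  filter_upwards [coeFn_schwartzIncl f, coeFn_schwartzIncl g] with x h1 h2
  rw [h1, h2]
  exact h x

theorem norm_schwartzIncl_fourier (f : 𝓢(ℝ, ℂ)) : ‖schwartzIncl (𝓕 f)‖ = ‖schwartzIncl f‖ := by
  rw [← fourierL2_schwartzIncl, LinearIsometryEquiv.norm_map]

theorem norm_schwartzIncl_le_of_fourier {f g : 𝓢(ℝ, ℂ)} {C : ℝ}
    (h : ∀ ξ, ‖𝓕 f ξ‖ ≤ C * ‖𝓕 g ξ‖) : ‖schwartzIncl f‖ ≤ C * ‖schwartzIncl g‖ := by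
  rw [← norm_schwartzIncl_fourier f, ← norm_schwartzIncl_fourier g]
  exact norm_schwartzIncl_le h

/-- Taylor's bound handles |a| ≤ 1; for |a| > 1 the crude bound 2 + |a| is at most 3a². -/
theorem norm_cexp_mul_I_sub_le (a : ℝ) : ‖cexp (a * I) - 1 - a * I‖ ≤ 3 * a ^ 2 := by
  rcases le_or_gt |a| 1 with h | h
  · have h1 : ‖(a : ℂ) * I‖ = |a| := by simp
    refine (Complex.norm_exp_sub_one_sub_id_le (h1.trans_le h)).trans ?_
    rw [h1, sq_abs]
    nlinarith [sq_nonneg a]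
  · have h1 : ‖cexp (a * I) - 1 - a * I‖ ≤ 1 + 1 + |a| := by
      refine (norm_sub_le _ _).trans (add_le_add ((norm_sub_le _ _).trans ?_) ?_)
      · rw [norm_exp_ofReal_mul_I, norm_one]
      · simp
    rw [← sq_abs]
    nlinarith

/-- The symbol of the free evolution. -/
def evolutionSymbol (t : ℝ) (ξ : ℝ) : ℂ := cexp ((t * energySymbol ξ : ℝ) * I)

theorem hasTemperateGrowth_evolutionSymbol (t : ℝ) :
    Function.HasTemperateGrowth (evolutionSymbol t) :=
  hasTemperateGrowth_cexp_comp
    ((Function.HasTemperateGrowth.const t).mul hasTemperateGrowth_energySymbol)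

theorem norm_evolutionSymbol (t ξ : ℝ) : ‖evolutionSymbol t ξ‖ = 1 := norm_exp_ofReal_mul_I _

/-- In Fourier space the second order remainder costs two powers of the energy, which a Schwartz
function can afford: the error is at most 3 (r - s)² ‖H₀² ψ‖. -/
theorem hasDerivAt_mult_evolutionSymbol (ψ : 𝓢(ℝ, ℂ)) (s : ℝ) :
    HasDerivAt (fun r => schwartzIncl (mult (evolutionSymbol r) ψ))
      (I • schwartzIncl (momentumSchwartz (momentumSchwartz (mult (evolutionSymbol s) ψ)))) s := by
  set χ := momentumSchwartz (momentumSchwartz (mult (evolutionSymbol s) ψ)) with hχ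
  set g := momentumSchwartz (momentumSchwartz (momentumSchwartz (momentumSchwartz ψ))) with hg
  rw [hasDerivAt_iff_isLittleO]
  refine Asymptotics.IsBigO.trans_isLittleO (g := fun r => ‖r - s‖ ^ 2) ?_
    (Asymptotics.isLittleO_pow_sub_sub s one_lt_two)
  refine Asymptotics.IsBigO.of_bound (3 * ‖schwartzIncl g‖) (Eventually.of_forall fun r => ?_)
  have h1 : schwartzIncl (mult (evolutionSymbol r) ψ) - schwartzIncl (mult (evolutionSymbol s) ψ)
      - (r - s) • I • schwartzIncl χ = schwartzIncl (mult (evolutionSymbol r) ψ -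
        mult (evolutionSymbol s) ψ - ((r - s : ℝ) * I : ℂ) • χ) := by
    rw [map_sub, map_sub, map_smul, mul_smul, Complex.coe_smul]
    rfl
  rw [h1]
  have h2 : ‖schwartzIncl (mult (evolutionSymbol r) ψ -
      mult (evolutionSymbol s) ψ - ((r - s : ℝ) * I : ℂ) • χ)‖ ≤
        (3 * (r - s) ^ 2) * ‖schwartzIncl g‖ := by
    refine norm_schwartzIncl_le_of_fourier fun ξ => ?_
    rw [sub_eq_add_neg, sub_eq_add_neg, ← neg_one_smul ℂ (_ • χ),
      ← neg_one_smul ℂ (mult (evolutionSymbol s) ψ)]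
    simp only [FourierTransform.fourier_add, FourierTransform.fourier_smul, add_apply, smul_apply,
      smul_eq_mul]
    rw [hχ, hg, fourier_momentumSchwartz_sq, fourier_momentumSchwartz_sq,
      fourier_momentumSchwartz_sq, fourier_mult (hasTemperateGrowth_evolutionSymbol s),
      fourier_mult (hasTemperateGrowth_evolutionSymbol r)]
    have h3 : evolutionSymbol r ξ = evolutionSymbol s ξ *
        cexp (((r - s) * energySymbol ξ : ℝ) * I) := by
      rw [evolutionSymbol, evolutionSymbol, ← Complex.exp_add]
      congr 1
      push_cast
      ring
    have h4 := norm_cexp_mul_I_sub_le ((r - s) * energySymbol ξ)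
    have h5 : evolutionSymbol r ξ * 𝓕 ψ ξ + -1 * (evolutionSymbol s ξ * 𝓕 ψ ξ) +
        -1 * (((r - s : ℝ) : ℂ) * I * (energySymbol ξ * (evolutionSymbol s ξ * 𝓕 ψ ξ))) =
        evolutionSymbol s ξ * 𝓕 ψ ξ * (cexp (((r - s) * energySymbol ξ : ℝ) * I) - 1 -
          ((r - s) * energySymbol ξ : ℝ) * I) := by
      rw [h3]
      push_cast
      ring
    rw [h5, norm_mul, norm_mul, norm_evolutionSymbol, one_mul, norm_mul, norm_mul,
      Complex.norm_real, Real.norm_eq_abs]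
    calc ‖𝓕 ψ ξ‖ * _ ≤ ‖𝓕 ψ ξ‖ * (3 * ((r - s) * energySymbol ξ) ^ 2) := by gcongr
      _ = 3 * (r - s) ^ 2 * (|energySymbol ξ| * (|energySymbol ξ| * ‖𝓕 ψ ξ‖)) := by
        rw [← mul_assoc |energySymbol ξ|, abs_mul_abs_self]
        ring
  refine h2.trans_eq ?_
  rw [Real.norm_of_nonneg (by positivity), Real.norm_eq_abs, sq_abs]
  ring

theorem mem_graph_closure_of_mem {T : L2R →ₗ.[ℂ] L2R} {p : L2R × L2R} (hp : p ∈ T.graph) :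
    p ∈ T.closure.graph :=
  LinearPMap.le_graph_of_le (LinearPMap.le_closure T) hp

theorem mem_graph_freeHamiltonian (f : 𝓢(ℝ, ℂ)) :
    (schwartzIncl f, schwartzIncl (momentumSchwartz (momentumSchwartz f))) ∈
      freeHamiltonian.closure.graph :=
  mem_graph_closure_of_mem (mem_graph_schwartzOp.2 ⟨f, rfl⟩)

theorem mult_evolutionSymbol_zero (ψ : 𝓢(ℝ, ℂ)) : mult (evolutionSymbol 0) ψ = ψ := by
  refine eq_of_fourier_eq fun ξ => ?_
  rw [fourier_mult (hasTemperateGrowth_evolutionSymbol 0)]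
  simp [evolutionSymbol]

theorem freeEvolution_neg_apply_apply (t : ℝ) (x : L2R) :
    freeEvolution (-t) (freeEvolution t x) = x := by
  have h := isUnitaryGroupOf_freeEvolution.add (-t) t
  rw [neg_add_cancel, isUnitaryGroupOf_freeEvolution.zero] at h
  exact (congrArg (fun T : BoundedOp => T x) h).symm

/-- On Schwartz functions, `e^{itH₀}` is the Fourier multiplier with symbol `e^{itp²}`. -/
theorem freeEvolution_schwartzIncl (t : ℝ) (ψ : 𝓢(ℝ, ℂ)) :
    freeEvolution t (schwartzIncl ψ) = schwartzIncl (mult (evolutionSymbol t) ψ) := by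
  -- The abstract group is composed with the inverse of the explicit one; the product rule shows the
  -- result to be constant, and it is compared at -t and 0.
  have h1 : ∀ s, HasDerivAt (fun r => freeEvolution r (schwartzIncl (mult (evolutionSymbol (-r)) ψ)))
      0 s := by
    intro s
    have h2 := (hasDerivAt_mult_evolutionSymbol ψ (-s)).scomp s (hasDerivAt_neg s)
    have h3 := isUnitaryGroupOf_freeEvolution.hasDerivAt_apply h2
      (mem_graph_freeHamiltonian (mult (evolutionSymbol (-s)) ψ))
    simpa using h3
  have h4 := is_const_of_deriv_eq_zero (fun s => (h1 s).differentiableAt)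
    (fun s => (h1 s).deriv) (-t) 0
  simp only [neg_neg, neg_zero, mult_evolutionSymbol_zero, isUnitaryGroupOf_freeEvolution.zero,
    one_apply_eq_self] at h4
  have h5 := congrArg (freeEvolution t) h4
  rw [← h5]
  simpa using freeEvolution_neg_apply_apply (-t) (schwartzIncl (mult (evolutionSymbol t) ψ))

end FreeEvolution

/-! ### Local smoothing for the free evolution -/

section Smoothing

/-- With a Gaussian weight in time, integrating the phase gives an explicit positive kernel that
decays in the energy difference d. -/
theorem integral_gaussian_mul_cexp (d : ℝ) :
    ∫ s : ℝ, (Real.exp (-s ^ 2) : ℂ) * cexp (-(s * d : ℝ) * I) =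
      (√Real.pi * Real.exp (-d ^ 2 / 4) : ℝ) := by
  have h := fourierIntegral_gaussian (b := 1) (by simp) (-d : ℂ)
  simp only [div_one, mul_one, neg_sq] at h
  have h1 : ((Real.pi : ℂ) ^ (1 / 2 : ℂ)) = (√Real.pi : ℝ) := by
    rw [Real.sqrt_eq_rpow, ofReal_cpow Real.pi_pos.le]
    push_cast
    rfl
  rw [h1] at h
  push_cast
  rw [← h]
  congr 1
  funext s
  rw [mul_comm]
  congr 1 <;> congr 1 <;> ring

/-- Since (ξ² - η²)² ≥ (|η| - |ξ|)⁴, the kernel decays in the distance of η from ±ξ at a rate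
independent of ξ. The two summands, one for each sign of η, are translates of an integrable
function. -/
theorem exp_neg_energy_le (ξ η : ℝ) :
    Real.exp (-(energySymbol ξ - energySymbol η) ^ 2 / 4) ≤
      2 * (1 + (η - |ξ|) ^ 2)⁻¹ + 2 * (1 + (η + |ξ|) ^ 2)⁻¹ := by
  have key : ∀ r y : ℝ, r ^ 4 ≤ y → Real.exp (-y) ≤ 2 * (1 + r ^ 2)⁻¹ := by
    intro r y hy
    rw [Real.exp_neg, ← div_eq_mul_inv, ← inv_div]
    refine inv_anti₀ (by positivity) ?_
    have h1 := Real.add_one_le_exp y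
    nlinarith [sq_nonneg (r ^ 2 - 1 / 2)]
  have hE : (ξ ^ 2 - η ^ 2) ^ 2 ≤ (energySymbol ξ - energySymbol η) ^ 2 / 4 := by
    have h1 : (energySymbol ξ - energySymbol η) ^ 2 / 4 =
        4 * Real.pi ^ 4 * (ξ ^ 2 - η ^ 2) ^ 2 := by
      rw [energySymbol, energySymbol, momentumSymbol, momentumSymbol]
      ring
    have h2 : (1 : ℝ) ≤ Real.pi ^ 4 := one_le_pow₀ (by linarith [Real.pi_gt_three])
    rw [h1]
    nlinarith [sq_nonneg (ξ ^ 2 - η ^ 2)]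
  have hr : (|η| - |ξ|) ^ 4 ≤ (energySymbol ξ - energySymbol η) ^ 2 / 4 := by
    refine le_trans ?_ hE
    rw [← sq_abs ξ, ← sq_abs η]
    have h1 : (|ξ| ^ 2 - |η| ^ 2) ^ 2 = (|η| - |ξ|) ^ 2 * (|η| + |ξ|) ^ 2 := by ring
    have h2 : (|η| - |ξ|) ^ 2 ≤ (|η| + |ξ|) ^ 2 := by nlinarith [abs_nonneg ξ, abs_nonneg η]
    rw [h1]
    nlinarith [sq_nonneg (|η| - |ξ|)]
  have h := key _ _ hr
  rw [neg_div]
  have h0 : ∀ x : ℝ, 0 ≤ 2 * (1 + x ^ 2)⁻¹ := fun x => by positivity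
  rcases abs_choice η with h1 | h1
  · rw [h1] at h
    linarith [h0 (η + |ξ|)]
  · have h2 : (|η| - |ξ|) ^ 2 = (η + |ξ|) ^ 2 := by rw [h1]; ring
    rw [h2] at h
    linarith [h0 (η - |ξ|)]

theorem integrable_exp_neg_energy (ξ : ℝ) :
    Integrable fun η => Real.exp (-(energySymbol ξ - energySymbol η) ^ 2 / 4) := by
  have hc := continuous_energySymbol
  refine Integrable.mono' (((integrable_inv_one_add_sq.comp_sub_right |ξ|).const_mul 2).add
    ((integrable_inv_one_add_sq.comp_add_right |ξ|).const_mul 2))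
    (Continuous.aestronglyMeasurable (by fun_prop)) (Eventually.of_forall fun η => ?_)
  rw [Real.norm_of_nonneg (Real.exp_pos _).le]
  exact exp_neg_energy_le ξ η

theorem integral_exp_neg_energy_le (ξ : ℝ) :
    ∫ η, Real.exp (-(energySymbol ξ - energySymbol η) ^ 2 / 4) ≤ 4 * Real.pi := by
  have h1 := (integrable_inv_one_add_sq.comp_sub_right |ξ|).const_mul 2
  have h2 := (integrable_inv_one_add_sq.comp_add_right |ξ|).const_mul 2
  refine (integral_mono (integrable_exp_neg_energy ξ) (h1.add h2)
    (exp_neg_energy_le ξ)).trans_eq ?_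
  simp only [Pi.add_apply]
  rw [integral_add h1 h2, integral_const_mul, integral_const_mul,
    integral_sub_right_eq_self (fun x : ℝ => (1 + x ^ 2)⁻¹),
    integral_add_right_eq_self (fun x : ℝ => (1 + x ^ 2)⁻¹), integral_univ_inv_one_add_sq]
  ring

/-- This is one half of a Schur test for the Gaussian kernel in the energy difference; the other
half follows by swapping the variables. -/
theorem integrable_sq_mul_exp_neg_energy {a : ℝ → ℂ} (ha2 : MemLp a 2 volume) :
    Integrable (fun p : ℝ × ℝ => ‖a p.1‖ ^ 2 *
      Real.exp (-(energySymbol p.1 - energySymbol p.2) ^ 2 / 4)) (volume.prod volume) ∧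
    ∫ p : ℝ × ℝ, ‖a p.1‖ ^ 2 *
      Real.exp (-(energySymbol p.1 - energySymbol p.2) ^ 2 / 4) ∂(volume.prod volume) ≤
        4 * Real.pi * ∫ ξ, ‖a ξ‖ ^ 2 := by
  have hc := continuous_energySymbol
  have hm : AEStronglyMeasurable (fun p : ℝ × ℝ => ‖a p.1‖ ^ 2 *
      Real.exp (-(energySymbol p.1 - energySymbol p.2) ^ 2 / 4)) (volume.prod volume) :=
    (ha2.1.comp_fst.norm.pow 2).mul (Continuous.aestronglyMeasurable (by fun_prop))
  have ha := (memLp_two_iff_integrable_sq_norm ha2.1).1 ha2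
  have hle : ∀ ξ, ∫ η, ‖a ξ‖ ^ 2 * Real.exp (-(energySymbol ξ - energySymbol η) ^ 2 / 4) ≤
      4 * Real.pi * ‖a ξ‖ ^ 2 := by
    intro ξ
    rw [integral_const_mul, mul_comm]
    gcongr
    exact integral_exp_neg_energy_le ξ
  have hi : Integrable (fun p : ℝ × ℝ => ‖a p.1‖ ^ 2 *
      Real.exp (-(energySymbol p.1 - energySymbol p.2) ^ 2 / 4)) (volume.prod volume) := by
    refine (integrable_prod_iff hm).2 ⟨Eventually.of_forall fun ξ =>
      (integrable_exp_neg_energy ξ).const_mul (‖a ξ‖ ^ 2), ?_⟩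
    refine (ha.const_mul (4 * Real.pi)).mono' hm.norm.integral_prod_right'
      (Eventually.of_forall fun ξ => ?_)
    rw [Real.norm_of_nonneg (integral_nonneg fun _ => norm_nonneg _)]
    refine le_trans (le_of_eq ?_) (hle ξ)
    congr 1
    funext η
    exact Real.norm_of_nonneg (by positivity)
  refine ⟨hi, ?_⟩
  rw [integral_prod _ hi, ← integral_const_mul]
  exact integral_mono hi.integral_prod_left (ha.const_mul _) hle

/-- A smoothing estimate for oscillatory integrals whose phase is the free energy. -/
theorem integral_gaussian_mul_norm_sq_le {a : ℝ → ℂ} (ha : Integrable a) (ha2 : MemLp a 2 volume) :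
    ∫ s : ℝ, Real.exp (-s ^ 2) * ‖∫ ξ, cexp (-(s * energySymbol ξ : ℝ) * I) * a ξ‖ ^ 2 ≤
      √Real.pi * (4 * Real.pi) * ∫ ξ, ‖a ξ‖ ^ 2 := by
  have hc := continuous_energySymbol
  set F : ℝ → ℝ × ℝ → ℂ := fun s p => (Real.exp (-s ^ 2) : ℂ) *
    cexp (-(s * (energySymbol p.1 - energySymbol p.2) : ℝ) * I) *
      (a p.1 * (starRingEnd ℂ) (a p.2)) with hF
  have hprod : Integrable (fun p : ℝ × ℝ => a p.1 * (starRingEnd ℂ) (a p.2))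
      (volume.prod volume) := by
    refine ha.mul_prod (g := fun y => (starRingEnd ℂ) (a y)) ?_
    exact (Complex.conjCLE.toContinuousLinearMap.integrable_comp ha)
  have h1 : ∀ s : ℝ, ((Real.exp (-s ^ 2) *
      ‖∫ ξ, cexp (-(s * energySymbol ξ : ℝ) * I) * a ξ‖ ^ 2 : ℝ) : ℂ) =
        ∫ p, F s p ∂(volume.prod volume) := by
    intro s
    push_cast
    rw [← Complex.mul_conj', ← integral_conj,
      ← integral_prod_mul (fun ξ => cexp (-((s : ℂ) * energySymbol ξ) * I) * a ξ),
      ← integral_const_mul]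
    congr 1
    funext p
    simp only [hF, map_mul, ← Complex.exp_conj, map_neg, conj_ofReal, conj_I]
    have : cexp (-((s * (energySymbol p.1 - energySymbol p.2) : ℝ) : ℂ) * I) =
        cexp (-((s : ℂ) * energySymbol p.1) * I) *
          cexp (-((s : ℂ) * energySymbol p.2) * -I) := by
      rw [← Complex.exp_add]
      congr 1
      push_cast
      ring
    rw [this]
    push_cast
    ring
  -- Integrability of `a` is needed here, to integrate over time first; it does not enter the final
  -- bound.
  have hint : Integrable (Function.uncurry F) (volume.prod (volume.prod volume)) := by
    have hg : Integrable fun s : ℝ => Real.exp (-s ^ 2) := by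
      simpa using integrable_exp_neg_mul_sq (b := 1) one_pos
    refine (hg.mul_prod hprod.norm).mono' ?_ (Eventually.of_forall fun q => ?_)
    · refine AEStronglyMeasurable.mul (Continuous.aestronglyMeasurable (by fun_prop)) ?_
      exact hprod.1.comp_snd
    · simp only [Function.uncurry, hF]
      rw [norm_mul, norm_mul, Complex.norm_real, Real.norm_of_nonneg (Real.exp_pos _).le,
        ← ofReal_neg, norm_exp_ofReal_mul_I, mul_one]
  have h2 : ((∫ s : ℝ, Real.exp (-s ^ 2) *
      ‖∫ ξ, cexp (-(s * energySymbol ξ : ℝ) * I) * a ξ‖ ^ 2 : ℝ) : ℂ) =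
        ∫ p : ℝ × ℝ, (√Real.pi * Real.exp (-(energySymbol p.1 - energySymbol p.2) ^ 2 / 4) : ℝ) *
          (a p.1 * (starRingEnd ℂ) (a p.2)) ∂(volume.prod volume) := by
    rw [← integral_complex_ofReal]
    simp_rw [h1]
    rw [integral_integral_swap hint]
    congr 1
    funext p
    rw [← integral_gaussian_mul_cexp, ← integral_mul_const]
  obtain ⟨hi1, hle⟩ := integrable_sq_mul_exp_neg_energy ha2
  have hi2 : Integrable (fun p : ℝ × ℝ => ‖a p.2‖ ^ 2 *
      Real.exp (-(energySymbol p.1 - energySymbol p.2) ^ 2 / 4)) (volume.prod volume) := by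
    refine hi1.swap.congr (Eventually.of_forall fun p => ?_)
    simp only [Function.comp, Prod.fst_swap, Prod.snd_swap]
    congr 3
    ring
  have heq : ∫ p : ℝ × ℝ, ‖a p.2‖ ^ 2 *
      Real.exp (-(energySymbol p.1 - energySymbol p.2) ^ 2 / 4) ∂(volume.prod volume) =
      ∫ p : ℝ × ℝ, ‖a p.1‖ ^ 2 *
      Real.exp (-(energySymbol p.1 - energySymbol p.2) ^ 2 / 4) ∂(volume.prod volume) := by
    rw [← integral_prod_swap]
    congr 1
    funext p
    simp only [Prod.fst_swap, Prod.snd_swap]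
    congr 3
    ring
  refine le_trans (le_trans (Real.le_norm_self _) (Complex.norm_real _).symm.le) ?_
  rw [h2]
  -- Schur test: |a(ξ) a(η)| is replaced by half the sum of the squares, and the two resulting
  -- integrals agree by symmetry.
  refine (norm_integral_le_of_norm_le (((hi1.add hi2).const_mul (√Real.pi / 2)))
    (Eventually.of_forall fun p => ?_)).trans ?_
  · rw [norm_mul, norm_mul, RCLike.norm_conj, Complex.norm_real,
      Real.norm_of_nonneg (by positivity)]
    simp only [Pi.add_apply]
    have h3 := two_mul_le_add_sq ‖a p.1‖ ‖a p.2‖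
    have h4 : 0 ≤ √Real.pi * Real.exp (-(energySymbol p.1 - energySymbol p.2) ^ 2 / 4) := by
      positivity
    nlinarith
  · simp only [Pi.add_apply]
    rw [integral_const_mul, integral_add hi1 hi2, heq]
    have h5 := Real.sqrt_nonneg Real.pi
    nlinarith

theorem mult_evolutionSymbol_apply (t : ℝ) (ψ : 𝓢(ℝ, ℂ)) (x : ℝ) :
    mult (evolutionSymbol t) ψ x =
      ∫ ξ, cexp (-(-t * energySymbol ξ : ℝ) * I) *
        (cexp ((2 * Real.pi * (ξ * x) : ℝ) * I) * 𝓕 ψ ξ) := by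
  rw [SchwartzMap.fourierMultiplierCLM_apply, SchwartzMap.fourierInv_coe, Real.fourierInv_eq']
  congr 1
  funext ξ
  rw [SchwartzMap.smulLeftCLM_apply_apply (hasTemperateGrowth_evolutionSymbol t), smul_eq_mul,
    smul_eq_mul, evolutionSymbol, mul_left_comm]
  simp [mul_comm ξ x]

theorem continuous_uncurry_mult_evolutionSymbol (ψ : 𝓢(ℝ, ℂ)) :
    Continuous fun q : ℝ × ℝ => mult (evolutionSymbol (-q.1)) ψ q.2 := by
  have hc := continuous_energySymbol
  simp_rw [mult_evolutionSymbol_apply]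
  refine continuous_of_dominated (bound := fun ξ => ‖𝓕 ψ ξ‖) (fun q => ?_)
    (fun q => Eventually.of_forall fun ξ => ?_) (𝓕 ψ).integrable.norm
    (Eventually.of_forall fun ξ => by fun_prop)
  · have := (𝓕 ψ).continuous
    exact Continuous.aestronglyMeasurable (by fun_prop)
  · rw [norm_mul, norm_mul, ← ofReal_neg, norm_exp_ofReal_mul_I, norm_exp_ofReal_mul_I, one_mul,
      one_mul]

theorem norm_mult_evolutionSymbol_apply_le (t : ℝ) (ψ : 𝓢(ℝ, ℂ)) (x : ℝ) :
    ‖mult (evolutionSymbol t) ψ x‖ ≤ ∫ ξ, ‖𝓕 ψ ξ‖ := by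
  rw [mult_evolutionSymbol_apply]
  refine norm_integral_le_of_norm_le (𝓕 ψ).integrable.norm (Eventually.of_forall fun ξ => ?_)
  rw [norm_mul, norm_mul, ← ofReal_neg, norm_exp_ofReal_mul_I, norm_exp_ofReal_mul_I, one_mul,
    one_mul]

theorem norm_sq_schwartzIncl (f : 𝓢(ℝ, ℂ)) : ‖schwartzIncl f‖ ^ 2 = ∫ x, ‖f x‖ ^ 2 :=
  norm_sq_toLp (f.memLp 2)

/-- The local smoothing estimate for the free evolution. -/
theorem integral_gaussian_mul_evolution_le (ψ : 𝓢(ℝ, ℂ)) (x : ℝ) :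
    ∫ s : ℝ, Real.exp (-s ^ 2) * ‖mult (evolutionSymbol (-s)) ψ x‖ ^ 2 ≤
      √Real.pi * (4 * Real.pi) * ‖schwartzIncl ψ‖ ^ 2 := by
  have hc : Continuous fun ξ => cexp ((2 * Real.pi * (ξ * x) : ℝ) * I) := by fun_prop
  have hn : ∀ ξ, ‖cexp ((2 * Real.pi * (ξ * x) : ℝ) * I) * 𝓕 ψ ξ‖ = ‖𝓕 ψ ξ‖ := fun ξ => by
    rw [norm_mul, norm_exp_ofReal_mul_I, one_mul]
  have hm : AEStronglyMeasurable (fun ξ => cexp ((2 * Real.pi * (ξ * x) : ℝ) * I) * 𝓕 ψ ξ)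
      volume := (hc.mul (𝓕 ψ).continuous).aestronglyMeasurable
  have h := integral_gaussian_mul_norm_sq_le
    ((𝓕 ψ).integrable.mono hm (Eventually.of_forall fun ξ => (hn ξ).le))
    (((𝓕 ψ).memLp 2).of_le hm (Eventually.of_forall fun ξ => (hn ξ).le))
  simp_rw [hn] at h
  rw [← norm_sq_schwartzIncl, norm_schwartzIncl_fourier] at h
  simp_rw [mult_evolutionSymbol_apply, neg_neg]
  exact h

/-- On (0, t] the Gaussian weight is at least e^{-t²}, which accounts for the factor e^{t²}. -/
theorem lintegral_evolution_le (ψ : 𝓢(ℝ, ℂ)) (t x : ℝ) :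
    ∫⁻ s in Set.Ioc 0 t, ‖mult (evolutionSymbol (-s)) ψ x‖ₑ ^ 2 ≤
      ENNReal.ofReal (Real.exp (t ^ 2) * (√Real.pi * (4 * Real.pi) * ‖schwartzIncl ψ‖ ^ 2)) := by
  have hpair : Continuous fun s : ℝ => (s, x) := by fun_prop
  have hcont : Continuous fun s : ℝ => mult (evolutionSymbol (-s)) ψ x :=
    by simpa only [Function.comp_def] using (continuous_uncurry_mult_evolutionSymbol ψ).comp hpair
  have hg : Integrable fun s : ℝ => Real.exp (-s ^ 2) := by
    simpa using integrable_exp_neg_mul_sq (b := 1) one_pos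
  have hint : Integrable fun s : ℝ =>
      Real.exp (-s ^ 2) * ‖mult (evolutionSymbol (-s)) ψ x‖ ^ 2 := by
    refine (hg.mul_const ((∫ ξ, ‖𝓕 ψ ξ‖) ^ 2)).mono'
      (Continuous.aestronglyMeasurable (by fun_prop)) (Eventually.of_forall fun s => ?_)
    rw [Real.norm_of_nonneg (by positivity)]
    gcongr
    exact norm_mult_evolutionSymbol_apply_le _ _ _
  have h1 : ∫⁻ s in Set.Ioc 0 t, ‖mult (evolutionSymbol (-s)) ψ x‖ₑ ^ 2 ≤
      ∫⁻ s in Set.Ioc 0 t, ENNReal.ofReal (Real.exp (t ^ 2) *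
        (Real.exp (-s ^ 2) * ‖mult (evolutionSymbol (-s)) ψ x‖ ^ 2)) := by
    refine setLIntegral_mono' measurableSet_Ioc fun s hs => ?_
    rw [← ofReal_norm, ← ENNReal.ofReal_pow (norm_nonneg _)]
    refine ENNReal.ofReal_le_ofReal ?_
    rw [← mul_assoc, ← Real.exp_add]
    refine le_mul_of_one_le_left (by positivity) (Real.one_le_exp ?_)
    nlinarith [hs.1, hs.2]
  refine h1.trans ((setLIntegral_le_lintegral _ _).trans ?_)
  rw [← ofReal_integral_eq_lintegral_ofReal (hint.const_mul _)
    (Eventually.of_forall fun s => by positivity), integral_const_mul]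
  refine ENNReal.ofReal_le_ofReal ?_
  gcongr
  exact integral_gaussian_mul_evolution_le ψ x

/-- `‖w e^{-isH₀} ψ‖²` is integrable in time over finite intervals, for any `w ∈ L²`. -/
theorem integral_norm_sq_mul_evolution_le {w : ℝ → ℂ} (hw : MemLp w 2 volume) (ψ : 𝓢(ℝ, ℂ))
    {t : ℝ} (ht : 0 ≤ t)
    (hcont : Continuous fun s => (memLp_mul_schwartz hw (mult (evolutionSymbol (-s)) ψ)).toLp
      (fun x => w x * mult (evolutionSymbol (-s)) ψ x)) :
    ∫ s in 0..t, ‖(memLp_mul_schwartz hw (mult (evolutionSymbol (-s)) ψ)).toLp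
      (fun x => w x * mult (evolutionSymbol (-s)) ψ x)‖ ^ 2 ≤
      Real.exp (t ^ 2) * (√Real.pi * (4 * Real.pi) * ‖schwartzIncl ψ‖ ^ 2) *
        ‖hw.toLp w‖ ^ 2 := by
  have hcont2 : Continuous fun s =>
      ‖(memLp_mul_schwartz hw (mult (evolutionSymbol (-s)) ψ)).toLp
        (fun x => w x * mult (evolutionSymbol (-s)) ψ x)‖ ^ 2 := hcont.norm.pow 2
  rw [intervalIntegral.integral_of_le ht]
  refine (ENNReal.ofReal_le_ofReal_iff (by positivity)).1 ?_
  rw [ofReal_integral_eq_lintegral_ofReal hcont2.integrableOn_Ioc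
    (Eventually.of_forall fun s => by positivity)]
  have hsq : ∀ {f : ℝ → ℂ} (hf : MemLp f 2 volume),
      ENNReal.ofReal (‖hf.toLp f‖ ^ 2) = ∫⁻ x, ‖f x‖ₑ ^ 2 := by
    intro f hf
    rw [norm_sq_toLp, ofReal_integral_eq_lintegral_ofReal
      ((memLp_two_iff_integrable_sq_norm hf.1).1 hf) (Eventually.of_forall fun s => by positivity)]
    simp_rw [ENNReal.ofReal_pow (norm_nonneg _), ofReal_norm]
  simp_rw [hsq, enorm_mul, mul_pow]
  -- After Tonelli the inner integral is over time at fixed x, where the smoothing bound is uniform;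
  -- only |w|² remains to be integrated.
  rw [lintegral_lintegral_swap]
  · rw [ENNReal.ofReal_mul (by positivity), hsq, ← lintegral_const_mul'' _ (hw.1.enorm.pow_const 2)]
    refine lintegral_mono fun x => ?_
    rw [lintegral_const_mul' _ _ (by simp), mul_comm]
    gcongr
    exact lintegral_evolution_le ψ t x
  · refine AEMeasurable.mul (hw.1.comp_snd.enorm.pow_const 2) ?_
    exact ((continuous_uncurry_mult_evolutionSymbol ψ).enorm.measurable.pow_const 2).aemeasurable

end Smoothing

/-! ### Norm continuous compact families and the commutator with G(Q)(P + i)⁻¹ -/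

section Interaction

theorem continuous_rankOne {E α : Type*} [NormedAddCommGroup E] [InnerProductSpace ℂ E]
    [TopologicalSpace α] {f g : α → E} (hf : Continuous f) (hg : Continuous g) :
    Continuous fun x => (rankOne ℂ (f x) (g x) : E →L[ℂ] E) := by
  have h1 : Continuous fun x => ContinuousLinearMap.smulRightL ℂ E E (innerSL ℂ (g x)) :=
    (ContinuousLinearMap.smulRightL ℂ E E).continuous.comp ((innerSL ℂ).continuous.comp hg)
  exact h1.clm_apply hf

namespace IsUnitaryGroupOf

variable {U U' : ℝ → BoundedOp} {A A' : L2R →ₗ.[ℂ] L2R}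

theorem neg_mul_self (h : IsUnitaryGroupOf U A) (t : ℝ) : U (-t) * U t = 1 := by
  rw [← h.add, neg_add_cancel, h.zero]

theorem mul_neg_self (h : IsUnitaryGroupOf U A) (t : ℝ) : U t * U (-t) = 1 := by
  rw [← h.add, add_neg_cancel, h.zero]

theorem star_eq (h : IsUnitaryGroupOf U A) (t : ℝ) : star (U t) = U (-t) := by
  rw [← mul_one (star (U t)), ← h.mul_neg_self t, ← mul_assoc,
    (Unitary.mem_iff.1 (h.unitary t)).1, one_mul]

theorem norm_le_one (h : IsUnitaryGroupOf U A) (t : ℝ) : ‖U t‖ ≤ 1 :=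
  ContinuousLinearMap.opNorm_le_bound _ zero_le_one fun ψ => by rw [h.norm_apply, one_mul]

theorem norm_mul_mul_le (h : IsUnitaryGroupOf U A) (h' : IsUnitaryGroupOf U' A') (s t : ℝ)
    (T : BoundedOp) : ‖U s * T * U' t‖ ≤ ‖T‖ := by
  have h1 := h.norm_le_one s
  have h2 := h'.norm_le_one t
  calc ‖U s * T * U' t‖ ≤ ‖U s‖ * ‖T‖ * ‖U' t‖ :=
        (norm_mul_le _ _).trans (by gcongr; exact norm_mul_le _ _)
    _ ≤ 1 * ‖T‖ * 1 := by gcongr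
    _ = ‖T‖ := by ring

/-- `s ↦ U(s) T U'(s)*` is norm continuous if `T` is compact. -/
theorem continuous_mul_mul (h : IsUnitaryGroupOf U A) (h' : IsUnitaryGroupOf U' A')
    {T : BoundedOp} (hT : IsCompactOperator T) : Continuous fun s => U s * T * U' (-s) := by
  -- For |a⟩⟨b| the family is |U(s)a⟩⟨U'(s)b|, so strong continuity becomes norm continuity; compact
  -- operators follow by uniform approximation.
  have key : ∀ S ∈ finiteRankSpan L2R, Continuous fun s => U s * S * U' (-s) := by
    intro S hS
    induction hS using Submodule.span_induction with
    | mem S hS =>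
      obtain ⟨a, b, rfl⟩ := hS
      have h1 : ∀ s, U s * rankOne ℂ a b * U' (-s) = rankOne ℂ (U s a) (U' s b) := by
        intro s
        have h2 : star (U' (-s)) = U' s := by rw [h'.star_eq, neg_neg]
        rw [← h2]
        change (U s ∘L rankOne ℂ a b) ∘L U' (-s) = _
        rw [comp_rankOne, rankOne_comp]
        rfl
      simp_rw [h1]
      exact continuous_rankOne (h.continuous a) (h'.continuous b)
    | zero => simpa using continuous_const
    | add S S' _ _ h1 h2 =>
      simp_rw [mul_add, add_mul]
      exact h1.add h2
    | smul c S _ h1 =>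
      simp_rw [mul_smul_comm, smul_mul_assoc]
      exact h1.const_smul c
  refine continuous_of_uniform_approx_of_continuous fun u hu => ?_
  obtain ⟨ε, hε, hu⟩ := Metric.mem_uniformity_dist.1 hu
  obtain ⟨S, hS, hd⟩ := Metric.mem_closure_iff.1
    (mem_closure_finiteRankSpan_of_isCompactOperator hT) ε hε
  refine ⟨_, key S hS, fun s => hu ?_⟩
  rw [dist_eq_norm, ← sub_mul, ← mul_sub]
  rw [dist_eq_norm] at hd
  exact (h.norm_mul_mul_le h' s (-s) _).trans_lt hd

end IsUnitaryGroupOf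

/-- The integral can be computed inside the closed subspace, which is itself a Banach space. It is
applied to the compact operators. -/
theorem intervalIntegral_mem_of_isClosed {E : Type*} [NormedAddCommGroup E] [NormedSpace ℂ E]
    [CompleteSpace E] {S : Submodule ℂ E} (hS : IsClosed (S : Set E)) {f : ℝ → E}
    (hf : Continuous f) (hfS : ∀ s, f s ∈ S) (a b : ℝ) : ∫ s in a..b, f s ∈ S := by
  have : CompleteSpace S := hS.completeSpace_coe
  let f' : ℝ → S := fun s => ⟨f s, hfS s⟩
  have hf' : Continuous f' := hf.subtype_mk _
  have h := S.subtypeL.intervalIntegral_comp_comm (μ := volume) (hf'.intervalIntegrable a b)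
  change ∫ s in a..b, S.subtypeL (f' s) ∈ S
  rw [h]
  exact (∫ s in a..b, f' s).2

theorem isCompactOperator_intervalIntegral {K : ℝ → BoundedOp} (hK : Continuous K)
    (hc : ∀ s, IsCompactOperator (K s)) (a b : ℝ) :
    IsCompactOperator (∫ s in a..b, K s : BoundedOp) :=
  intervalIntegral_mem_of_isClosed (S := compactOperator (RingHom.id ℂ) L2R L2R)
    isClosed_setOf_isCompactOperator hK hc a b

/-- The symbol of `(P + i c)⁻¹`. -/
def momentumResolvent {c : ℝ} (hc : c ≠ 0) : ℝ →ᵇ ℂ :=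
  invSymbol momentumSymbol continuous_momentumSymbol hc

theorem hasTemperateGrowth_momentumResolvent {c : ℝ} (hc : c ≠ 0) :
    Function.HasTemperateGrowth (momentumResolvent hc) :=
  hasTemperateGrowth_inv_add_I_mul hasTemperateGrowth_momentumSymbol hc

theorem momentumSchwartz_mult_momentumResolvent {c : ℝ} (hc : c ≠ 0) (θ : 𝓢(ℝ, ℂ)) :
    momentumSchwartz (mult (momentumResolvent hc) θ) =
      θ - (I * c : ℂ) • mult (momentumResolvent hc) θ := by
  refine eq_of_fourier_eq fun ξ => ?_
  rw [sub_eq_add_neg, ← neg_smul, FourierTransform.fourier_add, FourierTransform.fourier_smul]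
  simp only [add_apply, smul_apply, smul_eq_mul]
  rw [fourier_momentumSchwartz, fourier_mult (hasTemperateGrowth_momentumResolvent hc),
    momentumResolvent, invSymbol_apply]
  have := add_I_mul_ne_zero (momentumSymbol ξ) hc
  field_simp
  ring

theorem momentumSchwartz_mult {m : ℝ → ℂ} (hm : Function.HasTemperateGrowth m) (θ : 𝓢(ℝ, ℂ)) :
    momentumSchwartz (mult m θ) = mult m (momentumSchwartz θ) := by
  refine eq_of_fourier_eq fun ξ => ?_
  rw [fourier_momentumSchwartz, fourier_mult hm, fourier_mult hm, fourier_momentumSchwartz]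
  ring

theorem mult_momentumResolvent_apply_add {c : ℝ} (hc : c ≠ 0) (θ : 𝓢(ℝ, ℂ)) :
    mult (momentumResolvent hc) (momentumSchwartz θ + (I * c : ℂ) • θ) = θ := by
  rw [map_add, map_smul, ← momentumSchwartz_mult (hasTemperateGrowth_momentumResolvent hc),
    momentumSchwartz_mult_momentumResolvent]
  abel

/-- In one dimension (p + i)⁻¹ is square integrable, so f(Q)(P + i)⁻¹ is Hilbert–Schmidt for every f
in L². -/
theorem memLp_momentumResolvent : MemLp (momentumResolvent one_ne_zero) 2 volume := by
  refine memLp_of_norm_sq_le (momentumResolvent one_ne_zero).continuous (C := 1) fun ξ => ?_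
  rw [momentumResolvent, invSymbol_apply, norm_inv, inv_pow, ← normSq_eq_norm_sq, normSq_apply,
    one_mul]
  simp only [add_re, ofReal_re, mul_re, I_re, I_im, ofReal_im, add_im, mul_im]
  refine inv_anti₀ (by positivity) ?_
  rw [momentumSymbol]
  nlinarith [Real.pi_gt_three, sq_nonneg ξ, mul_nonneg (sq_nonneg ξ) Real.pi_pos.le]

/-- Pointwise product of Schwartz functions. -/
abbrev schwartzMul (G η : 𝓢(ℝ, ℂ)) : 𝓢(ℝ, ℂ) := SchwartzMap.smulLeftCLM ℂ G η

theorem schwartzMul_apply (G η : 𝓢(ℝ, ℂ)) (x : ℝ) : schwartzMul G η x = G x * η x := by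
  rw [schwartzMul, SchwartzMap.smulLeftCLM_apply_apply G.hasTemperateGrowth, smul_eq_mul]

theorem momentumSchwartz_schwartzMul (G η : 𝓢(ℝ, ℂ)) :
    momentumSchwartz (schwartzMul G η) =
      schwartzMul (momentumSchwartz G) η + schwartzMul G (momentumSchwartz η) := by
  ext x
  have h : (schwartzMul G η : ℝ → ℂ) = fun x => G x * η x := funext (schwartzMul_apply G η)
  rw [momentumSchwartz_apply, h, add_apply, schwartzMul_apply, schwartzMul_apply,
    momentumSchwartz_apply, momentumSchwartz_apply, deriv_fun_mul G.differentiableAt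
      η.differentiableAt]
  ring

variable {V : ℝ → ℝ} {w : ℝ → ℂ} {b : ℝ →ᵇ ℂ}

/-- The commutator of `H₀` with `G(Q) (P + i)⁻¹`, for Schwartz functions. -/
theorem momentumSchwartz_sq_schwartzMul (G χ : 𝓢(ℝ, ℂ)) :
    momentumSchwartz (momentumSchwartz (schwartzMul G (mult (momentumResolvent one_ne_zero) χ))) =
      schwartzMul G (mult (momentumResolvent one_ne_zero) (momentumSchwartz (momentumSchwartz χ))) +
      (2 : ℂ) • schwartzMul (momentumSchwartz G) χ +
      (schwartzMul (momentumSchwartz (momentumSchwartz G)) (mult (momentumResolvent one_ne_zero) χ) -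
      (2 * I : ℂ) • schwartzMul (momentumSchwartz G) (mult (momentumResolvent one_ne_zero) χ)) := by
  rw [momentumSchwartz_schwartzMul, map_add, momentumSchwartz_schwartzMul,
    momentumSchwartz_schwartzMul,
    ← momentumSchwartz_mult (hasTemperateGrowth_momentumResolvent one_ne_zero),
    ← momentumSchwartz_mult (hasTemperateGrowth_momentumResolvent one_ne_zero)]
  -- Here P (P + i)⁻¹ = 1 - i (P + i)⁻¹: the 1 yields the multiplication operator that is wanted,
  -- the rest is a compact error.
  have h : schwartzMul (momentumSchwartz G)
      (momentumSchwartz (mult (momentumResolvent one_ne_zero) χ)) =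
      schwartzMul (momentumSchwartz G) χ -
        I • schwartzMul (momentumSchwartz G) (mult (momentumResolvent one_ne_zero) χ) := by
    rw [momentumSchwartz_mult_momentumResolvent, ofReal_one, mul_one]
    ext x
    simp only [sub_apply, smul_apply, smul_eq_mul, schwartzMul_apply]
    ring
  rw [h, mul_smul, two_smul, two_smul]
  abel

/-- Multiplication by `-G''/2 - G' + V G / 2`. -/
def commutatorSymbol (V : ℝ → ℝ) (G : 𝓢(ℝ, ℂ)) (x : ℝ) : ℂ :=
  (1 / 2 : ℂ) * momentumSchwartz (momentumSchwartz G) x - I * momentumSchwartz G x +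
    (1 / 2 : ℂ) * (V x * G x)

/-- The Schwartz factor G makes V G square integrable even though V need not be; this is why Y is
compact. -/
theorem memLp_commutatorSymbol (hw : MemLp w 2 volume) (hV : ∀ x, (V x : ℂ) = w x + b x)
    (G : 𝓢(ℝ, ℂ)) : MemLp (commutatorSymbol V G) 2 volume :=
  ((((momentumSchwartz (momentumSchwartz G)).memLp 2).const_mul _).sub
    (((momentumSchwartz G).memLp 2).const_mul _)).add ((memLp_potential_mul hw hV G).const_mul _)

theorem prodOp_schwartz (G χ : 𝓢(ℝ, ℂ)) :
    prodOp (G.memLp 2) memLp_momentumResolvent (schwartzIncl χ) =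
      schwartzIncl (schwartzMul G (mult (momentumResolvent one_ne_zero) χ)) := by
  refine Lp.ext ?_
  filter_upwards [prodOp_schwartzIncl (G.memLp 2) memLp_momentumResolvent
    (hasTemperateGrowth_momentumResolvent one_ne_zero) χ,
    coeFn_schwartzIncl (schwartzMul G (mult (momentumResolvent one_ne_zero) χ))] with x h1 h2
  rw [h1, h2, schwartzMul_apply]

/-- With `X = G(Q) (P + i)⁻¹` one has `H X - X H₀ = 2 (-i G')(Q) + 2 Y`, where `Y` is compact. -/
theorem hamiltonian_commutator (hw : MemLp w 2 volume) (hV : ∀ x, (V x : ℂ) = w x + b x)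
    (G χ : 𝓢(ℝ, ℂ)) :
    schwartzIncl (momentumSchwartz (momentumSchwartz
      (schwartzMul G (mult (momentumResolvent one_ne_zero) χ)))) +
    (memLp_potential_mul hw hV (schwartzMul G (mult (momentumResolvent one_ne_zero) χ))).toLp
      (fun x => (V x : ℂ) * schwartzMul G (mult (momentumResolvent one_ne_zero) χ) x) =
    prodOp (G.memLp 2) memLp_momentumResolvent
      (schwartzIncl (momentumSchwartz (momentumSchwartz χ))) +
    (2 : ℂ) • (schwartzIncl (schwartzMul (momentumSchwartz G) χ) +
      prodOp (memLp_commutatorSymbol hw hV G) memLp_momentumResolvent (schwartzIncl χ)) := by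
  rw [momentumSchwartz_sq_schwartzMul, map_add, map_add, map_smul, prodOp_schwartz, smul_add,
    add_assoc, add_assoc]
  congr 2
  refine Lp.ext ?_
  set η := mult (momentumResolvent one_ne_zero) χ
  filter_upwards [prodOp_schwartzIncl (memLp_commutatorSymbol hw hV G) memLp_momentumResolvent
    (hasTemperateGrowth_momentumResolvent one_ne_zero) χ,
    coeFn_schwartzIncl (schwartzMul (momentumSchwartz (momentumSchwartz G)) η -
      (2 * I : ℂ) • schwartzMul (momentumSchwartz G) η),
    (memLp_potential_mul hw hV (schwartzMul G η)).coeFn_toLp,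
    Lp.coeFn_add (schwartzIncl (schwartzMul (momentumSchwartz (momentumSchwartz G)) η -
      (2 * I : ℂ) • schwartzMul (momentumSchwartz G) η))
      ((memLp_potential_mul hw hV (schwartzMul G η)).toLp (fun x => (V x : ℂ) * schwartzMul G η x)),
    Lp.coeFn_smul (2 : ℂ)
      (prodOp (memLp_commutatorSymbol hw hV G) memLp_momentumResolvent (schwartzIncl χ))]
    with x h1 h2 h3 h4 h5
  rw [h4, h5, Pi.add_apply, Pi.smul_apply, h1, h2, h3, sub_apply, smul_apply, schwartzMul_apply,
    schwartzMul_apply, schwartzMul_apply, commutatorSymbol, smul_eq_mul, smul_eq_mul]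
  ring

theorem freeEvolution_momentum (t : ℝ) (ψ : 𝓢(ℝ, ℂ)) :
    momentumSchwartz (mult (evolutionSymbol t) ψ) =
      mult (evolutionSymbol t) (momentumSchwartz ψ) :=
  momentumSchwartz_mult (hasTemperateGrowth_evolutionSymbol t) ψ

/-- Inserting (P + i)⁻¹(P + i) replaces the unbounded factor w by a bounded operator. As P commutes
with the free evolution, w e^{-isH₀} ψ is then continuous in s. -/
theorem toLp_mul_schwartz {w : ℝ → ℂ} (hw : MemLp w 2 volume) (χ : 𝓢(ℝ, ℂ)) :
    (memLp_mul_schwartz hw χ).toLp (fun x => w x * χ x) =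
      prodOp hw memLp_momentumResolvent (schwartzIncl (momentumSchwartz χ + I • χ)) := by
  refine Lp.ext ?_
  filter_upwards [(memLp_mul_schwartz hw χ).coeFn_toLp,
    prodOp_schwartzIncl hw memLp_momentumResolvent
      (hasTemperateGrowth_momentumResolvent one_ne_zero) (momentumSchwartz χ + I • χ)] with x h1 h2
  have h3 := mult_momentumResolvent_apply_add one_ne_zero χ
  rw [ofReal_one, mul_one] at h3
  rw [h1, h2]
  change _ = w x * mult (momentumResolvent one_ne_zero) (momentumSchwartz χ + I • χ) x
  rw [h3]

theorem continuous_freeEvolution_neg_apply (x : L2R) : Continuous fun s => freeEvolution (-s) x :=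
  (isUnitaryGroupOf_freeEvolution.continuous x).comp continuous_neg

theorem continuous_toLp_mul_evolution {w : ℝ → ℂ} (hw : MemLp w 2 volume) (ψ : 𝓢(ℝ, ℂ)) :
    Continuous fun s => (memLp_mul_schwartz hw (mult (evolutionSymbol (-s)) ψ)).toLp
      (fun x => w x * mult (evolutionSymbol (-s)) ψ x) := by
  have h : ∀ s, (memLp_mul_schwartz hw (mult (evolutionSymbol (-s)) ψ)).toLp
      (fun x => w x * mult (evolutionSymbol (-s)) ψ x) = prodOp hw memLp_momentumResolvent
        (freeEvolution (-s) (schwartzIncl (momentumSchwartz ψ + I • ψ))) := by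
    intro s
    rw [toLp_mul_schwartz hw, freeEvolution_schwartzIncl, freeEvolution_momentum,
      map_add (mult (evolutionSymbol (-s))), map_smul (mult (evolutionSymbol (-s)))]
  simp_rw [h]
  exact (prodOp hw memLp_momentumResolvent).continuous.comp (continuous_freeEvolution_neg_apply _)

end Interaction

/-! ### Compactness of e^{itH} e^{-itH₀} - 1 -/

section Compactness

variable {V : ℝ → ℝ} {w w' : ℝ → ℂ} {b b' : ℝ →ᵇ ℂ}

theorem potential_decomposition (hw : MemLp w 2 volume) (hV : ∀ x, (V x : ℂ) = w x + b x)
    (hw' : MemLp w' 2 volume) {G : 𝓢(ℝ, ℂ)}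
    (hres : ∀ x, (V x : ℂ) = w' x + b' x + I * momentumSchwartz G x) (χ : 𝓢(ℝ, ℂ)) :
    (memLp_potential_mul hw hV χ).toLp (fun x => (V x : ℂ) * χ x) =
      (memLp_mul_schwartz hw' χ).toLp (fun x => w' x * χ x) + mulOp b' (schwartzIncl χ) +
        I • schwartzIncl (schwartzMul (momentumSchwartz G) χ) := by
  refine Lp.ext ?_
  filter_upwards [(memLp_potential_mul hw hV χ).coeFn_toLp, (memLp_mul_schwartz hw' χ).coeFn_toLp,
    coeFn_mulOp b' (schwartzIncl χ), coeFn_schwartzIncl χ,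
    coeFn_schwartzIncl (schwartzMul (momentumSchwartz G) χ),
    Lp.coeFn_add ((memLp_mul_schwartz hw' χ).toLp (fun x => w' x * χ x) +
      mulOp b' (schwartzIncl χ)) (I • schwartzIncl (schwartzMul (momentumSchwartz G) χ)),
    Lp.coeFn_add ((memLp_mul_schwartz hw' χ).toLp (fun x => w' x * χ x))
      (mulOp b' (schwartzIncl χ)),
    Lp.coeFn_smul I (schwartzIncl (schwartzMul (momentumSchwartz G) χ))]
    with x h1 h2 h3 h4 h5 h6 h7 h8
  rw [h6, Pi.add_apply, h7, Pi.add_apply, h8, Pi.smul_apply, h1, h2, h3, h4, h5, hres,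
    schwartzMul_apply, smul_eq_mul]
  ring

theorem mem_graph_closure_hamiltonian (hw : MemLp w 2 volume)
    (hV : ∀ x, (V x : ℂ) = w x + b x) (f : 𝓢(ℝ, ℂ)) :
    (schwartzIncl f, schwartzIncl (momentumSchwartz (momentumSchwartz f)) +
      (memLp_potential_mul hw hV f).toLp (fun x => (V x : ℂ) * f x)) ∈
        (hamiltonian V).closure.graph :=
  mem_graph_closure_of_mem ((mem_graph_hamiltonian (memLp_potential_mul hw hV)).2 ⟨f, rfl⟩)

/-- The factor i/2 is chosen so that the commutator of X cancels the part G' of V. What survives is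
the small remainder and the compact Y. -/
theorem hasDerivAt_evolution_apply (hw : MemLp w 2 volume) (hV : ∀ x, (V x : ℂ) = w x + b x)
    (hw' : MemLp w' 2 volume) {G : 𝓢(ℝ, ℂ)}
    (hres : ∀ x, (V x : ℂ) = w' x + b' x + I * momentumSchwartz G x) (ψ : 𝓢(ℝ, ℂ)) (s : ℝ) :
    HasDerivAt (fun r => evolution V r (schwartzIncl (mult (evolutionSymbol (-r)) ψ) -
        (I / 2) • prodOp (G.memLp 2) memLp_momentumResolvent
          (schwartzIncl (mult (evolutionSymbol (-r)) ψ))))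
      (evolution V s (I • ((memLp_mul_schwartz hw' (mult (evolutionSymbol (-s)) ψ)).toLp
          (fun x => w' x * mult (evolutionSymbol (-s)) ψ x) +
          mulOp b' (schwartzIncl (mult (evolutionSymbol (-s)) ψ))) +
        prodOp (memLp_commutatorSymbol hw hV G) memLp_momentumResolvent
          (schwartzIncl (mult (evolutionSymbol (-s)) ψ)))) s := by
  set u := mult (evolutionSymbol (-s)) ψ with hu
  set X := prodOp (G.memLp 2) memLp_momentumResolvent with hX
  set θ := schwartzMul G (mult (momentumResolvent one_ne_zero) u) with hθ
  have h1 : HasDerivAt (fun r => schwartzIncl (mult (evolutionSymbol (-r)) ψ))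
      (-I • schwartzIncl (momentumSchwartz (momentumSchwartz u))) s :=
    ((hasDerivAt_mult_evolutionSymbol ψ (-s)).scomp s (hasDerivAt_neg s)).congr_deriv (by
      simp [u])
  have h2 := h1.sub (((X.restrictScalars ℝ).hasFDerivAt.comp_hasDerivAt s h1).const_smul (I / 2))
  have hg : (schwartzIncl u - (I / 2) • X (schwartzIncl u), _) ∈ (hamiltonian V).closure.graph :=
    Submodule.sub_mem _ (mem_graph_closure_hamiltonian hw hV u)
    (Submodule.smul_mem _ (I / 2) (x := (X (schwartzIncl u), _)) (by
      rw [hX, prodOp_schwartz]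
      exact mem_graph_closure_hamiltonian hw hV θ))
  have h3 := (isUnitaryGroupOf_evolution hw hV).hasDerivAt_apply h2 hg
  refine h3.congr_deriv (congrArg (evolution V s) ?_)
  rw [hamiltonian_commutator hw hV G u, potential_decomposition hw hV hw' hres u]
  change I • (_ - (I / 2) • _) + (_ - (I / 2) • X _) = _
  dsimp only
  rw [map_smul, ← hX]
  generalize schwartzIncl (momentumSchwartz (momentumSchwartz u)) = y
  generalize X y = z
  match_scalars <;> ring_nf
  simp [I_sq]

theorem norm_schwartzIncl_mult_evolutionSymbol (t : ℝ) (ψ : 𝓢(ℝ, ℂ)) :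
    ‖schwartzIncl (mult (evolutionSymbol t) ψ)‖ = ‖schwartzIncl ψ‖ := by
  rw [← freeEvolution_schwartzIncl, isUnitaryGroupOf_freeEvolution.norm_apply]

theorem integral_norm_mul_evolution_le (hw' : MemLp w' 2 volume) (ψ : 𝓢(ℝ, ℂ)) {t : ℝ}
    (ht : 0 ≤ t) {ε : ℝ} (hε : 0 < ε) (h1 : ‖hw'.toLp w'‖ ≤ ε) :
    ∫ s in 0..t, ‖(memLp_mul_schwartz hw' (mult (evolutionSymbol (-s)) ψ)).toLp
      (fun x => w' x * mult (evolutionSymbol (-s)) ψ x)‖ ≤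
        ε * ((Real.exp (t ^ 2) * (√Real.pi * (4 * Real.pi)) + t) / 2) * ‖schwartzIncl ψ‖ := by
  have hc := continuous_toLp_mul_evolution hw' ψ
  have hI := integral_norm_sq_mul_evolution_le hw' ψ ht hc
  set n : ℝ → ℝ := fun s => ‖(memLp_mul_schwartz hw' (mult (evolutionSymbol (-s)) ψ)).toLp
      (fun x => w' x * mult (evolutionSymbol (-s)) ψ x)‖ with hn
  have hnc : Continuous n := hc.norm
  have hn2 : Continuous fun s => n s ^ 2 := hnc.pow 2
  have hn0 : ∀ s, 0 ≤ n s := fun s => norm_nonneg _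
  change ∫ s in 0..t, n s ≤ _
  change ∫ s in 0..t, n s ^ 2 ≤ _ at hI
  set M := Real.exp (t ^ 2) * (√Real.pi * (4 * Real.pi)) with hM
  have hM0 : 0 ≤ M := by positivity
  have hI2 : ∫ s in 0..t, n s ^ 2 ≤ M * ‖schwartzIncl ψ‖ ^ 2 * ε ^ 2 := by
    refine hI.trans ?_
    rw [hM, ← mul_assoc]
    gcongr
  have key : ∀ lam : ℝ, 2 * lam * ∫ s in 0..t, n s ≤
      M * ‖schwartzIncl ψ‖ ^ 2 * ε ^ 2 + lam ^ 2 * t := by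
    intro lam
    have h3 : ∫ s in 0..t, (2 * lam * n s) ≤ ∫ s in 0..t, (n s ^ 2 + lam ^ 2) := by
      refine intervalIntegral.integral_mono_on ht ((hnc.const_mul _).intervalIntegrable _ _)
        ((hn2.add continuous_const).intervalIntegrable _ _) fun s _ => ?_
      nlinarith [sq_nonneg (n s - lam)]
    rw [intervalIntegral.integral_const_mul, intervalIntegral.integral_add
      (hn2.intervalIntegrable _ _) (continuous_const.intervalIntegrable _ _),
      intervalIntegral.integral_const, smul_eq_mul] at h3
    linarith
  rcases (norm_nonneg (schwartzIncl ψ)).eq_or_lt with h0 | h0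
  · have h4 : ∀ s, n s = 0 := by
      intro s
      have h5 : schwartzIncl (mult (evolutionSymbol (-s)) ψ) = 0 := by
        rw [← norm_eq_zero, norm_schwartzIncl_mult_evolutionSymbol, ← h0]
      have h6 := schwartzIncl_injective (h5.trans (map_zero _).symm)
      rw [hn]
      simp [h6]
    simp [h4, ← h0]
  -- The passage from the L² to the L¹ bound in time uses 2λn ≤ n² + λ²; this λ gives both terms on
  -- the right the scale ε² ‖ψ‖², and division by 2λ requires ψ ≠ 0.
  · have h5 := key (ε * ‖schwartzIncl ψ‖)
    have h6 : 0 < 2 * (ε * ‖schwartzIncl ψ‖) := by positivity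
    refine le_of_mul_le_mul_left (h5.trans_eq ?_) h6
    ring

/-- Integrating the corrected derivative over [0, t] puts the boundary terms of X and the integral
of e^{isH} Y e^{-isH₀} into K. The remaining integral contains only w' and b', controlled by
smoothing and by the sup norm. -/
theorem exists_isCompactOperator_norm_sub_le (hw : MemLp w 2 volume)
    (hV : ∀ x, (V x : ℂ) = w x + b x) (hw' : MemLp w' 2 volume) {G : 𝓢(ℝ, ℂ)}
    (hres : ∀ x, (V x : ℂ) = w' x + b' x + I * momentumSchwartz G x) {t : ℝ} (ht : 0 ≤ t)
    {ε : ℝ} (hε : 0 < ε) (h1 : ‖hw'.toLp w'‖ ≤ ε) (h2 : ‖b'‖ ≤ ε) :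
    ∃ K : BoundedOp, IsCompactOperator K ∧ ‖evolution V t * freeEvolution (-t) - 1 - K‖ ≤
      ε * ((Real.exp (t ^ 2) * (√Real.pi * (4 * Real.pi)) + t) / 2 + t) := by
  have hU := isUnitaryGroupOf_evolution hw hV
  have hU0 := isUnitaryGroupOf_freeEvolution
  set X := prodOp (G.memLp 2) memLp_momentumResolvent with hX
  set Y := prodOp (memLp_commutatorSymbol hw hV G) memLp_momentumResolvent with hY
  have hXc : IsCompactOperator X := isCompactOperator_prodOp _ _
  have hYc : IsCompactOperator Y := isCompactOperator_prodOp _ _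
  have hcomp : ∀ {T : BoundedOp}, IsCompactOperator T → ∀ s,
      IsCompactOperator (evolution V s * T * freeEvolution (-s)) := fun hT s =>
    (hT.clm_comp (evolution V s)).comp_clm (freeEvolution (-s))
  have hYcont := hU.continuous_mul_mul hU0 hYc
  refine ⟨(I / 2) • (evolution V t * X * freeEvolution (-t) - X) +
    ∫ s in 0..t, evolution V s * Y * freeEvolution (-s), ?_, ?_⟩
  · exact (((hcomp hXc t).sub hXc).smul (I / 2)).add
      (isCompactOperator_intervalIntegral hYcont (hcomp hYc) 0 t)
  refine opNorm_le_of_schwartz (by positivity) fun ψ => ?_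
  set n : ℝ → L2R := fun s => (memLp_mul_schwartz hw' (mult (evolutionSymbol (-s)) ψ)).toLp
      (fun x => w' x * mult (evolutionSymbol (-s)) ψ x) with hn
  have hnc : Continuous n := continuous_toLp_mul_evolution hw' ψ
  set u : ℝ → L2R := fun s => freeEvolution (-s) (schwartzIncl ψ) with hu
  have huc : Continuous u := continuous_freeEvolution_neg_apply _
  have hus : ∀ s, schwartzIncl (mult (evolutionSymbol (-s)) ψ) = u s := fun s =>
    (freeEvolution_schwartzIncl _ _).symm
  have hd : ∀ s, HasDerivAt (fun r => evolution V r (u r - (I / 2) • X (u r)))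
      (evolution V s (I • (n s + mulOp b' (u s))) +
        (evolution V s * Y * freeEvolution (-s)) (schwartzIncl ψ)) s := by
    intro s
    have h3 := hasDerivAt_evolution_apply hw hV hw' hres ψ s
    rw [map_add] at h3
    simp_rw [hus] at h3
    exact h3
  have hc1 : Continuous fun s => evolution V s (I • (n s + mulOp b' (u s))) :=
    hU.continuous_apply ((hnc.add ((mulOp b').continuous.comp huc)).const_smul I)
  have hc2 : Continuous fun s => (evolution V s * Y * freeEvolution (-s)) (schwartzIncl ψ) :=
    hYcont.clm_apply continuous_const
  have hftc := intervalIntegral.integral_eq_sub_of_hasDerivAt (fun s _ => hd s)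
    ((hc1.add hc2).intervalIntegrable 0 t)
  rw [intervalIntegral.integral_add (hc1.intervalIntegrable _ _) (hc2.intervalIntegrable _ _),
    ← ContinuousLinearMap.intervalIntegral_apply (hYcont.intervalIntegrable _ _)] at hftc
  have heq : (evolution V t * freeEvolution (-t) - 1 -
      ((I / 2) • (evolution V t * X * freeEvolution (-t) - X) +
      ∫ s in 0..t, evolution V s * Y * freeEvolution (-s))) (schwartzIncl ψ) =
      ∫ s in 0..t, evolution V s (I • (n s + mulOp b' (u s))) := by
    rw [← eq_sub_iff_add_eq] at hftc
    rw [hftc]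
    have hu0 : u 0 = schwartzIncl ψ := by simp [hu, hU0.zero]
    rw [hu0, hU.zero, map_sub, map_smul]
    change evolution V t (u t) - schwartzIncl ψ - ((I / 2) • (evolution V t (X (u t)) -
      X (schwartzIncl ψ)) + _) = evolution V t (u t) - (I / 2) • evolution V t (X (u t)) -
        (schwartzIncl ψ - (I / 2) • X (schwartzIncl ψ)) - _
    module
  rw [heq]
  have hb : ∀ s, ‖mulOp b' (u s)‖ ≤ ε * ‖schwartzIncl ψ‖ := by
    intro s
    refine ((mulOp b').le_opNorm _).trans ?_
    rw [hu, hU0.norm_apply]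
    gcongr
    exact (norm_mulOp_le b').trans h2
  have hnn : Continuous fun s => ‖n s‖ := hnc.norm
  refine (intervalIntegral.norm_integral_le_of_norm_le (g := fun s => ‖n s‖ + ε * ‖schwartzIncl ψ‖)
    ht (Eventually.of_forall fun s _ => ?_)
    ((hnn.add continuous_const).intervalIntegrable _ _)).trans ?_
  · rw [hU.norm_apply, norm_smul, norm_I, one_mul]
    exact (norm_add_le _ _).trans (by gcongr; exact hb s)
  · rw [intervalIntegral.integral_add (hnn.intervalIntegrable _ _)
      (continuous_const.intervalIntegrable _ _), intervalIntegral.integral_const, smul_eq_mul]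
    have h7 := integral_norm_mul_evolution_le hw' ψ ht hε h1
    change ∫ s in 0..t, ‖n s‖ ≤ _ at h7
    linarith

/-- `V` belongs to `L² + L^∞`, and is a norm limit there of derivatives of Schwartz functions. -/
structure IsApproximable (V : ℝ → ℝ) : Prop where
  exists_decomposition : ∃ (w : ℝ → ℂ) (b : ℝ →ᵇ ℂ), MemLp w 2 volume ∧ ∀ x, (V x : ℂ) = w x + b x
  exists_approx : ∀ ε > 0, ∃ (w' : ℝ → ℂ) (b' : ℝ →ᵇ ℂ) (G : 𝓢(ℝ, ℂ)) (hw' : MemLp w' 2 volume),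
    ‖hw'.toLp w'‖ ≤ ε ∧ ‖b'‖ ≤ ε ∧ ∀ x, (V x : ℂ) = w' x + b' x + I * momentumSchwartz G x

/-- The constant in the estimate does not depend on the splitting of V, so letting ε → 0 suffices
for t ≥ 0. For t < 0 one uses W(t) - 1 = -e^{itH} (W(-t) - 1) e^{-itH₀}, where W(t) = e^{itH}
e^{-itH₀}. -/
theorem IsApproximable.isCompactOperator (h : IsApproximable V) (t : ℝ) :
    IsCompactOperator (evolution V t * freeEvolution (-t) - 1 : BoundedOp) := by
  obtain ⟨w, b, hw, hV⟩ := h.exists_decomposition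
  have hU := isUnitaryGroupOf_evolution hw hV
  have hU0 := isUnitaryGroupOf_freeEvolution
  have hpos : ∀ t : ℝ, 0 ≤ t →
      IsCompactOperator (evolution V t * freeEvolution (-t) - 1 : BoundedOp) := by
    intro t ht
    set C := (Real.exp (t ^ 2) * (√Real.pi * (4 * Real.pi)) + t) / 2 + t with hC
    have hC0 : 0 < C := by positivity
    have hmem : evolution V t * freeEvolution (-t) - 1 ∈
        closure {T : BoundedOp | IsCompactOperator T} := by
      rw [Metric.mem_closure_iff]
      intro ε hε
      obtain ⟨w', b', G, hw', h1, h2, hres⟩ := h.exists_approx (ε / (2 * C)) (by positivity)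
      obtain ⟨K, hK, hle⟩ := exists_isCompactOperator_norm_sub_le hw hV hw' hres ht
        (by positivity) h1 h2
      refine ⟨K, hK, ?_⟩
      rw [dist_eq_norm]
      refine hle.trans_lt ?_
      rw [← hC]
      have : ε / (2 * C) * C = ε / 2 := by field_simp
      rw [this]
      linarith
    rwa [isClosed_setOf_isCompactOperator.closure_eq] at hmem
  rcases le_total 0 t with ht | ht
  · exact hpos t ht
  · have h1 := hpos (-t) (neg_nonneg.2 ht)
    have h2 : evolution V t * freeEvolution (-t) - 1 =
        -(evolution V t * (evolution V (-t) * freeEvolution (-(-t)) - 1) * freeEvolution (-t)) := by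
      rw [mul_sub, sub_mul, ← mul_assoc, hU.mul_neg_self, one_mul, mul_one, hU0.neg_mul_self,
        neg_sub]
    rw [h2]
    exact ((h1.clm_comp (evolution V t)).comp_clm (freeEvolution (-t))).neg

end Compactness

/-! ### Splitting and approximation of the singular potential -/

section SingularPotential

/-- The truncated potential `g max(|x|, R)^{-κ}`. -/
def truncatedPotential (g κ : ℝ) {R : ℝ} (hR : 0 < R) (hκ : 0 < κ) : ℝ →ᵇ ℂ :=
  BoundedContinuousFunction.ofNormedAddCommGroup (fun x => ((g * max |x| R ^ (-κ) : ℝ) : ℂ))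
    (by
      refine continuous_ofReal.comp (continuous_const.mul ?_)
      exact (continuous_abs.max continuous_const).rpow_const fun x =>
        Or.inl (hR.trans_le (le_max_right _ _)).ne')
    (|g| * R ^ (-κ)) fun x => by
      rw [Complex.norm_real, norm_mul, Real.norm_eq_abs,
        Real.norm_of_nonneg (Real.rpow_nonneg (hR.le.trans (le_max_right _ _)) _)]
      exact mul_le_mul_of_nonneg_left
        (Real.rpow_le_rpow_of_nonpos hR (le_max_right _ _) (by linarith)) (abs_nonneg g)

variable {g κ R : ℝ}

theorem truncatedPotential_apply (hR : 0 < R) (hκ : 0 < κ) (x : ℝ) :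
    truncatedPotential g κ hR hκ x = (g * max |x| R ^ (-κ) : ℝ) := rfl

theorem norm_truncatedPotential_le (hR : 0 < R) (hκ : 0 < κ) :
    ‖truncatedPotential g κ hR hκ‖ ≤ |g| * R ^ (-κ) :=
  BoundedContinuousFunction.norm_ofNormedAddCommGroup_le _ (by positivity) _

theorem integrableOn_abs_rpow {r : ℝ} (hr : -1 < r) (R : ℝ) :
    IntegrableOn (fun x : ℝ => |x| ^ r) (Set.Icc (-R) R) := by
  rcases lt_or_ge R 0 with hR | hR
  · rw [Set.Icc_eq_empty (by linarith)]
    exact integrableOn_empty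
  have h1 : IntervalIntegrable (fun x : ℝ => |x| ^ r) volume 0 R := by
    refine (intervalIntegral.intervalIntegrable_rpow' hr).congr fun x hx => ?_
    rw [Set.uIoc_of_le hR] at hx
    rw [abs_of_pos hx.1]
  have h2 : IntervalIntegrable (fun x : ℝ => |x| ^ r) volume (-R) 0 := by
    have := (IntervalIntegrable.iff_comp_neg).1 h1
    simpa using this.symm
  exact (intervalIntegrable_iff_integrableOn_Icc_of_le (by linarith)).1 (h2.trans h1)

theorem measurable_singularPotential (g κ : ℝ) : Measurable (singularPotential g κ) :=
  Measurable.ite (measurableSet_singleton 0) measurable_const (by fun_prop)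

/-- The difference vanishes for |x| > R and is dominated by |g| |x|^{-κ} inside. Square
integrability at the origin is where κ < 1/2 is needed. -/
theorem memLp_singularPotential_sub (hR : 0 < R) (hκ : 0 < κ) (hκ₁ : κ < 1 / 2) :
    MemLp (fun x => (singularPotential g κ x : ℂ) - truncatedPotential g κ hR hκ x) 2 volume := by
  have hm : Measurable fun x =>
      (singularPotential g κ x : ℂ) - truncatedPotential g κ hR hκ x :=
    (measurable_ofReal.comp (measurable_singularPotential g κ)).sub
      (truncatedPotential g κ hR hκ).continuous.measurable
  rw [memLp_two_iff_integrable_sq_norm hm.aestronglyMeasurable]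
  have hi : Integrable ((Set.Icc (-R) R).indicator fun x : ℝ => g ^ 2 * |x| ^ (-2 * κ)) :=
    (integrable_indicator_iff measurableSet_Icc).2
      ((integrableOn_abs_rpow (by linarith) R).const_mul (g ^ 2))
  refine hi.mono' (hm.norm.pow_const 2).aestronglyMeasurable ?_
  filter_upwards [compl_mem_ae_iff.2 (measure_singleton (0 : ℝ))] with x hx
  have hx0 : x ≠ 0 := hx
  have hxp : 0 < |x| := abs_pos.2 hx0
  rw [Real.norm_of_nonneg (by positivity), singularPotential, if_neg hx0,
    truncatedPotential_apply, ← ofReal_sub, Complex.norm_real, Real.norm_eq_abs, sq_abs,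
    ← mul_sub, mul_pow]
  by_cases hxR : |x| ≤ R
  · rw [Set.indicator_of_mem (show x ∈ Set.Icc (-R) R from abs_le.1 hxR), max_eq_right hxR]
    have h1 : R ^ (-κ) ≤ |x| ^ (-κ) := Real.rpow_le_rpow_of_nonpos hxp hxR (by linarith)
    have h2 : 0 ≤ R ^ (-κ) := by positivity
    have h3 : |x| ^ (-2 * κ) = (|x| ^ (-κ)) ^ 2 := by
      rw [← Real.rpow_natCast, ← Real.rpow_mul hxp.le]
      congr 1
      push_cast
      ring
    rw [h3]
    gcongr
    linarith
  · rw [max_eq_left (not_le.1 hxR).le, sub_self]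
    rw [Set.indicator_of_notMem fun h : x ∈ Set.Icc (-R) R => hxR (abs_le.2 h)]
    simp

/-- The range of P is dense: for Schwartz θ, θ - P(P + iδ)⁻¹θ = iδ(P + iδ)⁻¹θ tends to 0 as δ → 0,
by dominated convergence in Fourier space away from the null set {0}. The primitive -i(P + iδ)⁻¹θ is
again Schwartz. -/
theorem exists_norm_sub_momentum_lt (f : L2R) {ε : ℝ} (hε : 0 < ε) :
    ∃ G : 𝓢(ℝ, ℂ), ‖f - schwartzIncl (I • momentumSchwartz G)‖ < ε := by
  obtain ⟨_, ⟨θ, rfl⟩, hθ⟩ := Metric.mem_closure_iff.1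
    (dense_schwartzDomain.closure_eq.symm ▸ Set.mem_univ f : f ∈ closure (schwartzDomain : Set L2R))
    (ε / 2) (by positivity)
  rw [dist_eq_norm] at hθ
  let d : ℕ → ℝ := fun n => 1 / ((n : ℝ) + 1)
  have hd : ∀ n, d n ≠ 0 := fun n => (Nat.one_div_pos_of_nat).ne'
  have hd0 : Tendsto d atTop (𝓝 0) := tendsto_one_div_add_atTop_nhds_zero_nat
  have hf : ∀ n ξ, 𝓕 ((I * d n : ℂ) • mult (momentumResolvent (hd n)) θ) ξ =
      I * d n * ((momentumSymbol ξ : ℂ) + I * d n)⁻¹ * 𝓕 θ ξ := by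
    intro n ξ
    rw [FourierTransform.fourier_smul, smul_apply, smul_eq_mul,
      fourier_mult (hasTemperateGrowth_momentumResolvent (hd n)), momentumResolvent,
      invSymbol_apply]
    ring
  have hlim : Tendsto (fun n => ‖schwartzIncl ((I * d n : ℂ) • mult (momentumResolvent (hd n)) θ)‖
      ^ 2) atTop (𝓝 0) := by
    simp_rw [← norm_schwartzIncl_fourier (_ • _), norm_sq_schwartzIncl, hf]
    rw [← integral_zero ℝ ℝ (μ := volume)]
    refine tendsto_integral_of_dominated_convergence (fun ξ => ‖𝓕 θ ξ‖ ^ 2) (fun n => ?_)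
      ((memLp_two_iff_integrable_sq_norm ((𝓕 θ).memLp 2).1).1 ((𝓕 θ).memLp 2)) (fun n => ?_) ?_
    · simp_rw [← hf]
      exact ((SchwartzMap.continuous _).norm.pow 2).aestronglyMeasurable
    · refine Eventually.of_forall fun ξ => ?_
      rw [Real.norm_of_nonneg (by positivity), norm_mul]
      have h1 := norm_inv_add_I_mul_le (momentumSymbol ξ) (hd n)
      have h2 : 0 < |d n| := abs_pos.2 (hd n)
      have h3 : ‖I * d n * ((momentumSymbol ξ : ℂ) + I * d n)⁻¹‖ ≤ 1 := by
        rw [norm_mul, norm_mul, norm_I, one_mul, Complex.norm_real, Real.norm_eq_abs]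
        calc |d n| * _ ≤ |d n| * |d n|⁻¹ := by gcongr
          _ = 1 := mul_inv_cancel₀ h2.ne'
      gcongr
      exact mul_le_of_le_one_left (norm_nonneg _) h3
    · filter_upwards [compl_mem_ae_iff.2 (measure_singleton (0 : ℝ))] with ξ hξ
      have hp : (momentumSymbol ξ : ℂ) + I * (0 : ℝ) ≠ 0 := by
        have : ξ ≠ 0 := hξ
        simp [momentumSymbol, this, Real.pi_ne_zero]
      have hI : Tendsto (fun n => I * (d n : ℂ)) atTop (𝓝 (I * (0 : ℝ))) :=
        ((continuous_ofReal.tendsto 0).comp hd0).const_mul I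
      have := (((hI.mul ((hI.const_add (momentumSymbol ξ : ℂ)).inv₀ hp)).mul_const
        (𝓕 θ ξ)).norm.pow 2)
      simpa using this
  obtain ⟨n, hn⟩ := (hlim.eventually_lt_const (show 0 < (ε / 2) ^ 2 by positivity)).exists
  refine ⟨(-I) • mult (momentumResolvent (hd n)) θ, ?_⟩
  have h1 : I • momentumSchwartz ((-I) • mult (momentumResolvent (hd n)) θ) =
      θ - (I * d n : ℂ) • mult (momentumResolvent (hd n)) θ := by
    rw [map_smul, smul_smul, mul_neg, I_mul_I, neg_neg, one_smul,
      momentumSchwartz_mult_momentumResolvent]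
  rw [h1, map_sub, ← sub_add]
  have h2 := lt_of_pow_lt_pow_left₀ 2 (by positivity) hn
  exact (norm_add_le _ _).trans_lt (by linarith)

/-- First R is taken large enough to make the tail small in sup norm; for that R the L² part is then
approximated by derivatives of Schwartz functions. -/
theorem isApproximable_singularPotential (hκ : 0 < κ) (hκ₁ : κ < 1 / 2) :
    IsApproximable (singularPotential g κ) where
  exists_decomposition := ⟨_, truncatedPotential g κ one_pos hκ,
    memLp_singularPotential_sub one_pos hκ hκ₁, fun x => by ring⟩
  exists_approx := by
    intro ε hε
    have hlim : Tendsto (fun R : ℝ => |g| * R ^ (-κ)) atTop (𝓝 (|g| * 0)) :=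
      (tendsto_rpow_neg_atTop hκ).const_mul _
    rw [mul_zero] at hlim
    obtain ⟨R, hR1, hR⟩ := ((hlim.eventually_lt_const hε).and (eventually_gt_atTop 0)).exists
    have hw := memLp_singularPotential_sub (g := g) hR hκ hκ₁
    obtain ⟨G, hG⟩ := exists_norm_sub_momentum_lt (hw.toLp _) hε
    have hS := (I • momentumSchwartz G).memLp 2
    refine ⟨_, truncatedPotential g κ hR hκ, G, hw.sub hS, ?_,
      (norm_truncatedPotential_le hR hκ).trans hR1.le, fun x => ?_⟩
    · rw [MemLp.toLp_sub hw hS]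
      exact hG.le
    · simp only [Pi.sub_apply, smul_apply, smul_eq_mul]
      ring

end SingularPotential

/-! ### The basic resolvents and the free evolution -/

section Resolvents

/-- `a P + b Q` on Schwartz functions. -/
def linearSchwartz (a b : ℝ) : 𝓢(ℝ, ℂ) →ₗ[ℂ] 𝓢(ℝ, ℂ) :=
  (a : ℂ) • momentumSchwartz + (b : ℂ) • positionSchwartz

theorem linearSchwartz_apply (a b : ℝ) (f : 𝓢(ℝ, ℂ)) :
    linearSchwartz a b f = (a : ℂ) • momentumSchwartz f + (b : ℂ) • positionSchwartz f := rfl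

theorem smul_momentum_add_smul_position (a b : ℝ) :
    (a : ℂ) • momentum + (b : ℂ) • position = schwartzOp (linearSchwartz a b) := by
  refine LinearPMap.ext (inf_idem schwartzDomain) ?_
  rintro _ hf ⟨f, rfl⟩
  change (a : ℂ) • schwartzOp momentumSchwartz ⟨schwartzIncl f, _⟩ +
    (b : ℂ) • schwartzOp positionSchwartz ⟨schwartzIncl f, _⟩ = _
  rw [schwartzOp_apply, schwartzOp_apply, schwartzOp_apply, linearSchwartz_apply, map_add, map_smul,
    map_smul]

theorem inner_linearSchwartz (a b : ℝ) (f g : 𝓢(ℝ, ℂ)) :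
    ⟪schwartzIncl (linearSchwartz a b f), schwartzIncl g⟫_ℂ =
      ⟪schwartzIncl f, schwartzIncl (linearSchwartz a b g)⟫_ℂ := by
  have h1 := inner_schwartzIncl_eq_of_fourier fourier_momentumSchwartz f g
  have h2 : ⟪schwartzIncl (positionSchwartz f), schwartzIncl g⟫_ℂ =
      ⟪schwartzIncl f, schwartzIncl (positionSchwartz g)⟫_ℂ := by
    rw [inner_schwartzIncl, inner_schwartzIncl]
    congr 1
    funext x
    rw [positionSchwartz_apply, positionSchwartz_apply, map_mul, conj_ofReal]
    ring
  simp only [linearSchwartz_apply, map_add, map_smul, inner_add_left, inner_add_right,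
    inner_smul_left, inner_smul_right, conj_ofReal, h1, h2]

theorem graph_closure_linearSchwartz (a b : ℝ) :
    (schwartzOp (linearSchwartz a b)).graph.topologicalClosure =
      (schwartzOp (linearSchwartz a b)).closure.graph := by
  refine (isClosable_of_isFormalAdjoint dense_schwartzDomain
    (isFormalAdjoint_of_isSymmetricRel fun p hp q hq => ?_)).graph_closure_eq_closure_graph
  obtain ⟨f, rfl⟩ := mem_graph_schwartzOp.1 hp
  obtain ⟨g, rfl⟩ := mem_graph_schwartzOp.1 hq
  exact inner_linearSchwartz a b f g

theorem isResolventAt_iff {T : L2R →ₗ.[ℂ] L2R} {z : ℂ} {R : BoundedOp} :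
    IsResolventAt T z R ↔ (∀ φ, (R φ, φ - z • R φ) ∈ T.graph) ∧
      ∀ p ∈ T.graph, R (z • p.1 + p.2) = p.1 := by
  refine and_congr (forall_congr' fun φ => ?_) ?_
  · rw [LinearPMap.mem_graph_iff]
    constructor
    · rintro ⟨h, h1⟩
      exact ⟨⟨R φ, h⟩, rfl, eq_sub_of_add_eq' h1⟩
    · rintro ⟨⟨y, hy⟩, h1, h2⟩
      simp only at h1 h2
      subst h1
      exact ⟨hy, by rw [h2, add_sub_cancel]⟩
  · constructor
    · intro h p hp
      obtain ⟨y, h1, h2⟩ := LinearPMap.mem_graph_iff _ |>.1 hp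
      rw [← h1, ← h2]
      exact h y
    · intro h y
      exact h _ (T.mem_graph y)

theorem mem_basicResolvents_iff {R : BoundedOp} : R ∈ basicResolvents ↔ ∃ a b c : ℝ, c ≠ 0 ∧
    (∀ φ, (R φ, φ - (I * c : ℂ) • R φ) ∈ (schwartzOp (linearSchwartz a b)).closure.graph) ∧
      ∀ p ∈ (schwartzOp (linearSchwartz a b)).closure.graph, R ((I * c : ℂ) • p.1 + p.2) = p.1 := by
  simp only [basicResolvents, Set.mem_ofPred_eq, isResolventAt_iff, smul_momentum_add_smul_position]

theorem closure_graph_subset {a b : ℝ} {s : Set (L2R × L2R)} (hs : IsClosed s)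
    (h : ∀ f, (schwartzIncl f, schwartzIncl (linearSchwartz a b f)) ∈ s) {p : L2R × L2R}
    (hp : p ∈ (schwartzOp (linearSchwartz a b)).closure.graph) : p ∈ s := by
  rw [← graph_closure_linearSchwartz, ← SetLike.mem_coe, Submodule.topologicalClosure_coe] at hp
  refine closure_minimal (fun p hp => ?_) hs hp
  obtain ⟨f, rfl⟩ := mem_graph_schwartzOp.1 hp
  exact h f

theorem isClosed_graph_linearSchwartz (a b : ℝ) :
    IsClosed ((schwartzOp (linearSchwartz a b)).closure.graph : Set (L2R × L2R)) := by
  rw [← graph_closure_linearSchwartz]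
  exact Submodule.isClosed_topologicalClosure _

/-- A bounded operator which inverts `i c + a P + b Q` on the Schwartz functions is a resolvent. -/
theorem mem_basicResolvents_of_schwartz {a b c : ℝ} (hc : c ≠ 0) {R : BoundedOp}
    {B : 𝓢(ℝ, ℂ) → 𝓢(ℝ, ℂ)} (hB : ∀ θ, R (schwartzIncl θ) = schwartzIncl (B θ))
    (h1 : ∀ θ, linearSchwartz a b (B θ) + (I * c : ℂ) • B θ = θ)
    (h2 : ∀ θ, B (linearSchwartz a b θ + (I * c : ℂ) • θ) = θ) : R ∈ basicResolvents := by
  refine mem_basicResolvents_iff.2 ⟨a, b, c, hc, fun φ => ?_, fun p hp => ?_⟩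
  · refine denseRange_schwartzIncl.induction_on (p := fun φ => (R φ, φ - (I * c : ℂ) • R φ) ∈
      (schwartzOp (linearSchwartz a b)).closure.graph) φ
      ((isClosed_graph_linearSchwartz a b).preimage (by fun_prop)) fun θ => ?_
    refine mem_graph_closure_of_mem (mem_graph_schwartzOp.2 ⟨B θ, ?_⟩)
    rw [hB, ← map_smul, ← map_sub]
    congr 2
    rw [sub_eq_iff_eq_add]
    exact (h1 θ).symm
  · refine closure_graph_subset (s := {p | R ((I * c : ℂ) • p.1 + p.2) = p.1})
      (isClosed_eq (by fun_prop) (by fun_prop)) (fun f => ?_) hp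
    rw [Set.mem_ofPred_eq, ← map_smul, ← map_add, hB, add_comm, h2]

theorem subset_resolventAlgebra : basicResolvents ⊆ (resolventAlgebra : Set BoundedOp) :=
  (StarAlgebra.subset_adjoin ℂ _).trans (StarSubalgebra.le_topologicalClosure _)

theorem mulOp_inv_mem_basicResolvents {c : ℝ} (hc : c ≠ 0) :
    mulOp (invSymbol id continuous_id hc) ∈ basicResolvents := by
  have ht : Function.HasTemperateGrowth (invSymbol id continuous_id hc) :=
    hasTemperateGrowth_inv_add_I_mul Function.HasTemperateGrowth.id' hc
  refine mem_basicResolvents_of_schwartz (a := 0) (b := 1) hc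
    (B := SchwartzMap.smulLeftCLM ℂ (invSymbol id continuous_id hc))
    (fun θ => mulOp_schwartzIncl _ ht θ) (fun θ => ?_) fun θ => ?_ <;>
  · ext x
    have := add_I_mul_ne_zero x hc
    simp only [linearSchwartz_apply, add_apply, smul_apply, smul_eq_mul, ofReal_zero, zero_mul,
      zero_add, ofReal_one, one_mul, positionSchwartz_apply,
      SchwartzMap.smulLeftCLM_apply_apply ht, invSymbol_apply, id]
    field_simp

theorem fourierMul_inv_mem_basicResolvents {c : ℝ} (hc : c ≠ 0) :
    fourierMul (momentumResolvent hc) ∈ basicResolvents := by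
  have ht := hasTemperateGrowth_momentumResolvent hc
  refine mem_basicResolvents_of_schwartz (a := 1) (b := 0) hc
    (B := mult (momentumResolvent hc))
    (fun θ => fourierMul_schwartzIncl _ ht θ) (fun θ => ?_) fun θ => ?_
  · rw [linearSchwartz_apply, momentumSchwartz_mult_momentumResolvent]
    simp
  · rw [linearSchwartz_apply, ofReal_one, one_smul, ofReal_zero, zero_smul, add_zero,
      mult_momentumResolvent_apply_add]

theorem fourier_positionSchwartz (f : 𝓢(ℝ, ℂ)) (ξ : ℝ) :
    𝓕 (positionSchwartz f) ξ = I / (2 * Real.pi) * deriv (𝓕 f : 𝓢(ℝ, ℂ)) ξ := by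
  have hi : Function.HasTemperateGrowth fun x : ℝ => inner ℝ x (1 : ℝ) :=
    ((innerSL ℝ).flip (1 : ℝ)).hasTemperateGrowth
  have h1 : -(2 * Real.pi * I) • SchwartzMap.smulLeftCLM ℂ (fun x : ℝ => inner ℝ x (1 : ℝ)) f =
      -(2 * Real.pi * I) • positionSchwartz f := by
    congr 1
    ext x
    rw [SchwartzMap.smulLeftCLM_apply_apply hi, positionSchwartz_apply]
    simp
  have h2 := congrArg (fun g : 𝓢(ℝ, ℂ) => g ξ) (SchwartzMap.lineDerivOp_fourier_eq f (1 : ℝ))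
  rw [h1, FourierTransform.fourier_smul, smul_apply, smul_eq_mul,
    SchwartzMap.lineDerivOp_apply_eq_fderiv, fderiv_apply_one_eq_deriv] at h2
  rw [h2]
  have hpi : (Real.pi : ℂ) ≠ 0 := ofReal_ne_zero.2 Real.pi_ne_zero
  field_simp
  simp [I_sq]

theorem hasDerivAt_evolutionSymbol (t ξ : ℝ) : HasDerivAt (evolutionSymbol t)
    (evolutionSymbol t ξ * (t * (4 * Real.pi * momentumSymbol ξ) : ℝ) * I) ξ := by
  have h1 : HasDerivAt (fun ξ => t * energySymbol ξ) (t * (4 * Real.pi * momentumSymbol ξ)) ξ := by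
    have h2 := (((hasDerivAt_id ξ).const_mul (2 * Real.pi)).pow 2).const_mul t
    refine h2.congr_deriv ?_
    simp only [momentumSymbol, id]
    ring
  have h3 := (h1.ofReal_comp.mul_const I).cexp
  refine h3.congr_deriv ?_
  rw [evolutionSymbol]
  ring

/-- `Q e^{itH₀} = e^{itH₀} (Q - 2 t P)`. -/
theorem positionSchwartz_mult_evolutionSymbol (t : ℝ) (f : 𝓢(ℝ, ℂ)) :
    positionSchwartz (mult (evolutionSymbol t) f) =
      mult (evolutionSymbol t) (positionSchwartz f + ((-2 * t : ℝ) : ℂ) • momentumSchwartz f) := by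
  have ht := hasTemperateGrowth_evolutionSymbol t
  refine eq_of_fourier_eq fun ξ => ?_
  have h : ((𝓕 (mult (evolutionSymbol t) f) : 𝓢(ℝ, ℂ)) : ℝ → ℂ) = evolutionSymbol t * (𝓕 f : 𝓢(ℝ, ℂ)) :=
    funext (fourier_mult ht f)
  rw [fourier_positionSchwartz, fourier_mult ht, FourierTransform.fourier_add,
    FourierTransform.fourier_smul, add_apply, smul_apply, smul_eq_mul, fourier_positionSchwartz,
    fourier_momentumSchwartz, h,
    ((hasDerivAt_evolutionSymbol t ξ).mul (𝓕 f : 𝓢(ℝ, ℂ)).differentiableAt.hasDerivAt).deriv]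
  have hpi : (Real.pi : ℂ) ≠ 0 := ofReal_ne_zero.2 Real.pi_ne_zero
  push_cast
  field_simp
  ring_nf
  simp only [I_sq]
  ring

/-- The free motion is a linear canonical transformation, so it preserves the family of operators aP
+ bQ and hence permutes their resolvents. -/
theorem linearSchwartz_mult_evolutionSymbol (a b t : ℝ) (f : 𝓢(ℝ, ℂ)) :
    linearSchwartz (a + 2 * t * b) b (mult (evolutionSymbol t) f) =
      mult (evolutionSymbol t) (linearSchwartz a b f) := by
  rw [linearSchwartz_apply, linearSchwartz_apply, positionSchwartz_mult_evolutionSymbol,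
    momentumSchwartz_mult (hasTemperateGrowth_evolutionSymbol t)]
  simp only [map_add, map_smul]
  push_cast
  module

theorem freeEvolution_mem_graph {a b : ℝ} (t : ℝ) {p : L2R × L2R}
    (hp : p ∈ (schwartzOp (linearSchwartz a b)).closure.graph) :
    (freeEvolution t p.1, freeEvolution t p.2) ∈
      (schwartzOp (linearSchwartz (a + 2 * t * b) b)).closure.graph := by
  refine closure_graph_subset (s := {p | (freeEvolution t p.1, freeEvolution t p.2) ∈
      (schwartzOp (linearSchwartz (a + 2 * t * b) b)).closure.graph})
    ((isClosed_graph_linearSchwartz _ _).preimage (by fun_prop)) (fun f => ?_) hp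
  rw [Set.mem_ofPred_eq, freeEvolution_schwartzIncl, freeEvolution_schwartzIncl,
    ← linearSchwartz_mult_evolutionSymbol]
  exact mem_graph_closure_of_mem (mem_graph_schwartzOp.2 ⟨_, rfl⟩)

theorem freeEvolution_conj_mem_basicResolvents (t : ℝ) {R : BoundedOp} (hR : R ∈ basicResolvents) :
    freeEvolution t * R * freeEvolution (-t) ∈ basicResolvents := by
  obtain ⟨a, b, c, hc, h1, h2⟩ := mem_basicResolvents_iff.1 hR
  have hU : ∀ x, freeEvolution t (freeEvolution (-t) x) = x := fun x => by
    simpa using freeEvolution_neg_apply_apply (-t) x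
  refine mem_basicResolvents_iff.2 ⟨a + 2 * t * b, b, c, hc, fun φ => ?_, fun p hp => ?_⟩
  · have h3 := freeEvolution_mem_graph t (h1 (freeEvolution (-t) φ))
    simp only [map_sub, map_smul, hU] at h3
    exact h3
  · have h3 := freeEvolution_mem_graph (-t) hp
    have h4 : a + 2 * t * b + 2 * -t * b = a := by ring
    rw [h4] at h3
    have h5 := congrArg (freeEvolution t) (h2 _ h3)
    rw [← map_smul, ← map_add, hU] at h5
    exact h5

theorem freeEvolution_conj_mem_resolventAlgebra (t : ℝ) {A : BoundedOp}
    (hA : A ∈ resolventAlgebra) :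
    freeEvolution t * A * freeEvolution (-t) ∈ resolventAlgebra := by
  have hU := isUnitaryGroupOf_freeEvolution
  have hc : Continuous fun A : BoundedOp => freeEvolution t * A * freeEvolution (-t) := by fun_prop
  refine map_mem_closure (f := fun A : BoundedOp => freeEvolution t * A * freeEvolution (-t)) hc hA
    fun A hA => ?_
  refine StarAlgebra.adjoin_induction (p := fun A _ => freeEvolution t * A * freeEvolution (-t) ∈
    StarAlgebra.adjoin ℂ basicResolvents) ?_ ?_ ?_ ?_ ?_ hA
  · exact fun R hR => StarAlgebra.subset_adjoin ℂ _ (freeEvolution_conj_mem_basicResolvents t hR)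
  · intro r
    rw [← Algebra.commutes, mul_assoc, hU.mul_neg_self, mul_one]
    exact algebraMap_mem _ r
  · intro x y _ _ hx hy
    rw [mul_add, add_mul]
    exact add_mem hx hy
  · intro x y _ _ hx hy
    have h : freeEvolution t * (x * y) * freeEvolution (-t) =
        (freeEvolution t * x * freeEvolution (-t)) * (freeEvolution t * y * freeEvolution (-t)) := by
      calc _ = freeEvolution t * x * 1 * y * freeEvolution (-t) := by
            simp only [mul_assoc, one_mul]
        _ = _ := by
            rw [← hU.neg_mul_self t]
            simp only [mul_assoc]
    rw [h]
    exact mul_mem hx hy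
  · intro x _ hx
    have h : freeEvolution t * star x * freeEvolution (-t) =
        star (freeEvolution t * x * freeEvolution (-t)) := by
      rw [star_mul, star_mul, hU.star_eq, hU.star_eq, neg_neg, mul_assoc]
    rw [h]
    exact star_mem hx

end Resolvents

/-! ### The compact operators lie in the resolvent algebra, and stability -/

section CompactsInResolventAlgebra

theorem isClosed_resolventAlgebra : IsClosed (resolventAlgebra : Set BoundedOp) :=
  StarSubalgebra.isClosed_topologicalClosure _

/-- Fourier multipliers form a representation of the bounded continuous functions. -/
def fourierMulHom : (ℝ →ᵇ ℂ) →⋆ₐ[ℂ] BoundedOp :=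
  (fourierL2.symm.conjStarAlgEquiv : BoundedOp →⋆ₐ[ℂ] BoundedOp).comp mulOpHom

theorem fourierMulHom_apply (m : ℝ →ᵇ ℂ) : fourierMulHom m = fourierMul m := by
  ext f : 1
  rfl

theorem continuous_fourierMulHom : Continuous fourierMulHom := by
  have h : (fourierMulHom : (ℝ →ᵇ ℂ) → BoundedOp) = fun m =>
      (fourierL2.symm : L2R →L[ℂ] L2R) * mulOp m * (fourierL2 : L2R →L[ℂ] L2R) :=
    funext fourierMulHom_apply
  rw [h]
  have := continuous_mulOp
  fun_prop

/-- Restriction of continuous functions on the one-point compactification to the line. -/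
def restrictOnePoint : C(OnePoint ℝ, ℂ) →⋆ₐ[ℂ] (ℝ →ᵇ ℂ) where
  toFun f := (BoundedContinuousFunction.mkOfCompact f).compContinuous
    ⟨((↑) : ℝ → OnePoint ℝ), OnePoint.continuous_coe⟩
  map_one' := rfl
  map_mul' _ _ := rfl
  map_zero' := rfl
  map_add' _ _ := rfl
  commutes' _ := rfl
  map_star' _ := rfl

theorem continuous_restrictOnePoint : Continuous restrictOnePoint := by
  refine (LipschitzWith.of_dist_le_mul (K := 1) fun f g => ?_).continuous
  rw [NNReal.coe_one, one_mul]
  refine (BoundedContinuousFunction.dist_le dist_nonneg).2 fun x => ?_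
  exact ContinuousMap.dist_apply_le_dist (f := f) (g := g) _

/-- A closed star subalgebra which contains an injective function vanishing at infinity contains
all the continuous functions vanishing at infinity. -/
theorem mem_of_injective_mem {ρ : (ℝ →ᵇ ℂ) →⋆ₐ[ℂ] BoundedOp} (hρ : Continuous ρ)
    {S : StarSubalgebra ℂ BoundedOp} (hS : IsClosed (S : Set BoundedOp)) {r : ℝ →ᵇ ℂ}
    (hr : Function.Injective r) (hr0 : Tendsto r (cocompact ℝ) (𝓝 0)) (hne : ∀ x, r x ≠ 0)
    (hmem : ρ r ∈ S) {f : ℝ →ᵇ ℂ} (hf : Tendsto f (cocompact ℝ) (𝓝 0)) : ρ f ∈ S := by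
  -- Pulling S back to the one-point compactification makes Stone–Weierstrass applicable. There r
  -- extends by 0, and r being nowhere zero on the line separates infinity from the other points.
  let T : StarSubalgebra ℂ C(OnePoint ℝ, ℂ) := S.comap (ρ.comp restrictOnePoint)
  let ext : ∀ u : ℝ →ᵇ ℂ, Tendsto u (cocompact ℝ) (𝓝 0) → C(OnePoint ℝ, ℂ) := fun u hu =>
    OnePoint.continuousMapMk u.toContinuousMap 0 (by rwa [coclosedCompact_eq_cocompact])
  have hext : ∀ u hu, restrictOnePoint (ext u hu) = u := fun u hu => rfl
  have hT : IsClosed (T : Set C(OnePoint ℝ, ℂ)) :=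
    hS.preimage (hρ.comp continuous_restrictOnePoint)
  have hrT : ext r hr0 ∈ T := by
    change ρ (restrictOnePoint (ext r hr0)) ∈ S
    rwa [hext r hr0]
  have hsep : T.SeparatesPoints := by
    intro x y hxy
    refine ⟨ext r hr0, ⟨_, hrT, rfl⟩, ?_⟩
    induction x using OnePoint.rec with
    | infty =>
      induction y using OnePoint.rec with
      | infty => exact absurd rfl hxy
      | coe y => exact (hne y).symm
    | coe x =>
      induction y using OnePoint.rec with
      | infty => exact hne x
      | coe y => exact fun h => hxy (congrArg _ (hr h))
  have htop := ContinuousMap.starSubalgebra_topologicalClosure_eq_top_of_separatesPoints T hsep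
  have hle : T.topologicalClosure ≤ T := StarSubalgebra.topologicalClosure_minimal le_rfl hT
  have h : ext f hf ∈ T := hle (htop ▸ StarSubalgebra.mem_top)
  change ρ (restrictOnePoint (ext f hf)) ∈ S at h
  rwa [hext f hf] at h

theorem tendsto_invSymbol {a : ℝ → ℝ} (ha : Continuous a) {c : ℝ} (hc : c ≠ 0)
    (hle : ∀ x, |x| ≤ |a x|) : Tendsto (invSymbol a ha hc) (cocompact ℝ) (𝓝 0) := by
  refine squeeze_zero_norm' (a := fun x : ℝ => ‖x‖⁻¹) ?_
    (tendsto_inv_atTop_zero.comp (tendsto_norm_cocompact_atTop (E := ℝ)))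
  filter_upwards [(tendsto_norm_cocompact_atTop (E := ℝ)).eventually_gt_atTop 0] with x hx
  rw [invSymbol_apply, norm_inv]
  refine inv_anti₀ hx ((hle x).trans ?_)
  have h := Complex.abs_re_le_norm ((a x : ℂ) + I * c)
  simpa using h

theorem injective_invSymbol {a : ℝ → ℝ} (ha : Continuous a) {c : ℝ} (hc : c ≠ 0)
    (hinj : Function.Injective a) : Function.Injective (invSymbol a ha hc) := by
  intro x y h
  rw [invSymbol_apply, invSymbol_apply, inv_inj, add_left_inj, ofReal_inj] at h
  exact hinj h

theorem mulOp_mem_resolventAlgebra {f : ℝ →ᵇ ℂ} (hf : Tendsto f (cocompact ℝ) (𝓝 0)) :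
    mulOp f ∈ resolventAlgebra :=
  mem_of_injective_mem (ρ := mulOpHom) continuous_mulOp isClosed_resolventAlgebra
    (r := invSymbol id continuous_id one_ne_zero)
    (injective_invSymbol _ _ Function.injective_id) (tendsto_invSymbol _ _ fun _ => le_rfl)
    (fun x => inv_ne_zero (add_I_mul_ne_zero x one_ne_zero))
    (subset_resolventAlgebra (mulOp_inv_mem_basicResolvents one_ne_zero)) hf

theorem fourierMul_mem_resolventAlgebra {f : ℝ →ᵇ ℂ} (hf : Tendsto f (cocompact ℝ) (𝓝 0)) :
    fourierMul f ∈ resolventAlgebra := by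
  rw [← fourierMulHom_apply]
  refine mem_of_injective_mem continuous_fourierMulHom isClosed_resolventAlgebra
    (r := momentumResolvent one_ne_zero) (injective_invSymbol _ _ ?_) (tendsto_invSymbol _ _ ?_)
    (fun x => inv_ne_zero (add_I_mul_ne_zero _ one_ne_zero)) ?_ hf
  · exact mul_right_injective₀ (by positivity)
  · intro x
    rw [momentumSymbol, abs_mul, abs_of_pos (by positivity : 0 < 2 * Real.pi)]
    nlinarith [Real.pi_gt_three, abs_nonneg x]
  · rw [fourierMulHom_apply]
    exact subset_resolventAlgebra (fourierMul_inv_mem_basicResolvents one_ne_zero)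

theorem schwartz_integral_norm_mul_le (h χ : 𝓢(ℝ, ℂ)) :
    ∫ x, ‖schwartzMul h χ x‖ ≤ ‖schwartzIncl h‖ * ‖schwartzIncl χ‖ := by
  have h2 : ENNReal.ofReal 2 = 2 := by simp
  have hp := integral_mul_norm_le_Lp_mul_Lq (μ := volume) Real.HolderConjugate.two_two
    (f := h) (g := χ) (h2 ▸ h.memLp 2) (h2 ▸ χ.memLp 2)
  have hn : ∀ f : 𝓢(ℝ, ℂ), (∫ x, ‖f x‖ ^ (2 : ℝ)) ^ (1 / 2 : ℝ) = ‖schwartzIncl f‖ := by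
    intro f
    simp_rw [Real.rpow_two]
    rw [← norm_sq_schwartzIncl, ← Real.sqrt_eq_rpow, Real.sqrt_sq (norm_nonneg _)]
  rw [hn, hn] at hp
  simp_rw [schwartzMul_apply, norm_mul]
  exact hp

theorem mult_apply {m : ℝ → ℂ} (hm : Function.HasTemperateGrowth m) (θ : 𝓢(ℝ, ℂ)) (x : ℝ) :
    mult m θ x = ∫ ξ, m ξ * (cexp ((2 * Real.pi * (ξ * x) : ℝ) * I) * 𝓕 θ ξ) := by
  rw [SchwartzMap.fourierMultiplierCLM_apply, SchwartzMap.fourierInv_coe, Real.fourierInv_eq']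
  congr 1
  funext ξ
  rw [SchwartzMap.smulLeftCLM_apply_apply hm, smul_eq_mul, smul_eq_mul, mul_left_comm]
  simp [mul_comm ξ x]

/-- The combined phase is 2πξ(x - y) with |ξ| ≤ δ and |x - y| ≤ 2M on the support of θ, so it is
nearly constant. -/
theorem norm_cexp_mul_fourier_sub_le {θ : 𝓢(ℝ, ℂ)} {M δ x ξ : ℝ}
    (hθ : ∀ y, M < |y| → θ y = 0) (hx : |x| ≤ M) (hξ : |ξ| ≤ δ) :
    ‖cexp ((2 * Real.pi * (ξ * x) : ℝ) * I) * 𝓕 θ ξ - ∫ y, θ y‖ ≤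
      4 * Real.pi * M * δ * ∫ y, ‖θ y‖ := by
  have hM : 0 ≤ M := (abs_nonneg x).trans hx
  have hδ : 0 ≤ δ := (abs_nonneg ξ).trans hξ
  have h1 : cexp ((2 * Real.pi * (ξ * x) : ℝ) * I) * 𝓕 θ ξ =
      ∫ y, cexp (I * (2 * Real.pi * ξ * (x - y) : ℝ)) * θ y := by
    rw [SchwartzMap.fourier_coe, Real.fourier_eq', ← integral_const_mul]
    congr 1
    funext y
    rw [smul_eq_mul, ← mul_assoc, ← Complex.exp_add]
    congr 2
    simp
    ring
  have hi : Integrable fun y => cexp (I * (2 * Real.pi * ξ * (x - y) : ℝ)) * θ y :=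
    θ.integrable.bdd_mul (c := 1) (Continuous.aestronglyMeasurable (by fun_prop))
      (Eventually.of_forall fun y => by rw [mul_comm, norm_exp_ofReal_mul_I])
  rw [h1, ← integral_sub hi θ.integrable, ← integral_const_mul]
  refine norm_integral_le_of_norm_le (θ.integrable.norm.const_mul _) (Eventually.of_forall
    fun y => ?_)
  rw [← sub_one_mul, norm_mul]
  by_cases hy : M < |y|
  · simp [hθ y hy]
  · gcongr
    refine Real.norm_exp_I_mul_ofReal_sub_one_le.trans ?_
    rw [Real.norm_eq_abs, abs_mul, abs_mul, abs_of_pos (by positivity : 0 < 2 * Real.pi)]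
    have h3 : |x - y| ≤ 2 * M := by
      have := abs_sub x y
      linarith [not_lt.1 hy]
    calc 2 * Real.pi * |ξ| * |x - y| ≤ 2 * Real.pi * δ * (2 * M) := by gcongr
      _ = 4 * Real.pi * M * δ := by ring

/-- If `m` is a density concentrated near `0` then `m(P)` is close to `1 ⊗ 1` on functions with
bounded support. -/
theorem norm_mult_sub_integral_le {m : 𝓢(ℝ, ℂ)} {θ : 𝓢(ℝ, ℂ)} {M δ x : ℝ}
    (hm : ∀ ξ, δ < |ξ| → m ξ = 0) (hm1 : ∫ ξ, m ξ = 1) (hm2 : ∫ ξ, ‖m ξ‖ ≤ 1)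
    (hM : 0 ≤ M) (hδ : 0 ≤ δ) (hθ : ∀ y, M < |y| → θ y = 0) (hx : |x| ≤ M) :
    ‖mult m θ x - ∫ y, θ y‖ ≤ 4 * Real.pi * M * δ * ∫ y, ‖θ y‖ := by
  have hi : Integrable fun ξ => m ξ * (cexp ((2 * Real.pi * (ξ * x) : ℝ) * I) * 𝓕 θ ξ) := by
    obtain ⟨C, hC⟩ : ∃ C, ∀ ξ, ‖𝓕 θ ξ‖ ≤ C :=
      ⟨_, (𝓕 θ : 𝓢(ℝ, ℂ)).toBoundedContinuousFunction.norm_coe_le_norm⟩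
    refine m.integrable.mul_bdd (c := C) ?_ (Eventually.of_forall fun ξ => ?_)
    · have := (𝓕 θ : 𝓢(ℝ, ℂ)).continuous
      exact Continuous.aestronglyMeasurable (by fun_prop)
    · rw [norm_mul, norm_exp_ofReal_mul_I, one_mul]
      exact hC ξ
  have h1 : ∫ y, θ y = ∫ ξ, m ξ * ∫ y, θ y := by rw [integral_mul_const, hm1, one_mul]
  rw [mult_apply m.hasTemperateGrowth]
  nth_rewrite 1 [h1]
  rw [← integral_sub hi (m.integrable.mul_const _)]
  have hC0 : 0 ≤ 4 * Real.pi * M * δ * ∫ y, ‖θ y‖ := by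
    have : 0 ≤ ∫ y, ‖θ y‖ := integral_nonneg fun y => norm_nonneg (θ y)
    positivity
  refine (norm_integral_le_of_norm_le
    (m.integrable.norm.mul_const (4 * Real.pi * M * δ * ∫ y, ‖θ y‖))
    (Eventually.of_forall fun ξ => ?_)).trans ?_
  · rw [← mul_sub, norm_mul]
    by_cases hξ : δ < |ξ|
    · simp [hm ξ hξ]
    · gcongr
      exact norm_cexp_mul_fourier_sub_le hθ hx (not_lt.1 hξ)
  · rw [integral_mul_const]
    exact mul_le_of_le_one_left hC0 hm2

/-- The product has kernel f(x) k(x - y) h(y), where k is the inverse Fourier transform of m. As m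
has mass one near 0, k is close to 1 on the bounded supports, which leaves f(x) h(y). The conjugate
h' appears because the rank one operator is conjugate linear in its second vector. -/
theorem norm_mulOp_mul_sub_rankOne_le {f h h' m : 𝓢(ℝ, ℂ)} {M δ : ℝ} (hM : 0 ≤ M) (hδ : 0 ≤ δ)
    (hf : ∀ y, M < |y| → f y = 0) (hh : ∀ y, M < |y| → h y = 0)
    (hh' : ∀ y, h' y = (starRingEnd ℂ) (h y))
    (hm : ∀ ξ, δ < |ξ| → m ξ = 0) (hm1 : ∫ ξ, m ξ = 1) (hm2 : ∫ ξ, ‖m ξ‖ ≤ 1) :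
    ‖mulOp f.toBoundedContinuousFunction * fourierMul m.toBoundedContinuousFunction *
      mulOp h.toBoundedContinuousFunction - rankOne ℂ (schwartzIncl f) (schwartzIncl h')‖ ≤
        4 * Real.pi * M * δ * ‖schwartzIncl h‖ * ‖schwartzIncl f‖ := by
  refine opNorm_le_of_schwartz (by positivity) fun χ => ?_
  set θ := schwartzMul h χ with hθ
  have h1 : (mulOp f.toBoundedContinuousFunction * fourierMul m.toBoundedContinuousFunction *
      mulOp h.toBoundedContinuousFunction - rankOne ℂ (schwartzIncl f) (schwartzIncl h'))
      (schwartzIncl χ) = schwartzIncl (schwartzMul f (mult m θ) - (∫ y, θ y) • f) := by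
    have h2 : mulOp h.toBoundedContinuousFunction (schwartzIncl χ) = schwartzIncl θ :=
      mulOp_schwartzIncl h.toBoundedContinuousFunction h.hasTemperateGrowth χ
    have h3 : fourierMul m.toBoundedContinuousFunction (schwartzIncl θ) =
        schwartzIncl (mult m θ) :=
      fourierMul_schwartzIncl m.toBoundedContinuousFunction m.hasTemperateGrowth θ
    have h4 : mulOp f.toBoundedContinuousFunction (schwartzIncl (mult m θ)) =
        schwartzIncl (schwartzMul f (mult m θ)) :=
      mulOp_schwartzIncl f.toBoundedContinuousFunction f.hasTemperateGrowth _
    have h5 : ⟪schwartzIncl h', schwartzIncl χ⟫_ℂ = ∫ y, θ y := by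
      rw [inner_schwartzIncl]
      congr 1
      funext y
      rw [hθ, schwartzMul_apply, hh', Complex.conj_conj]
    rw [map_sub, map_smul, ← h4, ← h3, ← h2, ← h5]
    rfl
  rw [h1]
  refine (norm_schwartzIncl_le (g := f) (C := 4 * Real.pi * M * δ * ∫ y, ‖θ y‖)
    fun x => ?_).trans ?_
  · rw [sub_apply, smul_apply, schwartzMul_apply, smul_eq_mul, mul_comm (f x), ← sub_mul, norm_mul]
    by_cases hx : M < |x|
    · simp [hf x hx]
    · gcongr
      refine norm_mult_sub_integral_le hm hm1 hm2 hM hδ (fun y hy => ?_) (not_lt.1 hx)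
      rw [hθ, schwartzMul_apply, hh y hy, zero_mul]
  · calc 4 * Real.pi * M * δ * (∫ y, ‖θ y‖) * ‖schwartzIncl f‖ ≤
        4 * Real.pi * M * δ * (‖schwartzIncl h‖ * ‖schwartzIncl χ‖) * ‖schwartzIncl f‖ := by
          gcongr
          exact schwartz_integral_norm_mul_le h χ
      _ = _ := by ring

theorem exists_schwartz_density {δ : ℝ} (hδ : 0 < δ) : ∃ m : 𝓢(ℝ, ℂ),
    HasCompactSupport m ∧ (∀ ξ, δ < |ξ| → m ξ = 0) ∧ ∫ ξ, m ξ = 1 ∧ ∫ ξ, ‖m ξ‖ ≤ 1 := by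
  let φ : ContDiffBump (0 : ℝ) := ⟨δ / 2, δ, by positivity, by linarith⟩
  have hc : HasCompactSupport fun ξ => ((φ.normed volume ξ : ℝ) : ℂ) :=
    φ.hasCompactSupport_normed.comp_left (g := fun r : ℝ => (r : ℂ)) ofReal_zero
  have hs : ContDiff ℝ (⊤ : ℕ∞) fun ξ => ((φ.normed volume ξ : ℝ) : ℂ) :=
    ofRealCLM.contDiff.comp φ.contDiff_normed
  have hm : ∀ ξ, hc.toSchwartzMap hs ξ = ((φ.normed volume ξ : ℝ) : ℂ) := fun ξ => rfl
  refine ⟨hc.toSchwartzMap hs, hc, fun ξ hξ => ?_, ?_, ?_⟩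
  · rw [hm, ofReal_eq_zero, ← Function.notMem_support, φ.support_normed_eq]
    simpa using hξ.le
  · simp_rw [hm]
    rw [integral_complex_ofReal, φ.integral_normed, ofReal_one]
  · simp_rw [hm, Complex.norm_real, Real.norm_of_nonneg (φ.nonneg_normed _)]
    rw [φ.integral_normed]

theorem exists_bound_of_hasCompactSupport {f : ℝ → ℂ} (hf : HasCompactSupport f) :
    ∃ M : ℝ, 0 ≤ M ∧ ∀ y, M < |y| → f y = 0 := by
  obtain ⟨M, hM⟩ := hf.isCompact.isBounded.subset_closedBall (0 : ℝ)
  refine ⟨max M 0, le_max_right _ _, fun y hy => ?_⟩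
  refine image_eq_zero_of_notMem_tsupport fun h => ?_
  have := hM h
  rw [mem_closedBall_zero_iff, Real.norm_eq_abs] at this
  exact absurd (hy.trans_le this) (not_lt.2 (le_max_left _ _))

theorem rankOne_mem_resolventAlgebra_of_hasCompactSupport {f g : 𝓢(ℝ, ℂ)}
    (hf : HasCompactSupport f) (hg : HasCompactSupport g) :
    rankOne ℂ (schwartzIncl f) (schwartzIncl g) ∈ resolventAlgebra := by
  have hhc : HasCompactSupport fun y => (starRingEnd ℂ) (g y) :=
    hg.comp_left (g := starRingEnd ℂ) (map_zero _)
  have hhs : ContDiff ℝ (⊤ : ℕ∞) fun y => (starRingEnd ℂ) (g y) :=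
    conjCLE.contDiff.comp (g.smooth ⊤)
  set h := hhc.toSchwartzMap hhs with hh
  have hgh : ∀ y, g y = (starRingEnd ℂ) (h y) := fun y => (Complex.conj_conj (g y)).symm
  obtain ⟨M₁, hM₁, hf₁⟩ := exists_bound_of_hasCompactSupport hf
  obtain ⟨M₂, hM₂, hh₂⟩ := exists_bound_of_hasCompactSupport (f := h) hhc
  set M := max M₁ M₂ with hMdef
  have hM : 0 ≤ M := hM₁.trans (le_max_left _ _)
  refine isClosed_resolventAlgebra.closure_subset (Metric.mem_closure_iff.2 fun ε hε => ?_)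
  set C := 4 * Real.pi * M * ‖schwartzIncl h‖ * ‖schwartzIncl f‖ with hC
  have hC0 : 0 ≤ C := by positivity
  -- The error is Cδ; dividing by C + 1 makes it strictly less than ε even when C = 0.
  obtain ⟨m, hmc, hm, hm1, hm2⟩ := exists_schwartz_density (δ := ε / (C + 1)) (by positivity)
  refine ⟨mulOp f.toBoundedContinuousFunction * fourierMul m.toBoundedContinuousFunction *
      mulOp h.toBoundedContinuousFunction, mul_mem (mul_mem (mulOp_mem_resolventAlgebra
      hf.is_zero_at_infty) (fourierMul_mem_resolventAlgebra hmc.is_zero_at_infty))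
      (mulOp_mem_resolventAlgebra hhc.is_zero_at_infty), ?_⟩
  rw [dist_comm, dist_eq_norm]
  refine (norm_mulOp_mul_sub_rankOne_le hM (by positivity)
    (fun y hy => hf₁ y ((le_max_left _ _).trans_lt hy))
    (fun y hy => hh₂ y ((le_max_right _ _).trans_lt hy)) hgh hm hm1 hm2).trans_lt ?_
  calc 4 * Real.pi * M * (ε / (C + 1)) * ‖schwartzIncl h‖ * ‖schwartzIncl f‖ =
      ε * (C / (C + 1)) := by rw [hC]; ring
    _ < ε * 1 := by
      gcongr
      rw [div_lt_one (by positivity)]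
      linarith
    _ = ε := mul_one ε

theorem rankOne_mem_of_dense {E : Type*} [NormedAddCommGroup E] [InnerProductSpace ℂ E]
    {S : Set (E →L[ℂ] E)} (hS : IsClosed S) {D : Set E} (hD : Dense D)
    (h : ∀ x ∈ D, ∀ y ∈ D, rankOne ℂ x y ∈ S) (x y : E) : rankOne ℂ x y ∈ S := by
  have hc : Continuous fun p : E × E => (rankOne ℂ p.1 p.2 : E →L[ℂ] E) :=
    continuous_rankOne continuous_fst continuous_snd
  have hp : (x, y) ∈ closure (D ×ˢ D) := (hD.prod hD) (x, y)
  exact hS.closure_subset (map_mem_closure (f := fun p : E × E => (rankOne ℂ p.1 p.2 : E →L[ℂ] E))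
    hc hp fun p hp => h _ hp.1 _ hp.2)

theorem rankOne_mem_resolventAlgebra (x y : L2R) : rankOne ℂ x y ∈ resolventAlgebra := by
  have hd : Dense {u : L2R | ∃ f : 𝓢(ℝ, ℂ), HasCompactSupport f ∧ schwartzIncl f = u} := by
    refine (Lp.dense_hasCompactSupport_contDiff (F := ℂ) (E := ℝ) (μ := volume) (p := 2)
      ENNReal.ofNat_ne_top).mono ?_
    rintro u ⟨g, hg1, hg2, hg3⟩
    exact ⟨hg2.toSchwartzMap hg3, hg2, Lp.ext ((coeFn_schwartzIncl _).trans hg1.symm)⟩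
  refine rankOne_mem_of_dense isClosed_resolventAlgebra hd ?_ x y
  rintro _ ⟨f, hf, rfl⟩ _ ⟨g, hg, rfl⟩
  exact rankOne_mem_resolventAlgebra_of_hasCompactSupport hf hg

/-- The resolvent algebra contains the compact operators. -/
theorem mem_resolventAlgebra_of_isCompactOperator {T : BoundedOp} (hT : IsCompactOperator T) :
    T ∈ resolventAlgebra := by
  refine closure_minimal (s := (finiteRankSpan L2R : Set BoundedOp)) ?_ isClosed_resolventAlgebra
    (mem_closure_finiteRankSpan_of_isCompactOperator hT)
  have : finiteRankSpan L2R ≤ Subalgebra.toSubmodule resolventAlgebra.toSubalgebra := by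
    refine Submodule.span_le.2 ?_
    rintro _ ⟨a, b, rfl⟩
    exact rankOne_mem_resolventAlgebra a b
  exact this

variable {V : ℝ → ℝ}

theorem IsApproximable.isUnitaryGroupOf (h : IsApproximable V) :
    IsUnitaryGroupOf (evolution V) (hamiltonian V).closure := by
  obtain ⟨w, b, hw, hV⟩ := h.exists_decomposition
  exact isUnitaryGroupOf_evolution hw hV

/-- Conjugation by e^{itH} factors through the free conjugation and W = e^{itH} e^{-itH₀}, which
lies in the algebra as 1 plus a compact operator. -/
theorem IsApproximable.conj_mem_resolventAlgebra (h : IsApproximable V) (t : ℝ) {A : BoundedOp}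
    (hA : A ∈ resolventAlgebra) : evolution V t * A * evolution V (-t) ∈ resolventAlgebra := by
  have hU := h.isUnitaryGroupOf
  have hU0 := isUnitaryGroupOf_freeEvolution
  have hW : evolution V t * freeEvolution (-t) ∈ resolventAlgebra := by
    have h1 := add_mem (mem_resolventAlgebra_of_isCompactOperator (h.isCompactOperator t))
      (one_mem resolventAlgebra)
    rwa [sub_add_cancel] at h1
  have h2 : evolution V t * A * evolution V (-t) =
      (evolution V t * freeEvolution (-t)) * (freeEvolution t * A * freeEvolution (-t)) *
        star (evolution V t * freeEvolution (-t)) := by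
    rw [star_mul, hU.star_eq, hU0.star_eq, neg_neg]
    have h3 : ∀ B : BoundedOp, freeEvolution (-t) * (freeEvolution t * B) = B := fun B => by
      rw [← mul_assoc, hU0.neg_mul_self, one_mul]
    simp only [mul_assoc, h3]
  rw [h2]
  exact mul_mem (mul_mem hW (freeEvolution_conj_mem_resolventAlgebra t hA)) (star_mem hW)

theorem IsApproximable.image_conj_resolventAlgebra (h : IsApproximable V) (t : ℝ) :
    (fun A : BoundedOp => evolution V t * A * evolution V (-t)) '' (resolventAlgebra : Set BoundedOp)
      = (resolventAlgebra : Set BoundedOp) := by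
  have hU := h.isUnitaryGroupOf
  -- Equality rather than inclusion comes from applying the inclusion at -t as well.
  refine Set.Subset.antisymm ?_ fun A hA => ⟨_, h.conj_mem_resolventAlgebra (-t) hA, ?_⟩
  · rintro _ ⟨A, hA, rfl⟩
    exact h.conj_mem_resolventAlgebra t hA
  · simp only [neg_neg]
    rw [mul_assoc, mul_assoc, mul_assoc, hU.mul_neg_self, mul_one, ← mul_assoc, hU.mul_neg_self,
      one_mul]

end CompactsInResolventAlgebra

end ResolventAlgebra

end

theorem lemma6p2 (g κ : ℝ) (hκ₀ : 0 < κ) (hκ₁ : κ < 1 / 2) :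
    -- `V` is defined on `𝓓`, so that `H` has domain `𝓓`, and `H` is essentially self-adjoint on `𝓓`
    ((hamiltonian (singularPotential g κ)).domain = schwartzDomain ∧
      IsEssentiallySelfAdjoint (hamiltonian (singularPotential g κ))) ∧
    -- the unitary groups `e^{itH₀}` and `e^{itH}` exist
    IsUnitaryGroupOf freeEvolution freeHamiltonian.closure ∧
    IsUnitaryGroupOf (evolution (singularPotential g κ))
      (hamiltonian (singularPotential g κ)).closure ∧
    -- `e^{itH} e^{-itH₀} - 1` is compact
    (∀ t : ℝ, IsCompactOperator
      (evolution (singularPotential g κ) t * freeEvolution (-t) - 1 : BoundedOp)) ∧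
    -- `ℛ` is stable under the adjoint action of `e^{itH}`
    (∀ t : ℝ, (fun A : BoundedOp => evolution (singularPotential g κ) t * A *
        evolution (singularPotential g κ) (-t)) '' (resolventAlgebra : Set BoundedOp) =
      (resolventAlgebra : Set BoundedOp)) := by
  have h := isApproximable_singularPotential (g := g) hκ₀ hκ₁
  obtain ⟨w, b, hw, hV⟩ := h.exists_decomposition
  exact ⟨⟨domain_hamiltonian (memLp_potential_mul hw hV),
    isEssentiallySelfAdjoint_hamiltonian hw hV⟩, isUnitaryGroupOf_freeEvolution,
    h.isUnitaryGroupOf, h.isCompactOperator, h.image_conj_resolventAlgebra⟩
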